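/- \textbf{Setting.} Let $N\ge 1$ and $m>N+1$ be integers, $\mathbb T^N=(\mathbb R/\mathbb Z)^N$, and let $F=H^{2m}(\mathbb T^N;\mathbb R^N)$ with the norm $\|\mathbf e\|_F=\big(\sum_{|\alpha|\le 2m}\sum_i\|\partial^\alpha \mathbf e_i\|_{L^2}^2\big)^{1/2}$; $\mathbf e(x)$ denotes the value at $x$ of the continuous representative. Let $(E_t(\mathbf e))_{t\ge0}$, $\mathbf e\in F$, be a homogeneous Markov process with càdlàg paths in $F$ and $E_0(\mathbf e)=\mathbf e$, whose law $\mathbb P_{\mathbf e}$ on the path space depends measurably on $\mathbf e$; write $E(t,s;\mathbf e)$, $t\ge s$, for this process started from $\mathbf e$ at time $s$. Let $(\bar E_t)_{t\in\mathbb R}$ be a càdlàg stationary Markov process with the same transition function, of one-dimensional law $\nu$. Suppose that it is a mixing force field, i.e. that there is $R\ge0$ such that, $\bar B_R$ being the closed ball of radius $R$ of $F$: (i) for $\mathbf e\in\bar B_R$, almost surely $\|E_t(\mathbf e)\|_F\le R$ for all $t\ge0$; (ii) $\nu$ is supported in $\bar B_R$ and $\int_F \mathbf e\,d\nu(\mathbf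 e)=0$; (iii) there is a continuous, non-increasing, positive, integrable function $\gamma$ on $[0,\infty)$ such that for all probability measures $\mu,\mu'$ on $F$ supported in $\bar B_R$, the processes $(E_t)_{t\ge 0}$ with initial laws $\mu$ and $\mu'$ admit a coupling $(E^*_t,E^{*\prime}_t)_{t\ge 0}$ with $\mathbb E\|E^*_t-E^{*\prime}_t\|_F\le R\,\gamma(t)$ for all $t\ge0$; (iv) with $R_0(\mathbf e)=\int_0^\infty\mathbb E[E_t(\mathbf e)]\,dt$ and $A$ the generator of the process on $\bar B_R$ (in the sense of bounded pointwise convergence of the difference quotients, for bounded continuous functions), there is $C\ge 0$ such that for every continuous linear form $\Lambda$ on $F$ the functions $\varphi_\Lambda=\Lambda\circ R_0$ and $\varphi_\Lambda^2$ are in the domain of $A$, with $|A\varphi_\Lambda^2|\le C\|\Lambda\|^2$ and $|A\varphi_\Lambda|\le C\|\Lambda\|$ on $\bar B_R$. Let $M(v)=(2\pi)^{-N/2}e^{-|v|^2/2}$ and $\rho(f)=\int_{\mathbb R^N} f\,dv$. Fix $x\in\mathbb T^N$, and in the formulas below write $E(r,s;\mathbf e)$ and $\bar E_r$ for their values at $x$.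 For $f\in L^1(\mathbb R^N)$ and $s\le t$, let $f_{s,t}$ be the explicit solution of $\partial_t f_t+E(t,s;\mathbf e)\cdot\nabla_v f_t=Qf_t$, $f_{t=s}=f$, given by $$f^{\mathrm{LB}}_{s,t}(v)=e^{-(t-s)}f\Big(v-\int_s^tE(r,s;\mathbf e)dr\Big)+\rho(f)\int_s^te^{-(t-\sigma)}M\Big(v-\int_\sigma^tE(r,s;\mathbf e)dr\Big)d\sigma$$ in the linear Boltzmann case $Qf=\rho(f)M-f$, and by $$f^{\mathrm{FP}}_{s,t}(v)=e^{N(t-s)}\int_{\mathbb R^N}f\Big(e^{t-s}v-\int_s^te^{-(s-\sigma)}E(\sigma,s;\mathbf e)d\sigma+\sqrt{e^{2(t-s)}-1}\,w\Big)M(w)dw$$ in the Fokker--Planck case $Qf=\mathrm{div}_v(\nabla_vf+vf)$. Let $$\bar M^{\mathrm{LB}}_t(v)=\int_{-\infty}^te^{-(t-\sigma)}M\Big(v-\int_\sigma^t\bar E_r\,dr\Big)d\sigma,\qquad \bar M^{\mathrm{FP}}_t(v)=M\Big(v-\int_{-\infty}^te^{-(t-r)}\bar E_r\,dr\Big).$$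 \textbf{Theorem (Invariant solutions).} In each of the two cases LB and FP: (a) for all $f\in L^1(\mathbb R^N)$, $\mathbf e\in\bar B_R$ and $t\in\mathbb R$, the functions $f_{s,t}$ ($s\le t$) and $\bar M_t$ are in $L^1(\mathbb R^N)$, and $$(f_{s,t},E(t,s;\mathbf e))\longrightarrow(\rho(f)\bar M_t,\bar E_t)\quad\text{in law on }L^1(\mathbb R^N)\times F\text{ as }s\to-\infty;$$ (b) for every $\rho\in\mathbb R$, the law $\mu_\rho$ of $(\rho\bar M_t,\bar E_t)$ on $L^1(\mathbb R^N)\times F$ does not depend on $t\in\mathbb R$, and it is invariant: if the initial datum $(f,\mathbf e)$ is distributed according to $\mu_\rho$, then so is $(f_{0,\tau},E(\tau,0;\mathbf e))$, for every $\tau\ge0$. -/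

import Mathlib

open MeasureTheory ProbabilityTheory Filter Set
open scoped Topology NNReal ENNReal

namespace KineticMixing

noncomputable section

/-! ### The torus and the state space of the force field -/

/-- The velocity space `ℝ^N` with its Euclidean norm. -/
abbrev Vel (N : ℕ) : Type := EuclideanSpace ℝ (Fin N)

/-- The torus `𝕋^N = (ℝ/ℤ)^N`. -/
abbrev Torus (N : ℕ) : Type := UnitAddTorus (Fin N)

/-- The Haar probability measure (that is, Lebesgue measure) on `𝕋^N`. -/
def torusMeasure (N : ℕ) : Measure (Torus N) :=
  Measure.pi fun _ => AddCircle.haarAddCircle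

instance (N : ℕ) : IsProbabilityMeasure (torusMeasure N) := by
  unfold torusMeasure; infer_instance

/-- The projection `ℝ^N → 𝕋^N`. -/
def toTorus {N : ℕ} (y : Fin N → ℝ) : Torus N := fun i => (y i : UnitAddCircle)

/-- Smooth (`C^∞`) real functions on the torus: those whose periodic lift is smooth. -/
def IsSmooth {N : ℕ} (φ : Torus N → ℝ) : Prop :=
  ContDiff ℝ (⊤ : ℕ∞) fun y : Fin N → ℝ => φ (toTorus y)

/-- The partial derivative `∂φ/∂x_i` on the torus. -/
def torusPartial {N : ℕ} (i : Fin N) (φ : Torus N → ℝ) (x : Torus N) : ℝ :=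
  deriv (fun h : ℝ => φ (x + toTorus (Pi.single i h))) 0

/-- The iterated partial derivative `∂^α φ` on the torus. -/
def torusDeriv {N : ℕ} (α : Fin N → ℕ) (φ : Torus N → ℝ) : Torus N → ℝ :=
  (List.finRange N).foldr (fun i ψ => (torusPartial i)^[α i] ψ) φ

/-- Multi-indices `α ∈ ℕ^N` of length `|α| ≤ k`. -/
abbrev MultiIndex (N k : ℕ) : Type := {α : Fin N → Fin (k + 1) // ∑ i, (α i : ℕ) ≤ k}

/-- The multi-index `0`. -/
def MultiIndex.zero (N k : ℕ) : MultiIndex N k := ⟨0, by simp⟩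

/-- The multi-index as an element of `ℕ^N`. -/
def MultiIndex.val {N k : ℕ} (α : MultiIndex N k) : Fin N → ℕ := fun i => (α.1 i : ℕ)

theorem toTorus_isOpenQuotientMap (N : ℕ) : IsOpenQuotientMap (toTorus (N := N)) :=
  IsOpenQuotientMap.piMap fun _ => QuotientAddGroup.isOpenQuotientMap_mk

theorem IsSmooth.continuous {N : ℕ} {φ : Torus N → ℝ} (h : IsSmooth φ) : Continuous φ := by
  rw [← (toTorus_isOpenQuotientMap N).continuous_comp_iff]
  exact ContDiff.continuous h

theorem IsSmooth.torusPartial {N : ℕ} {φ : Torus N → ℝ} (h : IsSmooth φ) (i : Fin N) :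
    IsSmooth (torusPartial i φ) := by
  have key : (fun y : Fin N → ℝ => KineticMixing.torusPartial i φ (toTorus y)) =
      fun y => fderiv ℝ (fun z : Fin N → ℝ => φ (toTorus z)) y (Pi.single i 1) := by
    funext y
    have hd : HasDerivAt (fun t : ℝ => y + (Pi.single i t : Fin N → ℝ)) (Pi.single i 1) 0 := by
      have := (hasDerivAt_id (0 : ℝ)).smul_const (Pi.single i 1 : Fin N → ℝ)
      have h2 := this.const_add y
      simp only [one_smul] at h2
      refine h2.congr_of_eventuallyEq (Eventually.of_forall fun t => ?_)
      simp [← Pi.single_smul]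
    have hy : HasFDerivAt (fun z : Fin N → ℝ => φ (toTorus z))
        (fderiv ℝ (fun z : Fin N → ℝ => φ (toTorus z)) y)
        (y + (Pi.single i (0 : ℝ) : Fin N → ℝ)) := by
      have : y + (Pi.single i (0 : ℝ) : Fin N → ℝ) = y := by simp
      rw [this]
      exact ((ContDiff.differentiable h (by simp)) y).hasFDerivAt
    have := hy.comp_hasDerivAt (0 : ℝ) hd
    have e : (fun t : ℝ => φ (toTorus y + toTorus (Pi.single i t))) =
        (fun z : Fin N → ℝ => φ (toTorus z)) ∘
          fun t : ℝ => y + (Pi.single i t : Fin N → ℝ) := by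
      funext t
      simp only [Function.comp]
      congr 1
    unfold KineticMixing.torusPartial
    rw [e]
    exact this.deriv
  unfold IsSmooth
  rw [key]
  exact (ContDiff.fderiv_right (m := (⊤ : ℕ∞)) h (by simp)).clm_apply contDiff_const

theorem IsSmooth.torusDeriv {N : ℕ} {φ : Torus N → ℝ} (h : IsSmooth φ) (α : Fin N → ℕ) :
    IsSmooth (torusDeriv α φ) := by
  unfold KineticMixing.torusDeriv
  induction List.finRange N with
  | nil => exact h
  | cons i l ih =>
    simp only [List.foldr_cons]
    generalize α i = n
    induction n with
    | zero => exact ih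
    | succ n ihn =>
      rw [Function.iterate_succ_apply']
      exact ihn.torusPartial i

/-- `g` is the weak derivative `∂^α u` of `u ∈ L²(𝕋^N; ℝ^N)`:
`∫ ∂^α φ u dx = (-1)^|α| ∫ φ g dx` for all `φ ∈ C^∞(𝕋^N)`. -/
def IsWeakDeriv {N : ℕ} (α : Fin N → ℕ) (u g : Lp (Vel N) 2 (torusMeasure N)) : Prop :=
  ∀ φ : Torus N → ℝ, IsSmooth φ →
    ∫ x, torusDeriv α φ x • u x ∂(torusMeasure N) =
      (-1 : ℝ) ^ (∑ i, α i) • ∫ x, φ x • g x ∂(torusMeasure N)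

theorem integrable_smul_of_continuous {N : ℕ} {φ : Torus N → ℝ} (h : Continuous φ)
    (u : Lp (Vel N) 2 (torusMeasure N)) :
    Integrable (fun x => φ x • u x) (torusMeasure N) := by
  have hu : Integrable u (torusMeasure N) := (Lp.memLp u).integrable (by norm_num)
  obtain ⟨C, hC⟩ := (isCompact_range h).isBounded.exists_norm_le
  exact hu.bdd_smul C h.aestronglyMeasurable
    (Eventually.of_forall fun x => hC _ (mem_range_self x))

/-- The Sobolev space `H^k(𝕋^N; ℝ^N)`, an element being represented by the family
`(∂^α u)_{|α| ≤ k}` of its weak derivatives in `L²`. The (Hilbertian) norm inherited from the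
ambient `ℓ²`-sum of copies of `L²(𝕋^N; ℝ^N)` is
`‖u‖ = (∑_{|α| ≤ k} ∑_i ‖∂^α u_i‖²_{L²})^{1/2}`. -/
def sobolev (N k : ℕ) :
    Submodule ℝ (PiLp 2 fun _ : MultiIndex N k => Lp (Vel N) 2 (torusMeasure N)) where
  carrier := {u | ∀ α : MultiIndex N k, IsWeakDeriv α.val (u (MultiIndex.zero N k)) (u α)}
  add_mem' := by
    intro u w hu hw α φ hφ
    have h1 : ∀ (ψ : Torus N → ℝ), Continuous ψ → ∀ β : MultiIndex N k,
        ∫ x, ψ x • (u + w) β x ∂(torusMeasure N) =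
          ∫ x, ψ x • u β x ∂(torusMeasure N) + ∫ x, ψ x • w β x ∂(torusMeasure N) := by
      intro ψ hψ β
      rw [← integral_add (integrable_smul_of_continuous hψ _)
        (integrable_smul_of_continuous hψ _)]
      refine integral_congr_ae ?_
      filter_upwards [Lp.coeFn_add (u β) (w β)] with x hx
      change ψ x • (u β + w β : Lp (Vel N) 2 (torusMeasure N)) x = _
      rw [hx, Pi.add_apply, smul_add]
    rw [h1 _ (hφ.torusDeriv _).continuous, h1 _ hφ.continuous, hu α φ hφ, hw α φ hφ, smul_add]
  zero_mem' := by
    intro α φ hφ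
    have h1 : ∀ (ψ : Torus N → ℝ) (β : MultiIndex N k),
        ∫ x, ψ x • (0 : PiLp 2 fun _ : MultiIndex N k => Lp (Vel N) 2 (torusMeasure N)) β x
          ∂(torusMeasure N) = 0 := by
      intro ψ β
      refine (integral_congr_ae ?_).trans (integral_zero _ _)
      filter_upwards [Lp.coeFn_zero (Vel N) 2 (torusMeasure N)] with x hx
      change ψ x • (0 : Lp (Vel N) 2 (torusMeasure N)) x = _
      rw [hx, Pi.zero_apply, smul_zero]
    rw [h1, h1, smul_zero]
  smul_mem' := by
    intro c u hu α φ hφ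
    have h1 : ∀ (ψ : Torus N → ℝ) (β : MultiIndex N k),
        ∫ x, ψ x • (c • u) β x ∂(torusMeasure N) =
          c • ∫ x, ψ x • u β x ∂(torusMeasure N) := by
      intro ψ β
      rw [← integral_smul]
      refine integral_congr_ae ?_
      filter_upwards [Lp.coeFn_smul c (u β)] with x hx
      change ψ x • (c • u β : Lp (Vel N) 2 (torusMeasure N)) x = _
      rw [hx, Pi.smul_apply, smul_comm]
    rw [h1, h1, hu α φ hφ, smul_comm]

/-- The state space `F = H^{2m}(𝕋^N; ℝ^N)` of the force field. -/
abbrev ForceSpace (N m : ℕ) : Type := ↥(sobolev N (2 * m))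

instance (N m : ℕ) : MeasurableSpace (ForceSpace N m) := borel _

instance (N m : ℕ) : BorelSpace (ForceSpace N m) := ⟨rfl⟩

instance (N m : ℕ) : SecondCountableTopology (ForceSpace N m) := by
  have : Fact ((2 : ℝ≥0∞) ≠ ∞) := ⟨by norm_num⟩
  have : SecondCountableTopology (Lp (Vel N) 2 (torusMeasure N)) := Lp.SecondCountableTopology
  have := PiLp.secondCountableTopology 2
    fun _ : MultiIndex N (2 * m) => Lp (Vel N) 2 (torusMeasure N)
  exact TopologicalSpace.Subtype.secondCountableTopology _

open Classical in
/-- The value `𝐞(x)` at `x ∈ 𝕋^N` of (the continuous representative of) a force field `𝐞 ∈ F`. -/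
def forceAt {N m : ℕ} (x : Torus N) (e : ForceSpace N m) : Vel N :=
  if h : ∃ g : C(Torus N, Vel N), g =ᵐ[torusMeasure N] e.1 (MultiIndex.zero N (2 * m))
    then h.choose x else 0

/-! ### Càdlàg Markov processes -/

section Processes

variable {ι S Ω : Type*}

/-- Right-continuous functions with left limits. -/
def IsCadlag [LinearOrder ι] [TopologicalSpace ι] [TopologicalSpace S] (X : ι → S) : Prop :=
  ∀ t, ContinuousWithinAt X (Ici t) t ∧ ∃ l, Tendsto X (𝓝[<] t) (𝓝 l)

/-- The path space `D([0,∞); S)`, with the trace of the product `σ`-algebra. -/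
abbrev CadlagPath (S : Type*) [TopologicalSpace S] : Type _ := {ω : ℝ≥0 → S // IsCadlag ω}

/-- `X` is, under `μ`, a time-homogeneous Markov process (with respect to the filtration it
generates) with transition function `P`: `μ(X_t ∈ B | X_r, r ≤ s) = P_{t-s}(X_s, B)`. The index
set is `ℝ≥0` or `ℝ`, and `nndist s t` is the elapsed time `t - s`. -/
def IsMarkovProcess [Preorder ι] [PseudoMetricSpace ι] [MeasurableSpace S] [MeasurableSpace Ω]
    (P : ℝ≥0 → Kernel S S) (μ : Measure Ω) (X : ι → Ω → S) : Prop :=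
  ∀ s t, s ≤ t → ∀ B, MeasurableSet B →
    μ⟦X t ⁻¹' B | ⨆ r, ⨆ _ : r ≤ s, MeasurableSpace.comap (X r) inferInstance⟧
      =ᵐ[μ] fun ω => (P (nndist s t) (X s ω)).real B

variable [TopologicalSpace S] [MeasurableSpace S]

/-- The transition function `P(t, e, B) = ℙ_e(E_t ∈ B)` of a family `(ℙ_e)_e` of laws on the
path space. -/
def transition (law : Kernel S (CadlagPath S)) (t : ℝ≥0) : Kernel S S :=
  law.map fun ω => ω.1 t

/-- `(ℙ_e)_{e ∈ S}` is the family of laws of a càdlàg homogeneous Markov process `(E_t(e))_{t ≥ 0}`,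
realised as the canonical process on the path space: `E_0(e) = e`, and the Markov property with
transition function `P(t, e, B) = ℙ_e(E_t ∈ B)`. -/
structure IsMarkovFamily (law : Kernel S (CadlagPath S)) : Prop where
  start : ∀ e, ∀ᵐ ω ∂(law e), ω.1 0 = e
  markov : ∀ e, IsMarkovProcess (transition law) (law e) fun (t : ℝ≥0) (ω : CadlagPath S) => ω.1 t

/-- `(Ebar_t)_{t ∈ ℝ}` is, under `Pr`, a càdlàg stationary Markov process, indexed by the whole real
line, with the transition function of the family `(ℙ_e)`. -/
structure IsStationaryMarkov [MeasurableSpace Ω] (law : Kernel S (CadlagPath S))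
    (Pr : Measure Ω) (Ebar : ℝ → Ω → S) : Prop where
  measurable : ∀ t, Measurable (Ebar t)
  cadlag : ∀ ω, IsCadlag fun t => Ebar t ω
  stationary : ∀ t, Pr.map (Ebar t) = Pr.map (Ebar 0)
  markov : IsMarkovProcess (transition law) Pr Ebar

/-- The semigroup `(P_t φ)(e) = 𝔼 φ(E_t(e))`. -/
def semigroup (law : Kernel S (CadlagPath S)) (t : ℝ≥0) (φ : S → ℝ) (e : S) : ℝ :=
  ∫ y, φ y ∂(transition law t e)

/-- `φ` belongs to the domain of the generator `A` of the process on the stable subset `B` of the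
state space, and `A φ = ψ`, in the sense of bounded pointwise convergence: `φ` and `ψ` are bounded
continuous on `B`, the difference quotients `(P_t φ - φ)/t`, `0 < t < 1`, are uniformly bounded on
`B`, and they converge to `ψ` pointwise on `B` as `t → 0+`. -/
def HasGenerator (law : Kernel S (CadlagPath S)) (B : Set S) (φ ψ : S → ℝ) : Prop :=
  ContinuousOn φ B ∧ (∃ C, ∀ e ∈ B, |φ e| ≤ C) ∧
  ContinuousOn ψ B ∧ (∃ C, ∀ e ∈ B, |ψ e| ≤ C) ∧
  (∃ C, ∀ t : ℝ≥0, 0 < t → t < 1 → ∀ e ∈ B, |(t : ℝ)⁻¹ * (semigroup law t φ e - φ e)| ≤ C) ∧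
  ∀ e ∈ B, Tendsto (fun t : ℝ≥0 => (t : ℝ)⁻¹ * (semigroup law t φ e - φ e)) (𝓝[>] 0) (𝓝 (ψ e))

end Processes

section Mixing

variable {F Ω : Type*} [NormedAddCommGroup F] [NormedSpace ℝ F] [MeasurableSpace F]
  [MeasurableSpace Ω]

/-- The resolvent at `0`: `R_0(e) = ∫_0^∞ 𝔼[E_t(e)] dt`. -/
def resolventZero (law : Kernel F (CadlagPath F)) (e : F) : F :=
  ∫ t in Ioi (0 : ℝ), ∫ y, y ∂(transition law t.toNNReal e)

/-- Mixing force field: `Ebar` is a càdlàg stationary homogeneous Markov process, `law e` is the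
law of the process `(E_t(e))_{t ≥ 0}` with the same transition function started from `e`, and the
ball of radius `R` is stable and attracts at an integrable rate. -/
structure IsMixingForceField (R : ℝ) (law : Kernel F (CadlagPath F)) (Pr : Measure Ω)
    (Ebar : ℝ → Ω → F) : Prop where
  markovFamily : IsMarkovFamily law
  stationaryMarkov : IsStationaryMarkov law Pr Ebar
  radius_nonneg : 0 ≤ R
  /-- the closed ball of radius `R` is stable -/
  stable_ball : ∀ e : F, ‖e‖ ≤ R → ∀ᵐ ω ∂(law e), ∀ t : ℝ≥0, ‖ω.1 t‖ ≤ R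
  /-- the stationary law is supported in the ball -/
  support : ∀ᵐ e ∂(Pr.map (Ebar 0)), ‖e‖ ≤ R
  /-- the stationary law is centred -/
  centred : ∫ e, e ∂(Pr.map (Ebar 0)) = 0
  /-- mixing: processes with initial laws `μ`, `μ'` carried by the ball can be coupled so that
  `𝔼 ‖E*_t - E'*_t‖ ≤ R γ(t)` -/
  mixing : ∃ γ : ℝ → ℝ, ContinuousOn γ (Ici 0) ∧ AntitoneOn γ (Ici 0) ∧ (∀ t, 0 ≤ t → 0 < γ t) ∧
    IntegrableOn γ (Ici 0) ∧
    ∀ μ μ' : Measure F, IsProbabilityMeasure μ → IsProbabilityMeasure μ' →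
      (∀ᵐ e ∂μ, ‖e‖ ≤ R) → (∀ᵐ e ∂μ', ‖e‖ ≤ R) →
      ∃ Γ : Measure (CadlagPath F × CadlagPath F),
        Γ.fst = μ.bind law ∧ Γ.snd = μ'.bind law ∧
        ∀ t : ℝ≥0, ∫⁻ p, ‖p.1.1 t - p.2.1 t‖ₑ ∂Γ ≤ ENNReal.ofReal (R * γ t)
  /-- bounds on the generator applied to `φ_Λ = Λ ∘ R_0` and to its square -/
  generator_bound : ∃ C : ℝ, 0 ≤ C ∧ ∀ Λ : F →L[ℝ] ℝ, ∃ ψ₁ ψ₂ : F → ℝ,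
    HasGenerator law (Metric.closedBall 0 R) (fun e => Λ (resolventZero law e)) ψ₁ ∧
    HasGenerator law (Metric.closedBall 0 R) (fun e => Λ (resolventZero law e) ^ 2) ψ₂ ∧
    ∀ e : F, ‖e‖ ≤ R → |ψ₂ e| ≤ C * ‖Λ‖ ^ 2 ∧ |ψ₁ e| ≤ C * ‖Λ‖

end Mixing

/-! ### The unperturbed kinetic equation -/

/-- The Banach space `L¹(ℝ^N)`. -/
abbrev L1 (N : ℕ) : Type := Lp ℝ 1 (volume : Measure (Vel N))

instance (N : ℕ) : MeasurableSpace (L1 N) := borel _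

instance (N : ℕ) : BorelSpace (L1 N) := ⟨rfl⟩

open Classical in
/-- The class in `L¹(ℝ^N)` of an integrable function (and `0` otherwise). -/
def toL1 {N : ℕ} (g : Vel N → ℝ) : L1 N :=
  if h : Integrable g then h.toL1 g else 0

/-- The density `ρ(f) = ∫ f(v) dv`. -/
def density {N : ℕ} (f : Vel N → ℝ) : ℝ := ∫ v, f v

/-- The Maxwellian `M(v) = (2π)^{-N/2} exp(-|v|²/2)`. -/
def maxwellian {N : ℕ} (v : Vel N) : ℝ :=
  (2 * Real.pi) ^ (-(N : ℝ) / 2) * Real.exp (-‖v‖ ^ 2 / 2)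

/-- The two collision operators: linear Boltzmann, `Q f = ρ(f) M - f`, and Fokker-Planck,
`Q f = div_v (∇_v f + v f)`. -/
inductive Collision
  | LB
  | FP

/-- The solution at time `t`, in closed form, of `∂_t f_t + E(t) · ∇_v f_t = Q f_t`, `t > s`,
`f_s = f`. -/
def solution {N : ℕ} (Q : Collision) (f : Vel N → ℝ) (E : ℝ → Vel N) (s t : ℝ) (v : Vel N) : ℝ :=
  match Q with
  | .LB => Real.exp (-(t - s)) * f (v - ∫ r in s..t, E r) +
      density f * ∫ σ in s..t, Real.exp (-(t - σ)) * maxwellian (v - ∫ r in σ..t, E r)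
  | .FP => Real.exp (N * (t - s)) * ∫ w : Vel N,
      f (Real.exp (t - s) • v - (∫ σ in s..t, Real.exp (-(s - σ)) • E σ) +
        √(Real.exp (2 * (t - s)) - 1) • w) * maxwellian w

/-- The invariant solutions `Mbar_t` driven by `(E_r)_{r ∈ ℝ}`. -/
def invariantSolution {N : ℕ} (Q : Collision) (E : ℝ → Vel N) (t : ℝ) (v : Vel N) : ℝ :=
  match Q with
  | .LB => ∫ σ in Iic t, Real.exp (-(t - σ)) * maxwellian (v - ∫ r in σ..t, E r)
  | .FP => maxwellian (v - ∫ r in Iic t, Real.exp (-(t - r)) • E r)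

/-- On the canonical path space, `E(t, s; e) = ω(t - s)`, `t ≥ s`, under the law `ℙ_e`. -/
def forceFrom {S : Type*} [TopologicalSpace S] (s : ℝ) (ω : CadlagPath S) (t : ℝ) : S :=
  ω.1 (t - s).toNNReal

/-- The pair `(f_{s,t}, E(t,s;e)) ∈ L¹(ℝ^N) × F`, as a function of the path; the position `x` is a
parameter. -/
def statePair {N m : ℕ} (Q : Collision) (x : Torus N) (f : L1 N) (s t : ℝ)
    (ω : CadlagPath (ForceSpace N m)) : L1 N × ForceSpace N m :=
  (toL1 (solution Q f (fun r => forceAt x (forceFrom s ω r)) s t), forceFrom s ω t)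

/-- The pair `(ρ Mbar_t, Ebar_t) ∈ L¹(ℝ^N) × F`. -/
def limitPair {N m : ℕ} {Ω : Type*} (Q : Collision) (x : Torus N) (ρ : ℝ)
    (Ebar : ℝ → Ω → ForceSpace N m) (t : ℝ) (ω : Ω) : L1 N × ForceSpace N m :=
  (ρ • toL1 (invariantSolution Q (fun r => forceAt x (Ebar r ω)) t), Ebar t ω)

/-- The law at time `τ` of the pair `(f_{0,τ}, E(τ,0;e))` started at time `0` from `(f, e)`: the
transition function of the Markov process `(f_t, E_t)` on `L¹(ℝ^N) × F`. -/
def stepLaw {N m : ℕ} (Q : Collision) (x : Torus N)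
    (law : Kernel (ForceSpace N m) (CadlagPath (ForceSpace N m))) (τ : ℝ≥0)
    (z : L1 N × ForceSpace N m) : Measure (L1 N × ForceSpace N m) :=
  (law z.2).map (statePair Q x z.1 0 τ)

end

end KineticMixing

open KineticMixing

namespace KineticMixing

noncomputable section

/-! ### Fourier decay of the functions in `H^{2m}` of the torus -/

section Sobolev

variable {N : ℕ}

/-! In both closed formulas the force acts only through translations in velocity. Translations
preserve the `L¹` norm, and the translates of the Maxwellian `M` are Lipschitz in the shift
(`lintegral_maxwellian_sub_le`). Three deterministic estimates follow. Relaxation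
(`exists_relaxation`): uniformly in the force, the solution from `f` approaches `ρ(f)` times the
solution from `M`. In the LB case the difference is a translate of `e^{-(t-s)}(f - ρ(f)M)`. In the
FP case it is a translate of the same difference for the force-free Ornstein-Uhlenbeck semigroup,
which is handled with the Mehler kernel. Stability (`lintegral_solution_maxwellian_sub_le`):
replacing the force `E` by `E'` in the solution from `M` costs at most a constant times `∫_s^t
e^{-(t-r)} |E_r - E'_r| dr`. Remote past (`lintegral_solution_sub_invariantSolution_le`): for a
force bounded up to time `t`, the solution from `M` started at `s` is `O(e^{-(t-s)})` away from
`Mbar_t`.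

Convergence in law is a coupling argument. Mixing couples the process started from `e` with the one
started from the stationary law `ν`, at mean distance at most `R γ`. As `γ` is integrable, the
exponentially weighted integral of the distance vanishes at infinity; as `γ` is moreover monotone,
so does the distance at the final time (`exists_coupling`). For every `s`, the path of the
stationary process from time `s` on has the law of the process started from `ν` (`map_pathFrom`), so
one coupling serves for all `s`. Bounded Lipschitz test functions conclude
(`tendstoInDistribution_of_coupling`).

The law of the limit is independent of `t` because the approximating pairs depend on `t - s` only
and limits in law are unique (`map_limitPair_eq`). Invariance combines a pathwise and a
probabilistic fact: `Mbar` solves the equation along almost every path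
(`solution_invariantSolution`), and `Mbar_0` is a function of the past, given which the future path
has the law of the process started from `Ebar_0` (`map_pathFrom_restrict`).

Evaluation at `x` enters all this as a bounded linear map on `F`, by Sobolev embedding
(`exists_forceAt_eq_clm`). -/

theorem summable_norm_inv_pow_int {n : ℕ} (hn : N < n) :
    Summable fun k : Fin N → ℤ => (‖k‖ ^ n)⁻¹ := by
  let b := Pi.basisFun ℝ (Fin N)
  let L := Submodule.span ℤ (Set.range b)
  let b' := b.restrictScalars ℤ
  have hrank : Module.finrank ℤ L = N := by
    rw [Module.finrank_eq_card_basis b']; simp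
  have h := ZLattice.summable_norm_pow_inv L n (by rw [hrank]; exact hn)
  rw [← b'.equivFun.toEquiv.symm.summable_iff] at h
  refine h.congr fun k => ?_
  have hk : ((b'.equivFun.symm k : L) : Fin N → ℝ) = fun i => (k i : ℝ) := by
    rw [Module.Basis.equivFun_symm_apply]
    ext j
    simp [b', b, Pi.single_apply]
  -- Both sides are sup norms, so integer coordinates identify `ℤ^N` with the lattice isometrically.
  have : ‖b'.equivFun.symm k‖ = ‖k‖ := by
    change ‖((b'.equivFun.symm k : L) : Fin N → ℝ)‖ = ‖k‖
    rw [hk]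
    rfl
  change ‖b'.equivFun.symm k‖⁻¹ ^ n = _
  rw [this, inv_pow]

/-- The real trigonometric monomial `Re (c e^{2πi n·x})`. -/
def trigMonomial (n : Fin N → ℤ) (c : ℂ) (x : Torus N) : ℝ :=
  (c * UnitAddTorus.mFourier n x).re

theorem mFourier_toTorus (n : Fin N → ℤ) (y : Fin N → ℝ) :
    UnitAddTorus.mFourier n (toTorus y) =
      Complex.exp (2 * Real.pi * Complex.I * ∑ i, (n i : ℂ) * (y i : ℂ)) := by
  simp only [UnitAddTorus.mFourier, ContinuousMap.coe_mk, toTorus]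
  simp only [fourier_coe_apply, Complex.ofReal_one, div_one]
  rw [← Complex.exp_sum, Finset.mul_sum]
  congr 1
  exact Finset.sum_congr rfl fun i _ => by ring

theorem mFourier_add_point (n : Fin N → ℤ) (x y : Torus N) :
    UnitAddTorus.mFourier n (x + y) = UnitAddTorus.mFourier n x * UnitAddTorus.mFourier n y := by
  simp only [UnitAddTorus.mFourier, ContinuousMap.coe_mk, ← Finset.prod_mul_distrib]
  refine Finset.prod_congr rfl fun i _ => ?_
  simp [fourier_apply, AddCircle.toCircle_add, smul_add]

theorem isSmooth_trigMonomial (n : Fin N → ℤ) (c : ℂ) : IsSmooth (trigMonomial n c) := by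
  unfold IsSmooth trigMonomial
  simp only [mFourier_toTorus]
  refine Complex.reCLM.contDiff.comp (contDiff_const.mul (ContDiff.cexp ?_))
  refine contDiff_const.mul (ContDiff.sum fun i _ => contDiff_const.mul ?_)
  exact Complex.ofRealCLM.contDiff.comp (contDiff_apply ℝ ℝ i)

theorem torusPartial_trigMonomial (n : Fin N → ℤ) (c : ℂ) (i : Fin N) :
    torusPartial i (trigMonomial n c) = trigMonomial n (2 * Real.pi * Complex.I * n i * c) := by
  funext x
  unfold torusPartial trigMonomial
  have h (t : ℝ) : (c * UnitAddTorus.mFourier n (x + toTorus (Pi.single i t))).re =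
      Complex.reCLM (c * UnitAddTorus.mFourier n x *
        Complex.exp (t * (2 * Real.pi * Complex.I * n i))) := by
    rw [mFourier_add_point, mFourier_toTorus, Finset.sum_eq_single i]
    · rw [Pi.single_eq_same, mul_assoc c]
      simp only [Complex.reCLM_apply]
      congr 4
      ring
    · intro j _ hj; rw [Pi.single_eq_of_ne hj]; simp
    · simp
  simp only [h]
  have h1 : HasDerivAt (fun t : ℝ => Complex.exp ((t : ℂ) * (2 * Real.pi * Complex.I * n i)))
      (2 * Real.pi * Complex.I * n i) 0 := by
    have := ((hasDerivAt_id (0 : ℂ)).mul_const (2 * Real.pi * Complex.I * n i)).cexp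
    simpa using this.comp_ofReal
  have h2 := Complex.reCLM.hasFDerivAt.comp_hasDerivAt (0 : ℝ)
    (h1.const_mul (c * UnitAddTorus.mFourier n x))
  refine h2.deriv.trans ?_
  simp only [Complex.reCLM_apply]
  congr 1
  ring

theorem iterate_torusPartial_trigMonomial (n : Fin N → ℤ) (c : ℂ) (i : Fin N) (p : ℕ) :
    (torusPartial i)^[p] (trigMonomial n c) =
      trigMonomial n ((2 * Real.pi * Complex.I * n i) ^ p * c) := by
  induction p with
  | zero => simp
  | succ p ih =>
    rw [Function.iterate_succ_apply', ih, torusPartial_trigMonomial]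
    congr 1
    ring

theorem torusDeriv_single (i : Fin N) (p : ℕ) (φ : Torus N → ℝ) :
    torusDeriv (Pi.single i p) φ = (torusPartial i)^[p] φ := by
  have key : ∀ l : List (Fin N), l.Nodup →
      l.foldr (fun j ψ => (torusPartial j)^[(Pi.single i p : Fin N → ℕ) j] ψ) φ =
        if i ∈ l then (torusPartial i)^[p] φ else φ := by
    intro l
    induction l with
    | nil => simp
    | cons j l ih =>
      intro hl
      rw [List.nodup_cons] at hl
      simp only [List.foldr_cons, ih hl.2]
      by_cases hij : j = i
      · subst hij; simp [hl.1]
      · have : i ≠ j := fun h => hij h.symm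
        simp [hij, this]
  simp [torusDeriv, key _ (List.nodup_finRange N)]

/-- The multi-index `p e_i`. -/
def MultiIndex.single {p : ℕ} (i : Fin N) : MultiIndex N p :=
  ⟨Pi.single i (Fin.last p), by
    rw [Finset.sum_eq_single i]
    · simp
    · intro j _ hj; simp [Pi.single_eq_of_ne hj]
    · simp⟩

theorem MultiIndex.val_single {p : ℕ} (i : Fin N) :
    (MultiIndex.single i : MultiIndex N p).val = Pi.single i p := by
  funext j
  by_cases h : j = i
  · subst h; simp [MultiIndex.single, MultiIndex.val]
  · simp [MultiIndex.single, MultiIndex.val, Pi.single_eq_of_ne h]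

theorem norm_component_le {k : ℕ} (u : sobolev N k) (α : MultiIndex N k) : ‖u.1 α‖ ≤ ‖u‖ :=
  PiLp.norm_apply_le u.1 α

theorem norm_integral_smul_le {φ : Torus N → ℝ} (hφ : ∀ x, |φ x| ≤ 1)
    (u : Lp (Vel N) 2 (torusMeasure N)) :
    ‖∫ x, φ x • u x ∂(torusMeasure N)‖ ≤ ‖u‖ := by
  refine (norm_integral_le_integral_norm _).trans ?_
  have hu : Integrable u (torusMeasure N) := (Lp.memLp u).integrable (by norm_num)
  have h1 : ∫ x, ‖φ x • u x‖ ∂(torusMeasure N) ≤ ∫ x, ‖u x‖ ∂(torusMeasure N) := by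
    refine integral_mono_of_nonneg (Eventually.of_forall fun _ => norm_nonneg _) hu.norm
      (Eventually.of_forall fun x => ?_)
    simp only [norm_smul, Real.norm_eq_abs]
    exact mul_le_of_le_one_left (norm_nonneg _) (hφ x)
  refine h1.trans ?_
  rw [integral_norm_eq_lintegral_enorm hu.aestronglyMeasurable, ← eLpNorm_one_eq_lintegral_enorm,
    Lp.norm_def]
  exact ENNReal.toReal_mono (Lp.eLpNorm_ne_top u)
    (eLpNorm_le_eLpNorm_of_exponent_le (by norm_num) (Lp.aestronglyMeasurable u))

theorem abs_trigMonomial_le (n : Fin N → ℤ) {c : ℂ} (hc : ‖c‖ ≤ 1) (x : Torus N) :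
    |trigMonomial n c x| ≤ 1 := by
  refine (Complex.abs_re_le_norm _).trans ?_
  rw [norm_mul]
  have := (UnitAddTorus.mFourier n).norm_coe_le_norm x
  rw [UnitAddTorus.mFourier_norm] at this
  nlinarith [norm_nonneg c, norm_nonneg (UnitAddTorus.mFourier n x)]

/-- Test the weak derivative of order `2m` in the direction `i` where `|n_i|` equals the sup norm of
`n`: each derivative brings down a factor `2πi n_i`, and the derivative of `u` is bounded in `L²`.
-/
theorem norm_pow_mul_trig_integral_le {m : ℕ} (u : ForceSpace N m) (n : Fin N → ℤ) {c : ℂ}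
    (hc : ‖c‖ ≤ 1) (hn : n ≠ 0) :
    ‖∫ x, trigMonomial n c x • u.1 (MultiIndex.zero N (2 * m)) x ∂(torusMeasure N)‖ ≤
      (‖n‖ ^ (2 * m))⁻¹ * ‖u‖ := by
  obtain ⟨i, hi⟩ : ∃ i, ‖n‖ = ‖n i‖ := by
    have : Nonempty (Fin N) := by
      by_contra h
      rw [not_nonempty_iff] at h
      exact hn (Subsingleton.elim _ _)
    obtain ⟨i, -, hi⟩ := Finset.exists_mem_eq_sup (Finset.univ : Finset (Fin N))
      Finset.univ_nonempty (fun i => ‖n i‖₊)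
    exact ⟨i, by rw [Pi.norm_def, hi]; rfl⟩
  have hw := u.2 (MultiIndex.single i) (trigMonomial n c) (isSmooth_trigMonomial n c)
  rw [MultiIndex.val_single, torusDeriv_single, iterate_torusPartial_trigMonomial] at hw
  have hsum : ∑ j, (Pi.single i (2 * m) : Fin N → ℕ) j = 2 * m := by simp
  rw [hsum, pow_mul (-1 : ℝ)] at hw
  -- The order is even, so the factor is real and the differentiated monomial is a multiple of the
  -- original one.
  have hl : (2 * Real.pi * Complex.I * n i : ℂ) ^ (2 * m) =
      (((-1) ^ m * (2 * Real.pi * n i) ^ (2 * m) : ℝ) : ℂ) := by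
    push_cast
    rw [show (2 * Real.pi * Complex.I * n i : ℂ) = Complex.I * (2 * Real.pi * n i) by ring,
      mul_pow, pow_mul Complex.I]
    simp
  rw [hl] at hw
  have hpull : ∀ x, trigMonomial n ((((-1) ^ m * (2 * Real.pi * n i) ^ (2 * m) : ℝ) : ℂ) * c) x =
      ((-1) ^ m * (2 * Real.pi * n i) ^ (2 * m)) * trigMonomial n c x := by
    intro x
    simp only [trigMonomial, mul_assoc, Complex.re_ofReal_mul]
  simp only [hpull, mul_smul, integral_smul] at hw
  norm_num at hw
  have h2 := norm_integral_smul_le (abs_trigMonomial_le n hc) (u.1 (MultiIndex.single i))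
  have hn0 : 0 < ‖n‖ := norm_pos_iff.2 hn
  rw [le_inv_mul_iff₀ (by positivity)]
  refine le_trans ?_ (h2.trans (norm_component_le u _))
  rw [← hw, norm_smul, norm_smul, ← mul_assoc, norm_pow, norm_pow]
  simp only [norm_neg, norm_one, one_pow, one_mul, norm_mul]
  refine mul_le_mul_of_nonneg_right ?_ (norm_nonneg _)
  refine pow_le_pow_left₀ (norm_nonneg _) ?_ _
  have h3 : ‖((n i : ℤ) : ℝ)‖ = ‖n‖ := by rw [hi]; simp [Int.norm_eq_abs]
  rw [h3]
  -- The powers of `2π` are not needed: they are bounded below by `1`.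
  have : (1 : ℝ) ≤ ‖(2 : ℝ)‖ * ‖Real.pi‖ := by
    rw [Real.norm_of_nonneg Real.pi_pos.le]; norm_num; nlinarith [Real.pi_gt_three]
  nlinarith [norm_nonneg n]

end Sobolev
-- Sobolev embedding and continuity of the evaluation at a point
section SobolevEmbedding

local instance : MeasureSpace UnitAddCircle := ⟨AddCircle.haarAddCircle⟩

local instance : Measure.IsAddHaarMeasure (volume : Measure UnitAddCircle) :=
  inferInstanceAs (Measure.IsAddHaarMeasure AddCircle.haarAddCircle)

local instance : IsProbabilityMeasure (volume : Measure UnitAddCircle) :=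
  inferInstanceAs (IsProbabilityMeasure AddCircle.haarAddCircle)

variable {N : ℕ}

theorem torusMeasure_eq_volume : torusMeasure N = (volume : Measure (Torus N)) := rfl

instance : (torusMeasure N).IsOpenPosMeasure := by
  rw [torusMeasure_eq_volume]; infer_instance

/-- The `i`-th component of a vector field, as a complex function. -/
def complexComponent (i : Fin N) : Vel N →L[ℝ] ℂ :=
  Complex.ofRealCLM.comp (EuclideanSpace.proj i)

theorem complexComponent_apply (i : Fin N) (v : Vel N) : complexComponent i v = (v i : ℂ) := rfl

/-- Weak derivatives are tested against real functions only, so the character is split as `z = Re z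
+ i Re(-iz)`. -/
theorem mFourierCoeff_component (u : Lp (Vel N) 2 (torusMeasure N)) (i : Fin N) (k : Fin N → ℤ) :
    UnitAddTorus.mFourierCoeff ((complexComponent i).compLp u : Torus N → ℂ) k =
      complexComponent i (∫ x, trigMonomial (-k) 1 x • u x ∂(torusMeasure N)) +
      Complex.I *
        complexComponent i (∫ x, trigMonomial (-k) (-Complex.I) x • u x ∂(torusMeasure N)) := by
  have hi (c : ℂ) : Integrable (fun x => trigMonomial (-k) c x • u x) (torusMeasure N) :=
    integrable_smul_of_continuous (isSmooth_trigMonomial _ _).continuous u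
  rw [← ContinuousLinearMap.integral_comp_comm _ (hi _),
    ← ContinuousLinearMap.integral_comp_comm _ (hi _), ← integral_const_mul, ← integral_add
    ((complexComponent i).integrable_comp (hi _))
    (((complexComponent i).integrable_comp (hi _)).const_mul _)]
  refine integral_congr_ae ?_
  rw [← torusMeasure_eq_volume]
  filter_upwards [(complexComponent i).coeFn_compLp u] with x hx
  rw [hx]
  simp only [complexComponent_apply, PiLp.smul_apply, smul_eq_mul, trigMonomial]
  set z := UnitAddTorus.mFourier (-k) x
  apply Complex.ext <;> simp

/-- The zero mode carries no decay, and `0⁻¹ = 0` makes the power vanish there when `m > 0`; hence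
its separate term, bounded by the `L²` norm. -/
theorem norm_mFourierCoeff_component_le {m : ℕ} (u : ForceSpace N m) (i : Fin N)
    (k : Fin N → ℤ) :
    ‖UnitAddTorus.mFourierCoeff
      ((complexComponent i).compLp (u.1 (MultiIndex.zero N (2 * m))) : Torus N → ℂ) k‖ ≤
      (2 * (‖k‖ ^ (2 * m))⁻¹ + if k = 0 then 2 else 0) * ‖u‖ := by
  have hc (v : Vel N) : ‖complexComponent i v‖ ≤ ‖v‖ := by
    rw [complexComponent_apply, Complex.norm_real]
    exact PiLp.norm_apply_le v i
  have h1 : ‖(1 : ℂ)‖ ≤ 1 := by simp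
  have h2 : ‖-Complex.I‖ ≤ 1 := by simp
  rw [mFourierCoeff_component]
  refine (norm_add_le _ _).trans ?_
  rw [norm_mul, Complex.norm_I, one_mul]
  refine (add_le_add (hc _) (hc _)).trans ?_
  by_cases hk : k = 0
  · have h3 := norm_integral_smul_le (abs_trigMonomial_le (-k) h1)
      (u.1 (MultiIndex.zero N (2 * m)))
    have h4 := norm_integral_smul_le (abs_trigMonomial_le (-k) h2)
      (u.1 (MultiIndex.zero N (2 * m)))
    have h5 := norm_component_le u (MultiIndex.zero N (2 * m))
    have h6 : 0 ≤ (2 * (‖k‖ ^ (2 * m))⁻¹) * ‖u‖ := by positivity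
    rw [if_pos hk, add_mul]
    linarith
  · have h3 := norm_pow_mul_trig_integral_le u (-k) h1 (neg_ne_zero.2 hk)
    have h4 := norm_pow_mul_trig_integral_le u (-k) h2 (neg_ne_zero.2 hk)
    rw [norm_neg] at h3 h4
    rw [if_neg hk, add_zero]
    linarith

/-- **Sobolev embedding** of `H^{2m}(𝕋^N; ℝ^N)` into continuous functions, for `N < 2m`. -/
theorem exists_continuous_representative {m : ℕ} (hm : N < 2 * m) :
    ∃ C : ℝ, ∀ u : ForceSpace N m, ∃ g : C(Torus N, Vel N),
      g =ᵐ[torusMeasure N] u.1 (MultiIndex.zero N (2 * m)) ∧ ∀ x, ‖g x‖ ≤ C * ‖u‖ := by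
  let B : (Fin N → ℤ) → ℝ := fun k => 2 * (‖k‖ ^ (2 * m))⁻¹ + if k = 0 then 2 else 0
  have hB : Summable B := by
    refine ((summable_norm_inv_pow_int hm).mul_left 2).add ?_
    exact summable_of_ne_finset_zero (s := {0}) fun k hk => by simp_all
  have hB0 : ∀ k, 0 ≤ B k := fun k => by
    have : (0 : ℝ) ≤ if k = 0 then 2 else 0 := by split_ifs <;> norm_num
    positivity
  -- `√N` is the price of passing from a bound on each component to the Euclidean norm.
  refine ⟨√N * ∑' k, B k, fun u => ?_⟩
  let w (i : Fin N) : Lp ℂ 2 (volume : Measure (Torus N)) :=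
    (complexComponent i).compLp (u.1 (MultiIndex.zero N (2 * m)))
  let a (i : Fin N) (k : Fin N → ℤ) : C(Torus N, ℂ) :=
    UnitAddTorus.mFourierCoeff (w i) k • UnitAddTorus.mFourier k
  have ha (i k) : ‖a i k‖ ≤ B k * ‖u‖ := by
    simp only [a, norm_smul, UnitAddTorus.mFourier_norm, mul_one]
    exact norm_mFourierCoeff_component_le u i k
  have hs (i) : Summable (a i) := .of_norm_bounded (hB.mul_right _) (ha i)
  have hnorm (i) : ‖∑' k, a i k‖ ≤ (∑' k, B k) * ‖u‖ := by
    rw [← tsum_mul_right]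
    exact tsum_of_norm_bounded (hB.mul_right _).hasSum (ha i)
  -- The Fourier series converges uniformly to its continuous sum and in `L²` to the function
  -- itself; the two limits agree in `L²`.
  have hLp (i) : ContinuousMap.toLp 2 volume ℂ (∑' k, a i k) = w i := by
    have h1 := (ContinuousMap.toLp (E := ℂ) 2 (volume : Measure (Torus N)) ℂ).hasSum (hs i).hasSum
    refine h1.unique ?_
    convert! UnitAddTorus.hasSum_mFourier_series_L2 (w i) using 2
  refine ⟨⟨fun x => WithLp.toLp 2 fun i => ((∑' k, a i k) x).re, ?_⟩, ?_, fun x => ?_⟩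
  · refine (PiLp.continuous_toLp 2 _).comp (continuous_pi fun i => ?_)
    exact Complex.continuous_re.comp (∑' k, a i k).continuous
  · have h1 : ∀ i, ∀ᵐ x ∂(torusMeasure N), (∑' k, a i k) x =
        (u.1 (MultiIndex.zero N (2 * m)) x i : ℂ) := by
      intro i
      have h2 := ContinuousMap.coeFn_toLp (𝕜 := ℂ) (p := 2) (volume : Measure (Torus N))
        (∑' k, a i k)
      rw [hLp] at h2
      filter_upwards [h2, (complexComponent i).coeFn_compLp
        (u.1 (MultiIndex.zero N (2 * m)))] with x hx hx'
      rw [← hx]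
      exact hx'
    filter_upwards [ae_all_iff.2 h1] with x hx
    ext i
    simp [hx i]
  · have h0 : 0 ≤ (∑' k, B k) * ‖u‖ := mul_nonneg (tsum_nonneg hB0) (norm_nonneg _)
    rw [mul_assoc]
    refine (EuclideanSpace.norm_eq _).trans_le ?_
    rw [← Real.sqrt_sq h0, ← Real.sqrt_mul (Nat.cast_nonneg _)]
    refine Real.sqrt_le_sqrt ?_
    have : ∀ i ∈ (Finset.univ : Finset (Fin N)), ‖((∑' k, a i k) x).re‖ ^ 2 ≤
        ((∑' k, B k) * ‖u‖) ^ 2 := fun i _ => by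
      refine pow_le_pow_left₀ (norm_nonneg _) ?_ 2
      exact (Complex.abs_re_le_norm _).trans (((∑' k, a i k).norm_coe_le_norm x).trans (hnorm i))
    simpa using Finset.sum_le_sum this

/-- Evaluation at `x` is a continuous linear map on `H^{2m}(𝕋^N; ℝ^N)`, for `N < 2m`. -/
theorem exists_forceAt_eq_clm {m : ℕ} (hm : N < 2 * m) (x : Torus N) :
    ∃ L : ForceSpace N m →L[ℝ] Vel N, ∀ e, forceAt x e = L e := by
  obtain ⟨C, hC⟩ := exists_continuous_representative hm
  have key : ∀ (u : ForceSpace N m) (g : C(Torus N, Vel N)),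
      g =ᵐ[torusMeasure N] u.1 (MultiIndex.zero N (2 * m)) → forceAt x u = g x := by
    intro u g hg
    have h : ∃ g : C(Torus N, Vel N),
      g =ᵐ[torusMeasure N] u.1 (MultiIndex.zero N (2 * m)) := ⟨g, hg⟩
    unfold forceAt
    rw [dif_pos h]
    -- Haar measure charges every nonempty open set, so the continuous representative is unique. The
    -- choice made in `forceAt` is therefore immaterial, and linearity can be checked on any
    -- representatives.
    have := (h.choose.continuous.ae_eq_iff_eq (torusMeasure N) g.continuous).1
      (h.choose_spec.trans hg.symm)
    exact congrFun this x
  choose g hg hgC using hC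
  refine ⟨LinearMap.mkContinuous ⟨⟨forceAt x, fun u v => ?_⟩, fun c u => ?_⟩ C fun u => ?_,
    fun _ => rfl⟩
  · rw [key u _ (hg u), key v _ (hg v), key (u + v) (g u + g v) ?_]
    · rfl
    filter_upwards [hg u, hg v, Lp.coeFn_add (u.1 (MultiIndex.zero N (2 * m)))
      (v.1 (MultiIndex.zero N (2 * m)))] with y h1 h2 h3
    refine Eq.trans ?_ h3.symm
    simp [h1, h2]
  · change forceAt x (c • u) = c • forceAt x u
    rw [key u _ (hg u), key (c • u) (c • g u) ?_]
    · rfl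
    filter_upwards [hg u, Lp.coeFn_smul c (u.1 (MultiIndex.zero N (2 * m)))] with y h1 h3
    refine Eq.trans ?_ h3.symm
    simp [h1]
  · change ‖forceAt x u‖ ≤ _
    rw [key u _ (hg u)]
    exact hgC u x

end SobolevEmbedding
-- Measurability and integrability of càdlàg paths
section Cadlag

variable {Ω S : Type*}

/-- Time is replaced by the next point strictly to its right on the grid of step `1/(n+1)`. This
takes countably many values, so measurability is clear, and right continuity gives the pointwise
limit. -/
theorem measurable_uncurry_of_rightContinuous [MeasurableSpace Ω] [TopologicalSpace S]
    [TopologicalSpace.PseudoMetrizableSpace S] [MeasurableSpace S] [BorelSpace S]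
    {X : Ω → ℝ → S} (hX : ∀ t, Measurable fun ω => X ω t)
    (hc : ∀ ω t, ContinuousWithinAt (X ω) (Ici t) t) : Measurable (Function.uncurry X) := by
  let q : ℕ → ℝ → ℝ := fun n t => (⌊((n : ℝ) + 1) * t⌋ + 1) / ((n : ℝ) + 1)
  have hq1 (n t) : t < q n t := by
    rw [lt_div_iff₀ (by positivity), mul_comm]
    exact Int.lt_floor_add_one _
  have hq2 (n t) : q n t ≤ t + 1 / ((n : ℝ) + 1) := by
    have h : (0 : ℝ) < (n : ℝ) + 1 := by positivity
    rw [div_le_iff₀ h, add_mul t, div_mul_cancel₀ _ h.ne', mul_comm t]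
    gcongr
    exact Int.floor_le _
  have hq (t) : Tendsto (fun n => q n t) atTop (𝓝[≥] t) := by
    refine tendsto_nhdsWithin_iff.2 ⟨?_, Eventually.of_forall fun n => (hq1 n t).le⟩
    refine tendsto_of_tendsto_of_tendsto_of_le_of_le tendsto_const_nhds ?_
      (fun n => (hq1 n t).le) (fun n => hq2 n t)
    simpa using tendsto_const_nhds.add (tendsto_one_div_add_atTop_nhds_zero_nat (𝕜 := ℝ))
  refine measurable_of_tendsto_metrizable (f := fun n (p : Ω × ℝ) => X p.1 (q n p.2)) (fun n => ?_)
    (tendsto_pi_nhds.2 fun p => (hc p.1 p.2).tendsto.comp (hq p.2))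
  have h1 : Measurable fun p : Ω × ℤ => X p.1 (((p.2 : ℝ) + 1) / ((n : ℝ) + 1)) :=
    measurable_from_prod_countable_left fun k => hX (((k : ℝ) + 1) / ((n : ℝ) + 1))
  exact h1.comp (measurable_fst.prodMk
    (Int.measurable_floor.comp (measurable_const.mul measurable_snd)))

theorem IsCadlag.continuous_comp {ι S' : Type*} [LinearOrder ι] [TopologicalSpace ι]
    [TopologicalSpace S] [TopologicalSpace S'] {X : ι → S} (hX : IsCadlag X) {L : S → S'}
    (hL : Continuous L) : IsCadlag fun t => L (X t) := fun t =>
  ⟨hL.continuousAt.comp_continuousWithinAt (hX t).1,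
    let ⟨l, hl⟩ := (hX t).2
    ⟨L l, (hL.tendsto l).comp hl⟩⟩

theorem IsCadlag.delay [TopologicalSpace S] {X : ℝ≥0 → S} (hX : IsCadlag X) (s : ℝ) :
    IsCadlag fun r : ℝ => X (r - s).toNNReal := by
  have hc : Continuous fun r : ℝ => (r - s).toNNReal := by fun_prop
  have hm : Monotone fun r : ℝ => (r - s).toNNReal := fun a b h =>
    Real.toNNReal_le_toNNReal (by linarith)
  intro t
  refine ⟨(hX _).1.comp hc.continuousWithinAt fun r hr => hm hr, ?_⟩
  rcases le_or_gt t s with hts | hts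
  -- To the left of `s` the truncation in `toNNReal` freezes the path at its initial value.
  · refine ⟨X 0, tendsto_const_nhds.congr' ?_⟩
    filter_upwards [self_mem_nhdsWithin] with r hr
    rw [Real.toNNReal_of_nonpos]
    have : r < t := hr
    linarith
  · obtain ⟨l, hl⟩ := (hX (t - s).toNNReal).2
    refine ⟨l, hl.comp (tendsto_nhdsWithin_iff.2 ⟨(hc.tendsto t).mono_left nhdsWithin_le_nhds, ?_⟩)⟩
    filter_upwards [self_mem_nhdsWithin] with r hr
    have : r < t := hr
    exact (Real.toNNReal_lt_toNNReal_iff (by linarith)).2 (by linarith)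

theorem IsCadlag.shift [TopologicalSpace S] {X : ℝ → S} (hX : IsCadlag X) (s : ℝ) :
    IsCadlag fun τ : ℝ≥0 => X (s + τ) := by
  have hc : Continuous fun τ : ℝ≥0 => s + (τ : ℝ) := by fun_prop
  intro t
  refine ⟨(hX _).1.comp hc.continuousWithinAt fun r hr => ?_, ?_⟩
  · have : t ≤ r := hr
    have : (t : ℝ) ≤ r := mod_cast this
    simp only [mem_Ici]; linarith
  · obtain ⟨l, hl⟩ := (hX (s + t)).2
    refine ⟨l, hl.comp (tendsto_nhdsWithin_iff.2 ⟨(hc.tendsto t).mono_left nhdsWithin_le_nhds, ?_⟩)⟩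
    filter_upwards [self_mem_nhdsWithin] with r hr
    have : r < t := hr
    have : (r : ℝ) < t := mod_cast this
    simp only [mem_Iio]; linarith

variable {N : ℕ}

theorem IsCadlag.measurable {X : ℝ → Vel N} (hX : IsCadlag X) : Measurable X :=
  (measurable_uncurry_of_rightContinuous (Ω := Unit) (X := fun _ => X) (fun _ => measurable_const)
    fun _ t => (hX t).1).comp (measurable_const.prodMk measurable_id : Measurable fun t : ℝ => ((), t))

/-- The left limit and right continuity at `t` bound the path on a neighbourhood of `t`. -/
theorem IsCadlag.locallyIntegrable {X : ℝ → Vel N} (hX : IsCadlag X) : LocallyIntegrable X := by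
  intro t
  have hb : IsBoundedUnder (· ≤ ·) (𝓝 t) fun r => ‖X r‖ := by
    obtain ⟨l, hl⟩ := (hX t).2
    have h1 : ∀ᶠ r in 𝓝[<] t, ‖X r‖ ≤ ‖l‖ + 1 :=
      (hl.norm.eventually_lt_const (by linarith)).mono fun _ h => h.le
    have h2 : ∀ᶠ r in 𝓝[≥] t, ‖X r‖ ≤ ‖X t‖ + 1 :=
      ((hX t).1.tendsto.norm.eventually_lt_const (by linarith)).mono fun _ h => h.le
    refine ⟨max (‖l‖ + 1) (‖X t‖ + 1), ?_⟩
    rw [eventually_map, ← nhdsLT_sup_nhdsGE, eventually_sup]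
    exact ⟨h1.mono fun _ h => h.trans (le_max_left _ _),
      h2.mono fun _ h => h.trans (le_max_right _ _)⟩
  exact Measure.FiniteAtFilter.integrableAtFilter
    hX.measurable.stronglyMeasurable.stronglyMeasurableAtFilter (volume.finiteAt_nhds t) hb

theorem measurable_intervalIntegral {α : Type*} [MeasurableSpace α] {G : Type*}
    [NormedAddCommGroup G] [NormedSpace ℝ G] [MeasurableSpace G] [BorelSpace G]
    [SecondCountableTopology G]
    {f : α → ℝ → G} (hf : Measurable (Function.uncurry f))
    {a b : α → ℝ} (ha : Measurable a) (hb : Measurable b) :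
    Measurable fun x => ∫ r in (a x)..(b x), f x r := by
  have h : ∀ a b : α → ℝ, Measurable a → Measurable b →
      Measurable fun x => ∫ r in Ioc (a x) (b x), f x r := by
    intro a b ha hb
    simp only [← integral_indicator measurableSet_Ioc]
    have hs : MeasurableSet {p : α × ℝ | a p.1 < p.2 ∧ p.2 ≤ b p.1} :=
      (measurableSet_lt (ha.comp measurable_fst) measurable_snd).inter
        (measurableSet_le measurable_snd (hb.comp measurable_fst))
    exact (StronglyMeasurable.integral_prod_right
      (f := fun x r => (Ioc (a x) (b x)).indicator (f x) r)
      (hf.indicator hs).stronglyMeasurable).measurable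
  exact (h a b ha hb).sub (h b a hb ha)

end Cadlag

/-! ### The map from integrable functions to `L¹` -/

section L1

variable {N : ℕ}

theorem toL1_eq {g : Vel N → ℝ} (hg : Integrable g) : toL1 g = hg.toL1 g := dif_pos hg

theorem coeFn_toL1 {g : Vel N → ℝ} (hg : Integrable g) : toL1 g =ᵐ[volume] g := by
  rw [toL1_eq hg]; exact hg.coeFn_toL1

theorem toL1_coeFn (f : L1 N) : toL1 (f : Vel N → ℝ) = f := by
  rw [toL1_eq (L1.integrable_coeFn f)]; exact Integrable.toL1_coeFn _ _

theorem toL1_congr {g h : Vel N → ℝ} (hgh : g =ᵐ[volume] h) : toL1 g = toL1 h := by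
  by_cases hg : Integrable g
  · rw [toL1_eq hg, toL1_eq (hg.congr hgh)]
    exact (Integrable.toL1_eq_toL1_iff _ _ _ _).2 hgh
  · have hh : ¬ Integrable h := fun h' => hg (h'.congr hgh.symm)
    simp [toL1, hg, hh]

theorem smul_toL1 {g : Vel N → ℝ} (hg : Integrable g) (c : ℝ) :
    c • toL1 g = toL1 fun v => c * g v := by
  rw [toL1_eq hg, toL1_eq (hg.const_mul c)]
  exact (Integrable.toL1_smul g hg c).symm

theorem edist_toL1 {g h : Vel N → ℝ} (hg : Integrable g) (hh : Integrable h) :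
    edist (toL1 g) (toL1 h) = ∫⁻ v, ‖g v - h v‖ₑ := by
  rw [toL1_eq hg, toL1_eq hh, Integrable.edist_toL1_toL1]
  simp only [edist_eq_enorm_sub]

theorem measurable_coeFn (f : L1 N) : Measurable (f : Vel N → ℝ) :=
  (Lp.stronglyMeasurable f).measurable

instance : SecondCountableTopology (L1 N) := by
  have : Fact ((1 : ℝ≥0∞) ≠ ∞) := ⟨by norm_num⟩
  exact Lp.SecondCountableTopology

/-- `L¹` is separable, so its Borel sets are generated by balls; the distance to a fixed class is a
parametric integral, measurable by Tonelli. -/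
theorem measurable_toL1 {Ω : Type*} [MeasurableSpace Ω] {g : Ω → Vel N → ℝ}
    (hg : Measurable (Function.uncurry g)) (hi : ∀ ω, Integrable (g ω)) :
    Measurable fun ω => toL1 (g ω) := by
  have hb : TopologicalSpace.IsTopologicalBasis
      {s : Set (L1 N) | ∃ (f : L1 N) (r : ℝ≥0∞), s = Metric.eball f r} := by
    refine TopologicalSpace.isTopologicalBasis_of_isOpen_of_nhds ?_ ?_
    · rintro _ ⟨f, r, rfl⟩; exact Metric.isOpen_eball
    · intro a u ha hu
      obtain ⟨r, hr, h⟩ := EMetric.mem_nhds_iff.1 (hu.mem_nhds ha)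
      exact ⟨_, ⟨a, r, rfl⟩, Metric.mem_eball_self hr, h⟩
  change @Measurable _ _ _ (borel (L1 N)) _
  rw [hb.borel_eq_generateFrom]
  refine measurable_generateFrom ?_
  rintro _ ⟨f, r, rfl⟩
  have hm : Measurable fun ω => edist (toL1 (g ω)) f := by
    have : ∀ ω, edist (toL1 (g ω)) f = ∫⁻ v, ‖g ω v - f v‖ₑ := fun ω => by
      conv_lhs => rw [← toL1_coeFn f]
      exact edist_toL1 (hi ω) (L1.integrable_coeFn f)
    simp only [this]
    exact Measurable.lintegral_prod_right
      (f := fun ω v => ‖g ω v - f v‖ₑ) (hg.sub ((measurable_coeFn f).comp measurable_snd)).enorm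
  exact hm measurableSet_Iio

/-- **Minkowski's integral inequality** in `L¹`. -/
theorem lintegral_enorm_integral_le {α β : Type*} [MeasurableSpace α] [MeasurableSpace β]
    {μ : Measure α} [SFinite μ] {ν : Measure β} [SFinite ν] {k : α → β → ℝ}
    (hk : Measurable (Function.uncurry k)) :
    ∫⁻ v, ‖∫ σ, k σ v ∂μ‖ₑ ∂ν ≤ ∫⁻ σ, ∫⁻ v, ‖k σ v‖ₑ ∂ν ∂μ := by
  rw [lintegral_lintegral_swap hk.enorm.aemeasurable]
  exact lintegral_mono fun v => enorm_integral_le_lintegral_enorm _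

end L1

/-! ### The Maxwellian: mass, first moment and translations -/

section Maxwellian

variable {N : ℕ}

theorem maxwellian_pos (v : Vel N) : 0 < maxwellian v := by unfold maxwellian; positivity

theorem continuous_maxwellian : Continuous (maxwellian (N := N)) := by
  unfold maxwellian; fun_prop

theorem measurable_maxwellian : Measurable (maxwellian (N := N)) := continuous_maxwellian.measurable

theorem integrable_exp_neg_mul_sq {b : ℝ} (hb : 0 < b) :
    Integrable fun v : Vel N => Real.exp (-b * ‖v‖ ^ 2) := by
  refine Integrable.of_integral_ne_zero ?_
  rw [GaussianFourier.integral_rexp_neg_mul_sq_norm hb]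
  positivity

theorem maxwellian_eq (v : Vel N) :
    maxwellian v = (2 * Real.pi) ^ (-(N : ℝ) / 2) * Real.exp (-(1 / 2) * ‖v‖ ^ 2) := by
  unfold maxwellian; congr 2; ring

theorem integrable_maxwellian : Integrable (maxwellian (N := N)) := by
  simp only [funext maxwellian_eq]
  exact (integrable_exp_neg_mul_sq (by norm_num)).const_mul _

theorem integral_maxwellian : ∫ v : Vel N, maxwellian v = 1 := by
  simp only [maxwellian_eq]
  rw [integral_const_mul, GaussianFourier.integral_rexp_neg_mul_sq_norm (by norm_num)]
  rw [finrank_euclideanSpace_fin, show Real.pi / (1 / 2) = 2 * Real.pi by ring,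
    ← Real.rpow_add (by positivity)]
  simp [neg_div]

theorem lintegral_maxwellian : ∫⁻ v : Vel N, ‖maxwellian v‖ₑ = 1 := by
  have := ofReal_integral_eq_lintegral_ofReal (integrable_maxwellian (N := N))
    (Eventually.of_forall fun v => (maxwellian_pos v).le)
  rw [integral_maxwellian, ENNReal.ofReal_one] at this
  rw [this]
  exact lintegral_congr fun v => Real.enorm_of_nonneg (maxwellian_pos v).le

theorem lintegral_maxwellian_sub (a : Vel N) : ∫⁻ v : Vel N, ‖maxwellian (v - a)‖ₑ = 1 := by
  rw [lintegral_sub_right_eq_self (fun v => ‖maxwellian v‖ₑ), lintegral_maxwellian]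

/-- The first absolute moment of the Maxwellian. -/
def maxwellianMoment (N : ℕ) : ℝ≥0∞ := ∫⁻ v : Vel N, ‖v‖ₑ * ‖maxwellian v‖ₑ

theorem maxwellianMoment_ne_top : maxwellianMoment N ≠ ∞ := by
  have h : Integrable fun v : Vel N => ‖v‖ * maxwellian v := by
    refine Integrable.mono' ((integrable_exp_neg_mul_sq (N := N) (b := 1 / 4)
      (by norm_num)).const_mul ((2 * Real.pi) ^ (-(N : ℝ) / 2)))
      (continuous_norm.mul continuous_maxwellian).aestronglyMeasurable
      (Eventually.of_forall fun v => ?_)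
    rw [Real.norm_of_nonneg (mul_nonneg (norm_nonneg _) (maxwellian_pos v).le), maxwellian_eq,
      mul_left_comm]
    refine mul_le_mul_of_nonneg_left ?_ (by positivity)
    have h1 : ‖v‖ ≤ Real.exp (1 / 4 * ‖v‖ ^ 2) := by
      refine le_trans ?_ (Real.add_one_le_exp _)
      nlinarith [sq_nonneg (‖v‖ - 2)]
    calc ‖v‖ * Real.exp (-(1 / 2) * ‖v‖ ^ 2)
        ≤ Real.exp (1 / 4 * ‖v‖ ^ 2) * Real.exp (-(1 / 2) * ‖v‖ ^ 2) := by gcongr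
      _ = Real.exp (-(1 / 4) * ‖v‖ ^ 2) := by rw [← Real.exp_add]; congr 1; ring
  have h2 := h.hasFiniteIntegral
  rw [HasFiniteIntegral] at h2
  simp only [enorm_mul, enorm_norm] at h2
  exact h2.ne

theorem hasDerivAt_maxwellian_line (v a : Vel N) (θ : ℝ) :
    HasDerivAt (fun θ : ℝ => maxwellian (v - θ • a))
      (inner ℝ (v - θ • a) a * maxwellian (v - θ • a)) θ := by
  have h1 : HasDerivAt (fun θ : ℝ => v - θ • a) (-a) θ := by
    simpa using ((hasDerivAt_id θ).smul_const a).const_sub v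
  have h2 := ((h1.norm_sq.neg.div_const 2).exp).const_mul ((2 * Real.pi) ^ (-(N : ℝ) / 2))
  refine h2.congr_deriv ?_
  simp only [maxwellian, inner_neg_right, Pi.neg_apply]
  ring

/-- Integrate the derivative along the segment joining the two shifts. Minkowski's inequality and
translation invariance leave `∫ |v·(a-b)| M(v) dv`, and Cauchy-Schwarz gives the first moment. -/
theorem lintegral_maxwellian_sub_le (a b : Vel N) :
    ∫⁻ v, ‖maxwellian (v - a) - maxwellian (v - b)‖ₑ ≤ maxwellianMoment N * ‖a - b‖ₑ := by
  have hcont (v c : Vel N) : Continuous fun θ : ℝ =>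
      inner ℝ (v - θ • c) c * maxwellian (v - θ • c) :=
    ((continuous_const.sub (continuous_id.smul continuous_const)).inner continuous_const).mul
      (continuous_maxwellian.comp (continuous_const.sub (continuous_id.smul continuous_const)))
  have key (c : Vel N) : ∫⁻ v, ‖maxwellian (v - c) - maxwellian v‖ₑ ≤
      maxwellianMoment N * ‖c‖ₑ := by
    have h1 (v : Vel N) : maxwellian (v - c) - maxwellian v =
        ∫ θ in Ioc (0 : ℝ) 1, inner ℝ (v - θ • c) c * maxwellian (v - θ • c) := by
      rw [← intervalIntegral.integral_of_le zero_le_one,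
        intervalIntegral.integral_eq_sub_of_hasDerivAt
          (fun θ _ => hasDerivAt_maxwellian_line v c θ) ((hcont v c).intervalIntegrable _ _)]
      simp
    simp only [h1]
    refine (lintegral_enorm_integral_le (ν := volume) (μ := volume.restrict (Ioc (0 : ℝ) 1))
      (k := fun (θ : ℝ) (v : Vel N) => inner ℝ (v - θ • c) c * maxwellian (v - θ • c)) ?_).trans ?_
    · have h3 : Continuous fun p : ℝ × Vel N => p.2 - p.1 • c :=
        continuous_snd.sub (continuous_fst.smul continuous_const)
      exact ((h3.inner continuous_const).mul (continuous_maxwellian.comp h3)).measurable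
    · have h2 (θ : ℝ) : ∫⁻ v : Vel N, ‖inner ℝ (v - θ • c) c * maxwellian (v - θ • c)‖ₑ ≤
          maxwellianMoment N * ‖c‖ₑ := by
        rw [lintegral_sub_right_eq_self (fun v : Vel N => ‖inner ℝ v c * maxwellian v‖ₑ),
          maxwellianMoment, ← lintegral_mul_const _ (by
            exact measurable_id.enorm.mul measurable_maxwellian.enorm)]
        refine lintegral_mono fun v => ?_
        rw [enorm_mul, mul_right_comm]
        gcongr
        rw [← enorm_norm v, ← enorm_norm c, ← enorm_mul]
        refine enorm_le_iff_norm_le.2 ?_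
        rw [Real.norm_of_nonneg (by positivity : 0 ≤ ‖v‖ * ‖c‖)]
        exact norm_inner_le_norm v c
      refine (lintegral_mono h2).trans ?_
      simp
  have := lintegral_sub_right_eq_self (μ := volume)
    (fun v => ‖maxwellian (v - (a - b)) - maxwellian v‖ₑ) b
  simp only [sub_sub, add_sub_cancel] at this
  rw [this]
  exact key (a - b)

end Maxwellian
-- The closed formulas: measurability, `L¹` bounds, linearity
section Solution

variable {N : ℕ}

theorem maxwellian_le (v : Vel N) : maxwellian v ≤ (2 * Real.pi) ^ (-(N : ℝ) / 2) := by
  unfold maxwellian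
  refine mul_le_of_le_one_right (by positivity) (Real.exp_le_one_iff.2 ?_)
  nlinarith [sq_nonneg ‖v‖]

theorem maxwellian_neg (v : Vel N) : maxwellian (-v) = maxwellian v := by simp [maxwellian]

theorem lintegral_comp_smul_add {h : Vel N → ℝ≥0∞} (hh : Measurable h) {r : ℝ} (hr : 0 < r)
    (a : Vel N) : ∫⁻ v, h (r • v + a) = ENNReal.ofReal ((r ^ N)⁻¹) * ∫⁻ v, h v := by
  have h1 := lintegral_map (μ := (volume : Measure (Vel N))) (f := fun v => h (v + a))
    (g := fun v => r • v) (hh.comp (measurable_id.add_const a)) (measurable_const_smul r)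
  rw [← h1, show (Measure.map (fun v : Vel N => r • v) volume) = _ from
    Measure.map_addHaar_smul volume hr.ne', lintegral_smul_measure,
    lintegral_add_right_eq_self h, finrank_euclideanSpace_fin, abs_of_pos (by positivity)]
  rfl

theorem integral_comp_smul_add (h : Vel N → ℝ) {r : ℝ} (hr : 0 < r) (a : Vel N) :
    ∫ v, h (r • v + a) = (r ^ N)⁻¹ * ∫ v, h v := by
  rw [Measure.integral_comp_smul volume (fun v => h (v + a)) r, integral_add_right_eq_self h,
    finrank_euclideanSpace_fin, abs_of_pos (by positivity), smul_eq_mul]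

theorem integrable_comp_smul_add {h : Vel N → ℝ} (hh : Integrable h) {r : ℝ} (hr : r ≠ 0)
    (a : Vel N) : Integrable fun v => h (r • v + a) :=
  (hh.comp_add_right a).comp_smul hr

theorem integrableOn_exp_neg_sub_Iic (t r : ℝ) : IntegrableOn (fun σ => Real.exp (-(t - σ))) (Iic r) := by
  have := (integrableOn_exp_Iic r).const_mul (Real.exp (-t))
  refine IntegrableOn.congr_fun this (fun σ _ => ?_) measurableSet_Iic
  rw [← Real.exp_add]; congr 1; ring

theorem lintegral_exp_neg_sub_Iic (t r : ℝ) :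
    ∫⁻ σ in Iic r, ENNReal.ofReal (Real.exp (-(t - σ))) = ENNReal.ofReal (Real.exp (-(t - r))) := by
  rw [← ofReal_integral_eq_lintegral_ofReal (integrableOn_exp_neg_sub_Iic t r)
    (Eventually.of_forall fun σ => (Real.exp_pos _).le)]
  congr 1
  have : ∀ σ, Real.exp (-(t - σ)) = Real.exp (-t) * Real.exp σ := fun σ => by
    rw [← Real.exp_add]; congr 1; ring
  simp only [this, integral_const_mul, integral_exp_Iic]

theorem measurable_exp_neg_sub (t : ℝ) : Measurable fun σ : ℝ => Real.exp (-(t - σ)) := by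
  fun_prop

theorem measurable_drift {E : ℝ → Vel N} (hE : Measurable E) (t : ℝ) :
    Measurable fun σ => ∫ r in σ..t, E r :=
  measurable_intervalIntegral (α := ℝ) (f := fun _ => E) (hE.comp measurable_snd) measurable_id
    measurable_const

theorem integrableOn_exp_mul_maxwellian {a : ℝ → Vel N} (ha : Measurable a) (t r : ℝ) (v : Vel N) :
    IntegrableOn (fun σ => Real.exp (-(t - σ)) * maxwellian (v - a σ)) (Iic r) := by
  refine (integrableOn_exp_neg_sub_Iic t r).mul_bdd (c := (2 * Real.pi) ^ (-(N : ℝ) / 2))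
    (measurable_maxwellian.comp (measurable_const.sub ha)).aestronglyMeasurable
    (Eventually.of_forall fun σ => ?_)
  rw [Real.norm_of_nonneg (maxwellian_pos _).le]
  exact maxwellian_le _

theorem intervalIntegrable_exp_mul_maxwellian {a : ℝ → Vel N} (ha : Measurable a) (t r r' : ℝ)
    (v : Vel N) :
    IntervalIntegrable (fun σ => Real.exp (-(t - σ)) * maxwellian (v - a σ)) volume r r' :=
  ⟨(integrableOn_exp_mul_maxwellian ha t r' v).mono_set Ioc_subset_Iic_self,
    (integrableOn_exp_mul_maxwellian ha t r v).mono_set Ioc_subset_Iic_self⟩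

theorem measurable_exp_mul_maxwellian {a : ℝ → Vel N} (ha : Measurable a) (t : ℝ) :
    Measurable (Function.uncurry fun (σ : ℝ) (v : Vel N) =>
      Real.exp (-(t - σ)) * maxwellian (v - a σ)) :=
  ((measurable_exp_neg_sub t).comp measurable_fst).mul
    (measurable_maxwellian.comp (measurable_snd.sub (ha.comp measurable_fst)))

theorem lintegral_exp_mul_maxwellian (a : ℝ → Vel N) (t σ : ℝ) :
    ∫⁻ v : Vel N, ‖Real.exp (-(t - σ)) * maxwellian (v - a σ)‖ₑ =
      ENNReal.ofReal (Real.exp (-(t - σ))) := by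
  simp only [enorm_mul]
  rw [lintegral_const_mul' _ _ (by simp), lintegral_maxwellian_sub, mul_one, Real.enorm_of_nonneg (Real.exp_pos _).le]

theorem lintegral_setIntegral_exp_mul_maxwellian_le {a : ℝ → Vel N} (ha : Measurable a) (t : ℝ)
    (A : Set ℝ) :
    ∫⁻ v : Vel N, ‖∫ σ in A, Real.exp (-(t - σ)) * maxwellian (v - a σ)‖ₑ ≤
      ∫⁻ σ in A, ENNReal.ofReal (Real.exp (-(t - σ))) := by
  refine (lintegral_enorm_integral_le (measurable_exp_mul_maxwellian ha t)).trans ?_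
  simp only [lintegral_exp_mul_maxwellian, le_refl]

/-- The Ornstein-Uhlenbeck (Fokker-Planck without force) semigroup. -/
def ouSemigroup (T : ℝ) (f : Vel N → ℝ) (z : Vel N) : ℝ :=
  Real.exp (N * T) * ∫ w : Vel N,
    f (Real.exp T • z + √(Real.exp (2 * T) - 1) • w) * maxwellian w

/-- The force only translates the force-free evolution, so `L¹` estimates in the FP case reduce to
the case without force. -/
theorem solution_FP (f : Vel N → ℝ) (E : ℝ → Vel N) (s t : ℝ) (v : Vel N) :
    solution .FP f E s t v =
      ouSemigroup (t - s) f (v - ∫ σ in s..t, Real.exp (-(t - σ)) • E σ) := by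
  have h : Real.exp (t - s) • ∫ σ in s..t, Real.exp (-(t - σ)) • E σ =
      ∫ σ in s..t, Real.exp (-(s - σ)) • E σ := by
    rw [← intervalIntegral.integral_smul]
    refine intervalIntegral.integral_congr fun σ _ => ?_
    simp only [smul_smul, ← Real.exp_add]
    congr 2; ring
  simp only [solution, ouSemigroup, smul_sub, h]

theorem measurable_ouSemigroup (T : ℝ) {f : Vel N → ℝ} (hf : Measurable f) :
    Measurable (ouSemigroup T f) := by
  refine Measurable.const_mul ?_ _
  refine (StronglyMeasurable.integral_prod_right (f := fun (z w : Vel N) =>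
    f (Real.exp T • z + √(Real.exp (2 * T) - 1) • w) * maxwellian w) ?_).measurable
  refine Measurable.stronglyMeasurable ?_
  exact (hf.comp (by fun_prop)).mul (measurable_maxwellian.comp measurable_snd)

theorem measurable_solution {Ω : Type*} [MeasurableSpace Ω] {E : Ω → ℝ → Vel N}
    (hE : Measurable (Function.uncurry E)) (Q : Collision) {f : Vel N → ℝ} (hf : Measurable f)
    (s t : ℝ) : Measurable (Function.uncurry fun ω => solution Q f (E ω) s t) := by
  have hEi : Measurable fun p : (Ω × Vel N) × ℝ => E p.1.1 p.2 :=
    hE.comp ((measurable_fst.comp measurable_fst).prodMk measurable_snd)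
  cases Q with
  | LB =>
    have h1 : Measurable fun p : Ω × Vel N => ∫ r in s..t, E p.1 r :=
      measurable_intervalIntegral hEi measurable_const measurable_const
    have h2 : Measurable fun q : (Ω × Vel N) × ℝ => ∫ r in q.2..t, E q.1.1 r :=
      measurable_intervalIntegral (f := fun (q : (Ω × Vel N) × ℝ) r => E q.1.1 r)
        (hEi.comp ((measurable_fst.comp measurable_fst).prodMk measurable_snd))
        measurable_snd measurable_const
    refine ((hf.comp (measurable_snd.sub h1)).const_mul _).add (Measurable.const_mul ?_ _)
    refine measurable_intervalIntegral (α := Ω × Vel N) ?_ measurable_const measurable_const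
    exact ((measurable_exp_neg_sub t).comp measurable_snd).mul
      (measurable_maxwellian.comp ((measurable_snd.comp measurable_fst).sub h2))
  | FP =>
    have h1 : Measurable fun p : Ω × Vel N => ∫ r in s..t, Real.exp (-(t - r)) • E p.1 r :=
      measurable_intervalIntegral (((measurable_exp_neg_sub t).comp measurable_snd).smul hEi)
        measurable_const measurable_const
    have : (Function.uncurry fun ω => solution .FP f (E ω) s t) =
        fun p => ouSemigroup (t - s) f (p.2 - ∫ r in s..t, Real.exp (-(t - r)) • E p.1 r) := by
      funext p; exact solution_FP _ _ _ _ _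
    rw [this]
    exact (measurable_ouSemigroup _ hf).comp (measurable_snd.sub h1)

theorem measurable_invariantSolution {Ω : Type*} [MeasurableSpace Ω] {E : Ω → ℝ → Vel N}
    (hE : Measurable (Function.uncurry E)) (Q : Collision) (t : ℝ) :
    Measurable (Function.uncurry fun ω => invariantSolution Q (E ω) t) := by
  have hEi : Measurable fun p : (Ω × Vel N) × ℝ => E p.1.1 p.2 :=
    hE.comp ((measurable_fst.comp measurable_fst).prodMk measurable_snd)
  cases Q with
  | LB =>
    have h2 : Measurable fun q : (Ω × Vel N) × ℝ => ∫ r in q.2..t, E q.1.1 r :=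
      measurable_intervalIntegral (f := fun (q : (Ω × Vel N) × ℝ) r => E q.1.1 r)
        (hEi.comp ((measurable_fst.comp measurable_fst).prodMk measurable_snd))
        measurable_snd measurable_const
    refine (StronglyMeasurable.integral_prod_right (ν := volume.restrict (Iic t))
      (f := fun (p : Ω × Vel N) σ =>
        Real.exp (-(t - σ)) * maxwellian (p.2 - ∫ r in σ..t, E p.1 r)) ?_).measurable
    refine Measurable.stronglyMeasurable ?_
    exact ((measurable_exp_neg_sub t).comp measurable_snd).mul
      (measurable_maxwellian.comp ((measurable_snd.comp measurable_fst).sub h2))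
  | FP =>
    refine measurable_maxwellian.comp (measurable_snd.sub ?_)
    refine (StronglyMeasurable.integral_prod_right (ν := volume.restrict (Iic t))
      (f := fun (p : Ω × Vel N) r => Real.exp (-(t - r)) • E p.1 r) ?_).measurable
    exact (((measurable_exp_neg_sub t).comp measurable_snd).smul hEi).stronglyMeasurable

theorem measurable_solution_right {E : ℝ → Vel N} (hE : Measurable E) (Q : Collision)
    {f : Vel N → ℝ} (hf : Measurable f) (s t : ℝ) : Measurable (solution Q f E s t) :=
  (measurable_solution (Ω := Unit) (E := fun _ => E) (hE.comp measurable_snd) Q hf s t).of_uncurry_left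
    (x := ())

theorem measurable_invariantSolution_right {E : ℝ → Vel N} (hE : Measurable E) (Q : Collision)
    (t : ℝ) : Measurable (invariantSolution Q E t) :=
  (measurable_invariantSolution (Ω := Unit) (E := fun _ => E) (hE.comp measurable_snd) Q t).of_uncurry_left
    (x := ())

/-- The prefactor `e^{NT}` exactly cancels the Jacobian of the dilation by `e^T`. -/
theorem lintegral_ouSemigroup_le (T : ℝ) {f : Vel N → ℝ} (hf : Measurable f) :
    ∫⁻ z, ‖ouSemigroup T f z‖ₑ ≤ ∫⁻ v, ‖f v‖ₑ := by
  have hk : Measurable (Function.uncurry fun (w z : Vel N) =>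
      f (Real.exp T • z + √(Real.exp (2 * T) - 1) • w) * maxwellian w) :=
    (hf.comp (f := fun p : Vel N × Vel N => Real.exp T • p.2 + √(Real.exp (2 * T) - 1) • p.1)
      (by fun_prop)).mul (measurable_maxwellian.comp measurable_fst)
  have h1 := lintegral_enorm_integral_le (μ := volume) (ν := volume) hk
  have h2 (w : Vel N) : ∫⁻ z : Vel N,
      ‖f (Real.exp T • z + √(Real.exp (2 * T) - 1) • w) * maxwellian w‖ₑ =
      (ENNReal.ofReal ((Real.exp T ^ N)⁻¹) * ∫⁻ v, ‖f v‖ₑ) * ‖maxwellian w‖ₑ := by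
    simp only [enorm_mul]
    rw [lintegral_mul_const' _ _ (by simp), lintegral_comp_smul_add hf.enorm (Real.exp_pos T)]
  simp only [h2] at h1
  rw [lintegral_const_mul _ measurable_maxwellian.enorm, lintegral_maxwellian, mul_one] at h1
  unfold ouSemigroup
  simp only [enorm_mul]
  rw [lintegral_const_mul' _ _ (by simp), Real.enorm_of_nonneg (Real.exp_pos _).le]
  refine (mul_le_mul_right h1 _).trans ?_
  rw [← mul_assoc, ← ENNReal.ofReal_mul (Real.exp_pos _).le, ← Real.exp_nat_mul,
    mul_inv_cancel₀ (Real.exp_pos _).ne', ENNReal.ofReal_one, one_mul]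

theorem enorm_density_le (f : Vel N → ℝ) : ‖density f‖ₑ ≤ ∫⁻ v, ‖f v‖ₑ :=
  enorm_integral_le_lintegral_enorm _

theorem exists_lintegral_solution_le (N : ℕ) (s t : ℝ) : ∃ C : ℝ≥0∞, C ≠ ∞ ∧
    ∀ (Q : Collision) (E : ℝ → Vel N), Measurable E → ∀ f : Vel N → ℝ, Measurable f →
      ∫⁻ v, ‖solution Q f E s t v‖ₑ ≤ C * ∫⁻ v, ‖f v‖ₑ := by
  -- The `1` serves the FP case; the other two terms are the transported datum and the source in the
  -- LB case. The interval is unordered because `s ≤ t` is not assumed.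
  refine ⟨1 + ENNReal.ofReal (Real.exp (-(t - s))) +
    ∫⁻ σ in uIoc s t, ENNReal.ofReal (Real.exp (-(t - σ))), ?_, fun Q E hE f hf => ?_⟩
  · refine ENNReal.add_ne_top.2 ⟨by simp, ?_⟩
    have h : uIoc s t ⊆ Iic (max s t) := fun σ hσ => hσ.2
    exact ((lintegral_mono_set h).trans_lt
      (by rw [lintegral_exp_neg_sub_Iic]; exact ENNReal.ofReal_lt_top)).ne
  cases Q with
  | LB =>
    simp only [solution]
    have h1 : Measurable fun v => Real.exp (-(t - s)) * f (v - ∫ r in s..t, E r) :=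
      (hf.comp (measurable_id.sub_const _)).const_mul _
    refine (lintegral_mono fun v => enorm_add_le _ _).trans ?_
    rw [lintegral_add_left h1.enorm, add_mul, add_mul, one_mul, add_assoc]
    simp only [enorm_mul]
    rw [lintegral_const_mul' _ _ (by simp), lintegral_const_mul' _ _ (by simp),
      lintegral_sub_right_eq_self (fun v => ‖f v‖ₑ), Real.enorm_of_nonneg (Real.exp_pos _).le]
    refine le_trans ?_ le_add_self
    refine add_le_add le_rfl ?_
    rw [mul_comm]
    refine mul_le_mul' ?_ (enorm_density_le f)
    have hn (g : ℝ → ℝ) : ‖∫ σ in s..t, g σ‖ₑ = ‖∫ σ in uIoc s t, g σ‖ₑ := by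
      rw [← enorm_norm, intervalIntegral.norm_intervalIntegral_eq, enorm_norm]
    simp only [hn]
    exact lintegral_setIntegral_exp_mul_maxwellian_le (measurable_drift hE t) t _
  | FP =>
    simp only [solution_FP]
    rw [lintegral_sub_right_eq_self (fun v => ‖ouSemigroup (t - s) f v‖ₑ), add_assoc, add_mul,
      one_mul]
    exact (lintegral_ouSemigroup_le _ hf).trans le_self_add

theorem integrable_solution {E : ℝ → Vel N} (hE : Measurable E) (Q : Collision)
    {f : Vel N → ℝ} (hf : Measurable f) (hfi : Integrable f) (s t : ℝ) :
    Integrable (solution Q f E s t) := by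
  obtain ⟨C, hC, h⟩ := exists_lintegral_solution_le N s t
  exact ⟨(measurable_solution_right hE Q hf s t).aestronglyMeasurable,
    (h Q E hE f hf).trans_lt (ENNReal.mul_lt_top hC.lt_top hfi.hasFiniteIntegral)⟩

theorem integrable_invariantSolution {E : ℝ → Vel N} (hE : Measurable E) (Q : Collision) (t : ℝ) :
    Integrable (invariantSolution Q E t) := by
  cases Q with
  | LB =>
    refine ⟨(measurable_invariantSolution_right hE .LB t).aestronglyMeasurable, ?_⟩
    refine (lintegral_setIntegral_exp_mul_maxwellian_le (measurable_drift hE t) t (Iic t)).trans_lt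
      ?_
    rw [lintegral_exp_neg_sub_Iic]; exact ENNReal.ofReal_lt_top
  | FP => exact integrable_maxwellian.comp_sub_right _

theorem integrable_ouSemigroup_integrand (T : ℝ) {f : Vel N → ℝ} (hfi : Integrable f) (z : Vel N) : Integrable fun w : Vel N =>
      f (Real.exp T • z + √(Real.exp (2 * T) - 1) • w) * maxwellian w := by
  by_cases hc : √(Real.exp (2 * T) - 1) = 0
  · simp only [hc, zero_smul, add_zero]
    exact integrable_maxwellian.const_mul _
  · have h1 : Integrable fun w : Vel N => f (Real.exp T • z + √(Real.exp (2 * T) - 1) • w) := by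
      simpa only [add_comm] using integrable_comp_smul_add hfi hc (Real.exp T • z)
    refine h1.mul_bdd (c := (2 * Real.pi) ^ (-(N : ℝ) / 2))
      measurable_maxwellian.aestronglyMeasurable (Eventually.of_forall fun w => ?_)
    rw [Real.norm_of_nonneg (maxwellian_pos _).le]
    exact maxwellian_le _

theorem solution_sub (Q : Collision) {f g : Vel N → ℝ} (hfi : Integrable f) (hgi : Integrable g) (E : ℝ → Vel N) (s t : ℝ) (v : Vel N) :
    solution Q (f - g) E s t v = solution Q f E s t v - solution Q g E s t v := by
  cases Q with
  | LB =>
    have : density (f - g) = density f - density g := integral_sub hfi hgi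
    simp only [solution, this, Pi.sub_apply]
    ring
  | FP =>
    simp only [solution_FP, ouSemigroup, Pi.sub_apply, sub_mul]
    rw [integral_sub (integrable_ouSemigroup_integrand _ hfi _)
      (integrable_ouSemigroup_integrand _ hgi _), mul_sub]

theorem solution_const_mul (Q : Collision) (c : ℝ) (f : Vel N → ℝ) (E : ℝ → Vel N) (s t : ℝ)
    (v : Vel N) : solution Q (fun v => c * f v) E s t v = c * solution Q f E s t v := by
  cases Q with
  | LB =>
    have : density (fun v => c * f v) = c * density f := integral_const_mul _ _
    simp only [solution, this]
    ring
  | FP =>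
    simp only [solution_FP, ouSemigroup, mul_assoc, integral_const_mul]
    ring

theorem lintegral_solution_sub_le (s t : ℝ) : ∃ C : ℝ≥0∞, C ≠ ∞ ∧
    ∀ (Q : Collision) (E : ℝ → Vel N), Measurable E → ∀ f g : Vel N → ℝ, Measurable f →
      Integrable f → Measurable g → Integrable g →
      ∫⁻ v, ‖solution Q f E s t v - solution Q g E s t v‖ₑ ≤ C * ∫⁻ v, ‖f v - g v‖ₑ := by
  obtain ⟨C, hC, h⟩ := exists_lintegral_solution_le N s t
  refine ⟨C, hC, fun Q E hE f g hf hfi hg hgi => ?_⟩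
  simp only [← solution_sub Q hfi hgi]
  exact h Q E hE (f - g) (hf.sub hg)

/-- The formulas evaluate a representative pointwise; the `L¹` bound on differences shows that they
act on classes. -/
theorem solution_congr_ae (Q : Collision) {f g : Vel N → ℝ} (hf : Measurable f)
    (hfi : Integrable f) (hg : Measurable g) (hgi : Integrable g) (hfg : f =ᵐ[volume] g)
    {E : ℝ → Vel N} (hE : Measurable E) (s t : ℝ) :
    solution Q f E s t =ᵐ[volume] solution Q g E s t := by
  obtain ⟨C, hC, h⟩ := lintegral_solution_sub_le (N := N) s t
  have h1 := h Q E hE f g hf hfi hg hgi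
  have h2 : ∫⁻ v, ‖f v - g v‖ₑ = 0 := by
    refine (lintegral_congr_ae ?_).trans lintegral_zero
    filter_upwards [hfg] with v hv
    simp [hv]
  have h3 : Measurable fun v => ‖solution Q f E s t v - solution Q g E s t v‖ₑ :=
    ((measurable_solution_right hE Q hf s t).sub (measurable_solution_right hE Q hg s t)).enorm
  rw [h2, mul_zero, nonpos_iff_eq_zero, lintegral_eq_zero_iff h3] at h1
  filter_upwards [h1] with v hv
  simpa [sub_eq_zero] using hv

end Solution
-- Relaxation of the Ornstein-Uhlenbeck semigroup
section OrnsteinUhlenbeck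

variable {N : ℕ}

/-- With `c² = e^{2T} - 1`, one has `|e^T z + cw|² + |w|² = |z|² + |e^T w + cz|²`. This pulls a
Maxwellian in `z` out of the integral over `w`, which makes `M` invariant. -/
theorem maxwellian_mul_maxwellian {T : ℝ} (hT : 0 ≤ T) (z w : Vel N) :
    maxwellian (Real.exp T • z + √(Real.exp (2 * T) - 1) • w) * maxwellian w =
      maxwellian z * maxwellian (Real.exp T • w + √(Real.exp (2 * T) - 1) • z) := by
  have hc : √(Real.exp (2 * T) - 1) ^ 2 = Real.exp T ^ 2 - 1 := by
    rw [Real.sq_sqrt (by linarith [Real.one_le_exp (by positivity : 0 ≤ 2 * T)]),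
      ← Real.exp_nat_mul]
    norm_num
  have h : ∀ c A B : ℝ, (c * Real.exp A) * (c * Real.exp B) = c ^ 2 * Real.exp (A + B) := by
    intro c A B; rw [Real.exp_add]; ring
  unfold maxwellian
  rw [h, h]
  congr 2
  rw [norm_add_sq_real, norm_add_sq_real]
  simp only [norm_smul, mul_pow, Real.norm_eq_abs, sq_abs, inner_smul_left, inner_smul_right, hc,
    real_inner_comm w z, RCLike.conj_to_real]
  ring

theorem ouSemigroup_maxwellian_sub {T : ℝ} (hT : 0 ≤ T) (b z : Vel N) :
    ouSemigroup T (fun v => maxwellian (v - b)) z = maxwellian (z - Real.exp (-T) • b) := by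
  unfold ouSemigroup
  have h1 (w : Vel N) : Real.exp T • z + √(Real.exp (2 * T) - 1) • w - b =
      Real.exp T • (z - Real.exp (-T) • b) + √(Real.exp (2 * T) - 1) • w := by
    rw [smul_sub, smul_smul, ← Real.exp_add]
    simp only [add_neg_cancel, Real.exp_zero, one_smul]
    abel
  simp only [h1, maxwellian_mul_maxwellian hT]
  rw [integral_const_mul, integral_comp_smul_add _ (Real.exp_pos T), integral_maxwellian,
    ← Real.exp_nat_mul, mul_one, mul_left_comm, mul_inv_cancel₀ (Real.exp_pos _).ne', mul_one]

theorem ouSemigroup_maxwellian {T : ℝ} (hT : 0 ≤ T) (z : Vel N) :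
    ouSemigroup T maxwellian z = maxwellian z := by
  simpa using ouSemigroup_maxwellian_sub hT 0 z

theorem solution_FP_maxwellian {s t : ℝ} (hst : s ≤ t) (E : ℝ → Vel N) (v : Vel N) :
    solution .FP maxwellian E s t v =
      maxwellian (v - ∫ σ in s..t, Real.exp (-(t - σ)) • E σ) := by
  rw [solution_FP, ouSemigroup_maxwellian (by linarith)]

/-- The centred Gaussian density of covariance `l² Id`. -/
def scaledMaxwellian (l : ℝ) (v : Vel N) : ℝ := (l ^ N)⁻¹ * maxwellian (l⁻¹ • v)

theorem continuous_scaledMaxwellian (l : ℝ) : Continuous (scaledMaxwellian (N := N) l) :=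
  continuous_const.mul (continuous_maxwellian.comp (continuous_const_smul _))

/-- The standard deviation at time `T` of the Ornstein-Uhlenbeck process. -/
def ouDeviation (T : ℝ) : ℝ := √(1 - Real.exp (-(2 * T)))

theorem ouDeviation_pos {T : ℝ} (hT : 0 < T) : 0 < ouDeviation T :=
  Real.sqrt_pos.2 (by linarith [Real.exp_lt_one_iff.2 (by linarith : -(2 * T) < 0)])

theorem tendsto_ouDeviation : Tendsto ouDeviation atTop (𝓝[≤] 1) := by
  refine tendsto_nhdsWithin_iff.2 ⟨?_, Eventually.of_forall fun T => ?_⟩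
  · have h1 : Tendsto (fun T : ℝ => Real.exp (-(2 * T))) atTop (𝓝 0) :=
      Real.tendsto_exp_neg_atTop_nhds_zero.comp (tendsto_id.const_mul_atTop (by norm_num))
    have h2 := (h1.const_sub 1).sqrt
    simp only [sub_zero, Real.sqrt_one] at h2
    exact h2
  · exact Real.sqrt_le_one.2 (by linarith [Real.exp_pos (-(2 * T))])

/-- The substitution `y = e^T z + √(e^{2T} - 1) w` turns the average into the Mehler kernel; strict
positivity of `T` makes it nondegenerate. -/
theorem ouSemigroup_eq {T : ℝ} (hT : 0 < T) (f : Vel N → ℝ) (z : Vel N) :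
    ouSemigroup T f z =
      ∫ y, f y * scaledMaxwellian (ouDeviation T) (z - Real.exp (-T) • y) := by
  have hl := ouDeviation_pos hT
  have hc : √(Real.exp (2 * T) - 1) = Real.exp T * ouDeviation T := by
    rw [ouDeviation, ← Real.sqrt_sq (Real.exp_pos T).le, ← Real.sqrt_mul (by positivity)]
    congr 1
    rw [← Real.exp_nat_mul, mul_sub, ← Real.exp_add]
    norm_num
  have hc0 : 0 < Real.exp T * ouDeviation T := mul_pos (Real.exp_pos T) hl
  have h := integral_comp_smul_add (fun y => f y *
    maxwellian ((ouDeviation T)⁻¹ • (z - Real.exp (-T) • y))) hc0 (Real.exp T • z)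
  have h1 (w : Vel N) : maxwellian ((ouDeviation T)⁻¹ •
      (z - Real.exp (-T) • ((Real.exp T * ouDeviation T) • w + Real.exp T • z))) =
      maxwellian w := by
    rw [← maxwellian_neg w, smul_add, smul_smul, smul_smul, ← mul_assoc, ← Real.exp_add]
    simp only [neg_add_cancel, Real.exp_zero, one_smul, one_mul]
    rw [show z - (ouDeviation T • w + z) = -(ouDeviation T • w) by abel, smul_neg, smul_smul,
      inv_mul_cancel₀ hl.ne', one_smul]
  simp only [h1] at h
  unfold ouSemigroup
  rw [hc]
  simp only [add_comm (Real.exp T • z)]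
  rw [h, ← mul_assoc, mul_pow, mul_inv, ← mul_assoc, ← Real.exp_nat_mul,
    mul_inv_cancel₀ (Real.exp_pos _).ne', one_mul, ← integral_const_mul]
  refine integral_congr_ae (Eventually.of_forall fun y => ?_)
  simp only [scaledMaxwellian]
  ring

theorem scaledMaxwellian_nonneg {l : ℝ} (hl : 0 ≤ l) (v : Vel N) : 0 ≤ scaledMaxwellian l v :=
  mul_nonneg (by positivity) (maxwellian_pos _).le

theorem scaledMaxwellian_le {l : ℝ} (hl : 0 ≤ l) (v : Vel N) :
    scaledMaxwellian l v ≤ (l ^ N)⁻¹ * (2 * Real.pi) ^ (-(N : ℝ) / 2) :=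
  mul_le_mul_of_nonneg_left (maxwellian_le _) (by positivity)

/-- The `L¹` distance of the centred Gaussian density of covariance `l² Id` to the Maxwellian. -/
def scaledDist (N : ℕ) (l : ℝ) : ℝ≥0∞ := ∫⁻ v : Vel N, ‖scaledMaxwellian l v - maxwellian v‖ₑ

/-- Dominated convergence. Approaching `1` from below matters: for `1/2 < l ≤ 1`, `|v/l| ≥ |v|` and
`l^{-N} ≤ 2^N`, so the scaled Gaussian is at most `2^N M`. -/
theorem tendsto_scaledDist : Tendsto (scaledDist N) (𝓝[≤] 1) (𝓝 0) := by
  have h0 : ∫⁻ _ : Vel N, (0 : ℝ≥0∞) = 0 := lintegral_zero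
  rw [← h0]
  refine tendsto_lintegral_filter_of_dominated_convergence
    (fun v => ENNReal.ofReal (2 ^ N * maxwellian v) + ENNReal.ofReal (maxwellian v))
    (Eventually.of_forall fun l =>
      ((continuous_scaledMaxwellian l).measurable.sub measurable_maxwellian).enorm) ?_ ?_ ?_
  · have h1 : ∀ᶠ l : ℝ in 𝓝[≤] 1, 1 / 2 < l :=
      nhdsWithin_le_nhds (eventually_gt_nhds (by norm_num))
    filter_upwards [h1, self_mem_nhdsWithin] with l hl hl1
    refine Eventually.of_forall fun v => ?_
    have hl0 : 0 < l := by linarith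
    refine enorm_sub_le.trans ?_
    rw [Real.enorm_of_nonneg (maxwellian_pos v).le,
      Real.enorm_of_nonneg (scaledMaxwellian_nonneg hl0.le v)]
    gcongr
    unfold scaledMaxwellian
    refine mul_le_mul ?_ ?_ (maxwellian_pos _).le (by positivity)
    · rw [← inv_pow]
      refine pow_le_pow_left₀ (by positivity) ?_ N
      rw [inv_le_comm₀ hl0 (by norm_num)]
      linarith
    · unfold maxwellian
      have : ‖v‖ ≤ ‖l⁻¹ • v‖ := by
        rw [norm_smul, norm_inv, Real.norm_of_nonneg hl0.le]
        exact le_mul_of_one_le_left (norm_nonneg _) ((one_le_inv₀ hl0).2 hl1)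
      have := pow_le_pow_left₀ (norm_nonneg v) this 2
      gcongr
  · rw [lintegral_add_left (measurable_maxwellian.const_mul _).ennreal_ofReal]
    refine (ENNReal.add_lt_top.2 ⟨?_, ?_⟩).ne
    · exact (integrable_maxwellian.const_mul _).lintegral_lt_top
    · exact integrable_maxwellian.lintegral_lt_top
  · refine Eventually.of_forall fun v => ?_
    have h2 : ContinuousAt (fun l : ℝ => ‖scaledMaxwellian l v - maxwellian v‖ₑ) 1 := by
      refine ContinuousAt.enorm (ContinuousAt.sub ?_ continuousAt_const)
      unfold scaledMaxwellian
      have hi : ContinuousAt (fun l : ℝ => l⁻¹) 1 := continuousAt_inv₀ one_ne_zero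
      refine ContinuousAt.mul ((continuousAt_id.pow N).inv₀ (by simp)) ?_
      exact continuous_maxwellian.continuousAt.comp (hi.smul continuousAt_const)
    have h3 := h2.tendsto.mono_left (nhdsWithin_le_nhds (s := Iic 1))
    simpa [scaledMaxwellian] using h3

/-- A rate of relaxation to equilibrium. -/
def relaxationRate (f : Vel N → ℝ) (T : ℝ) : ℝ≥0∞ :=
  ∫⁻ y, ‖f y‖ₑ * (scaledDist N (ouDeviation T) +
    min 2 (maxwellianMoment N * ‖Real.exp (-T) • y‖ₑ))

/-- By Minkowski it suffices to compare the Mehler kernel with `M` for each starting point `y`. The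
covariance is changed first, at cost `scaledDist`, then the centre `e^{-T} y` is moved to `0`. -/
theorem lintegral_ouSemigroup_sub_le {T : ℝ} (hT : 0 < T) {f : Vel N → ℝ} (hf : Measurable f)
    (hfi : Integrable f) :
    ∫⁻ z, ‖ouSemigroup T f z - density f * maxwellian z‖ₑ ≤ relaxationRate f T := by
  have hl := (ouDeviation_pos hT).le
  have hint (z : Vel N) : Integrable fun y =>
      f y * scaledMaxwellian (ouDeviation T) (z - Real.exp (-T) • y) := by
    refine hfi.mul_bdd (c := ((ouDeviation T) ^ N)⁻¹ * (2 * Real.pi) ^ (-(N : ℝ) / 2))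
      ((continuous_scaledMaxwellian _).measurable.comp
        (measurable_const.sub (measurable_id.const_smul (Real.exp (-T))))).aestronglyMeasurable
      (Eventually.of_forall fun w => ?_)
    rw [Real.norm_of_nonneg (scaledMaxwellian_nonneg hl _)]
    exact scaledMaxwellian_le hl _
  have h1 (z : Vel N) : ouSemigroup T f z - density f * maxwellian z =
      ∫ y, f y * (scaledMaxwellian (ouDeviation T) (z - Real.exp (-T) • y) - maxwellian z) := by
    simp only [mul_sub]
    rw [integral_sub (hint z) (hfi.mul_const _), integral_mul_const, ← ouSemigroup_eq hT]
    rfl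
  simp only [h1]
  refine (lintegral_enorm_integral_le ?_).trans ?_
  · have h2 : Measurable fun p : Vel N × Vel N => p.2 - Real.exp (-T) • p.1 := by fun_prop
    exact (hf.comp measurable_fst).mul (((continuous_scaledMaxwellian _).measurable.comp h2).sub
      (measurable_maxwellian.comp measurable_snd))
  · unfold relaxationRate
    refine lintegral_mono fun y => ?_
    simp only [enorm_mul]
    rw [lintegral_const_mul' _ _ (by simp)]
    refine mul_le_mul_right ?_ _
    set a := Real.exp (-T) • y
    have h3 : ∫⁻ v : Vel N, ‖scaledMaxwellian (ouDeviation T) (v - a) - maxwellian (v - a)‖ₑ =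
        scaledDist N (ouDeviation T) :=
      lintegral_sub_right_eq_self
        (fun v => ‖scaledMaxwellian (ouDeviation T) v - maxwellian v‖ₑ) a
    have hm1 : Measurable fun v : Vel N => maxwellian (v - a) :=
      measurable_maxwellian.comp (measurable_id.sub_const a)
    have hm2 : Measurable fun v : Vel N => scaledMaxwellian (ouDeviation T) (v - a) :=
      (continuous_scaledMaxwellian _).measurable.comp (measurable_id.sub_const a)
    have h4 : ∫⁻ v : Vel N, ‖maxwellian (v - a) - maxwellian v‖ₑ ≤
        min 2 (maxwellianMoment N * ‖a‖ₑ) := by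
      refine le_min ?_ (by simpa using lintegral_maxwellian_sub_le a 0)
      refine (lintegral_mono fun v => enorm_sub_le).trans ?_
      rw [lintegral_add_left hm1.enorm, lintegral_maxwellian_sub, lintegral_maxwellian,
        one_add_one_eq_two]
    rw [← h3]
    refine le_trans ?_ (add_le_add le_rfl h4)
    have hm3 : Measurable fun v : Vel N =>
        ‖scaledMaxwellian (ouDeviation T) (v - a) - maxwellian (v - a)‖ₑ := (hm2.sub hm1).enorm
    rw [← lintegral_add_left hm3]
    refine lintegral_mono fun v => ?_
    refine le_trans (le_of_eq ?_) (enorm_add_le _ _)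
    congr 1; ring

/-- Dominated convergence with majorant `3|f|`: the cap `2` on the translation cost dispenses with a
first moment of `f`. -/
theorem tendsto_relaxationRate {f : Vel N → ℝ} (hf : Measurable f) (hfi : Integrable f) :
    Tendsto (relaxationRate f) atTop (𝓝 0) := by
  have h0 : ∫⁻ _ : Vel N, (0 : ℝ≥0∞) = 0 := lintegral_zero
  have hd : Tendsto (fun T => scaledDist N (ouDeviation T)) atTop (𝓝 0) :=
    tendsto_scaledDist.comp tendsto_ouDeviation
  rw [← h0]
  refine tendsto_lintegral_filter_of_dominated_convergence (fun v => ‖f v‖ₑ * (1 + 2))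
    (Eventually.of_forall fun T => ?_) ?_ ?_ ?_
  · refine hf.enorm.mul (measurable_const.add (measurable_const.min ?_))
    exact ((measurable_id.const_smul (Real.exp (-T))).enorm).const_mul _
  · filter_upwards [hd.eventually (gt_mem_nhds zero_lt_one)] with T hT
    refine Eventually.of_forall fun v => ?_
    gcongr
    exact min_le_left _ _
  · rw [lintegral_mul_const' _ _ (by simp)]
    exact ENNReal.mul_ne_top hfi.hasFiniteIntegral.ne (by simp)
  · refine Eventually.of_forall fun v => ?_
    have h1 : Tendsto (fun T : ℝ => ‖Real.exp (-T) • v‖ₑ) atTop (𝓝 0) := by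
      have := (Real.tendsto_exp_neg_atTop_nhds_zero.smul_const v).enorm
      simpa using this
    have h2 : Tendsto (fun T : ℝ => maxwellianMoment N * ‖Real.exp (-T) • v‖ₑ) atTop (𝓝 0) := by
      simpa using ENNReal.Tendsto.const_mul h1 (Or.inr maxwellianMoment_ne_top)
    have h3 : Tendsto (fun T : ℝ => min 2 (maxwellianMoment N * ‖Real.exp (-T) • v‖ₑ)) atTop
        (𝓝 0) := by
      simpa using (tendsto_const_nhds (x := (2 : ℝ≥0∞))).min h2
    simpa using ENNReal.Tendsto.const_mul (hd.add h3) (Or.inr (enorm_ne_top (x := f v)))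

end OrnsteinUhlenbeck

/-! ### Relaxation, stability in the force, and the invariant solutions -/

section Estimates

variable {N : ℕ}

theorem density_maxwellian : density (maxwellian (N := N)) = 1 := integral_maxwellian

/-- Relaxation of the solution to the solution started from the Maxwellian, uniformly with respect
to the force field. -/
theorem exists_relaxation {f : Vel N → ℝ} (hf : Measurable f) (hfi : Integrable f) :
    ∃ ε : ℝ → ℝ≥0∞, Tendsto ε atTop (𝓝 0) ∧ ∀ (Q : Collision) (E : ℝ → Vel N) (s t : ℝ), s < t →
      ∫⁻ v, ‖solution Q f E s t v - density f * solution Q maxwellian E s t v‖ₑ ≤ ε (t - s) := by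
  -- A single rate for both operators: the first term serves FP, the second LB.
  refine ⟨fun T => relaxationRate f T +
    ENNReal.ofReal (Real.exp (-T)) * ∫⁻ v, ‖f v - density f * maxwellian v‖ₑ, ?_, ?_⟩
  · have h1 : Tendsto (fun T : ℝ => ENNReal.ofReal (Real.exp (-T))) atTop (𝓝 0) := by
      simpa using ENNReal.tendsto_ofReal Real.tendsto_exp_neg_atTop_nhds_zero
    have h2 := ENNReal.Tendsto.mul_const (b := ∫⁻ v, ‖f v - density f * maxwellian v‖ₑ) h1
      (Or.inr (hfi.sub (integrable_maxwellian.const_mul _)).hasFiniteIntegral.ne)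
    simpa using (tendsto_relaxationRate hf hfi).add h2
  · intro Q E s t hst
    cases Q with
    | LB =>
      refine le_trans (le_of_eq ?_) le_add_self
      -- The source terms cancel because `M` has mass one.
      have h (v : Vel N) : solution .LB f E s t v - density f * solution .LB maxwellian E s t v =
          Real.exp (-(t - s)) * (f (v - ∫ r in s..t, E r) -
            density f * maxwellian (v - ∫ r in s..t, E r)) := by
        simp only [solution, density_maxwellian]; ring
      simp only [h, enorm_mul]
      rw [lintegral_const_mul' _ _ (by simp), Real.enorm_of_nonneg (Real.exp_pos _).le,
        lintegral_sub_right_eq_self (fun v => ‖f v - density f * maxwellian v‖ₑ)]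
    | FP =>
      refine le_trans ?_ le_self_add
      simp only [solution_FP_maxwellian hst.le, solution_FP]
      rw [lintegral_sub_right_eq_self
        (fun v => ‖ouSemigroup (t - s) f v - density f * maxwellian v‖ₑ)]
      exact lintegral_ouSemigroup_sub_le (by linarith) hf hfi

/-- Tonelli on the triangle `s < σ < r ≤ t`, the integral of `e^{-(t-σ)}` over `σ ≤ r` being
`e^{-(t-r)}`. It absorbs the drift accumulated since each emission time `σ` of the LB source. -/
theorem lintegral_exp_mul_setLIntegral_le (s t : ℝ) {d : ℝ → ℝ≥0∞} (hd : Measurable d) :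
    ∫⁻ σ in Ioc s t, ENNReal.ofReal (Real.exp (-(t - σ))) * ∫⁻ r in Ioc σ t, d r ≤
      ∫⁻ r in Ioc s t, ENNReal.ofReal (Real.exp (-(t - r))) * d r := by
  have hm : Measurable fun σ : ℝ => ENNReal.ofReal (Real.exp (-(t - σ))) :=
    (measurable_exp_neg_sub t).ennreal_ofReal
  have hs : MeasurableSet {p : ℝ × ℝ | p.1 < p.2} := measurableSet_lt measurable_fst measurable_snd
  let k : ℝ → ℝ → ℝ≥0∞ := fun σ r =>
    {p : ℝ × ℝ | p.1 < p.2}.indicator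
      (fun p => ENNReal.ofReal (Real.exp (-(t - p.1))) * d p.2) (σ, r)
  have hk : Measurable (Function.uncurry k) :=
    ((hm.comp measurable_fst).mul (hd.comp measurable_snd)).indicator hs
  have h1 : ∀ σ ∈ Ioc s t, ENNReal.ofReal (Real.exp (-(t - σ))) * ∫⁻ r in Ioc σ t, d r =
      ∫⁻ r in Ioc s t, k σ r := by
    intro σ hσ
    have : ∀ r, k σ r = (Ioi σ).indicator
        (fun r => ENNReal.ofReal (Real.exp (-(t - σ))) * d r) r := fun r => by
      simp only [k, indicator, mem_ofPred_eq, mem_Ioi]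
    simp only [this]
    rw [lintegral_indicator measurableSet_Ioi, Measure.restrict_restrict measurableSet_Ioi,
      lintegral_const_mul' _ _ (by simp)]
    congr 3
    ext r
    simp only [mem_inter_iff, mem_Ioi, mem_Ioc]
    exact ⟨fun h => ⟨h.1, hσ.1.trans h.1, h.2⟩, fun h => ⟨h.1, h.2.2⟩⟩
  rw [setLIntegral_congr_fun measurableSet_Ioc h1, lintegral_lintegral_swap hk.aemeasurable]
  refine setLIntegral_mono' measurableSet_Ioc fun r _ => ?_
  have h2 : ∀ σ, k σ r = (Iio r).indicator
      (fun σ => ENNReal.ofReal (Real.exp (-(t - σ))) * d r) σ := fun σ => by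
    simp only [k, indicator, mem_ofPred_eq, mem_Iio]
  simp only [h2]
  rw [← lintegral_exp_neg_sub_Iic t r, ← lintegral_mul_const _ hm,
    lintegral_indicator measurableSet_Iio]
  exact lintegral_mono' (Measure.restrict_mono_set _ Iio_subset_Iic_self |>.trans' (by
    rw [Measure.restrict_restrict measurableSet_Iio]
    exact Measure.restrict_mono_set _ inter_subset_left)) le_rfl

theorem enorm_intervalIntegral_sub_le {E E' : ℝ → Vel N} {s t : ℝ} (hst : s ≤ t)
    (hE : IntervalIntegrable E volume s t) (hE' : IntervalIntegrable E' volume s t) :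
    ‖(∫ r in s..t, E r) - ∫ r in s..t, E' r‖ₑ ≤ ∫⁻ r in Ioc s t, ‖E r - E' r‖ₑ := by
  rw [← intervalIntegral.integral_sub hE hE', intervalIntegral.integral_of_le hst]
  exact enorm_integral_le_lintegral_enorm _

/-- Stability with respect to the force field of the solution started from the Maxwellian. -/
theorem lintegral_solution_maxwellian_sub_le (Q : Collision) {E E' : ℝ → Vel N}
    (hE : Measurable E) (hE' : Measurable E') (hEi : LocallyIntegrable E)
    (hEi' : LocallyIntegrable E') {s t : ℝ} (hst : s ≤ t) :
    ∫⁻ v, ‖solution Q maxwellian E s t v - solution Q maxwellian E' s t v‖ₑ ≤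
      2 * maxwellianMoment N *
        ∫⁻ r in Ioc s t, ENNReal.ofReal (Real.exp (-(t - r))) * ‖E r - E' r‖ₑ := by
  set J := ∫⁻ r in Ioc s t, ENNReal.ofReal (Real.exp (-(t - r))) * ‖E r - E' r‖ₑ
  have hi (X : ℝ → Vel N) (hX : LocallyIntegrable X) (a b : ℝ) :
      IntervalIntegrable X volume a b :=
    (hX.integrableOn_isCompact isCompact_uIcc).intervalIntegrable
  cases Q with
  | LB =>
    have hd := measurable_drift hE t
    have hd' := measurable_drift hE' t
    have h (v : Vel N) : solution .LB maxwellian E s t v - solution .LB maxwellian E' s t v =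
        Real.exp (-(t - s)) * (maxwellian (v - ∫ r in s..t, E r) -
          maxwellian (v - ∫ r in s..t, E' r)) +
        ∫ σ in Ioc s t, Real.exp (-(t - σ)) * (maxwellian (v - ∫ r in σ..t, E r) -
          maxwellian (v - ∫ r in σ..t, E' r)) := by
      simp only [solution, density_maxwellian, one_mul, mul_sub]
      rw [← intervalIntegral.integral_of_le hst, intervalIntegral.integral_sub
        (intervalIntegrable_exp_mul_maxwellian hd t s t v)
        (intervalIntegrable_exp_mul_maxwellian hd' t s t v)]
      ring
    simp only [h]
    have hm0 (a : Vel N) : Measurable fun v : Vel N => maxwellian (v - a) :=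
      measurable_maxwellian.comp (measurable_id.sub_const a)
    have hm1 : Measurable fun v : Vel N => Real.exp (-(t - s)) *
      (maxwellian (v - ∫ r in s..t, E r) - maxwellian (v - ∫ r in s..t, E' r)) :=
      ((hm0 _).sub (hm0 _)).const_mul _
    refine (lintegral_mono fun v => enorm_add_le _ _).trans ?_
    rw [lintegral_add_left hm1.enorm, mul_assoc, two_mul]
    -- The transported datum and the source each cost one copy of `J`, whence the factor `2`; FP
    -- needs only one.
    refine add_le_add ?_ ?_
    · simp only [enorm_mul]
      rw [lintegral_const_mul' _ _ (by simp), Real.enorm_of_nonneg (Real.exp_pos _).le]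
      refine (mul_le_mul_right ((lintegral_maxwellian_sub_le _ _).trans
        (mul_le_mul_right (enorm_intervalIntegral_sub_le hst (hi E hEi s t)
          (hi E' hEi' s t)) _)) _).trans ?_
      rw [mul_left_comm]
      refine mul_le_mul_right ?_ _
      rw [← lintegral_const_mul' _ _ (by simp)]
      -- On the interval `e^{-(t-s)} ≤ e^{-(t-r)}`.
      refine setLIntegral_mono' measurableSet_Ioc fun r hr => ?_
      gcongr
      exact hr.1.le
    · have hm2 : Measurable (Function.uncurry fun (σ : ℝ) (v : Vel N) =>
          Real.exp (-(t - σ)) * (maxwellian (v - ∫ r in σ..t, E r) -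
          maxwellian (v - ∫ r in σ..t, E' r))) := by
        simp only [mul_sub]
        exact (measurable_exp_mul_maxwellian hd t).sub (measurable_exp_mul_maxwellian hd' t)
      refine (lintegral_enorm_integral_le hm2).trans ?_
      have h3 : ∀ σ ∈ Ioc s t, ∫⁻ v : Vel N, ‖Real.exp (-(t - σ)) *
          (maxwellian (v - ∫ r in σ..t, E r) - maxwellian (v - ∫ r in σ..t, E' r))‖ₑ ≤
          maxwellianMoment N * (ENNReal.ofReal (Real.exp (-(t - σ))) *
            ∫⁻ r in Ioc σ t, ‖E r - E' r‖ₑ) := by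
        intro σ hσ
        simp only [enorm_mul]
        rw [lintegral_const_mul' _ _ (by simp), Real.enorm_of_nonneg (Real.exp_pos _).le,
          mul_left_comm]
        exact mul_le_mul_right ((lintegral_maxwellian_sub_le _ _).trans
          (mul_le_mul_right (enorm_intervalIntegral_sub_le hσ.2 (hi E hEi _ _)
          (hi E' hEi' _ _)) _)) _
      refine (setLIntegral_mono' measurableSet_Ioc h3).trans ?_
      rw [lintegral_const_mul' _ _ maxwellianMoment_ne_top]
      exact mul_le_mul_right
        (lintegral_exp_mul_setLIntegral_le s t (d := fun r => ‖E r - E' r‖ₑ)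
          (hE.sub hE').enorm) _
  | FP =>
    simp only [solution_FP_maxwellian hst]
    refine (lintegral_maxwellian_sub_le _ _).trans ?_
    have hc : Continuous fun r : ℝ => Real.exp (-(t - r)) := by fun_prop
    have h1 := enorm_intervalIntegral_sub_le hst ((hi E hEi s t).continuousOn_smul hc.continuousOn)
      ((hi E' hEi' s t).continuousOn_smul hc.continuousOn)
    simp only [← smul_sub, enorm_smul, Real.enorm_of_nonneg (Real.exp_pos _).le] at h1
    rw [mul_assoc, two_mul]
    exact (mul_le_mul_right h1 _).trans le_self_add

theorem integrableOn_exp_smul {E : ℝ → Vel N} (hE : Measurable E) {K t : ℝ}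
    (hK : ∀ r ≤ t, ‖E r‖ ≤ K) {u : ℝ} (hut : u ≤ t) (s : ℝ) :
    IntegrableOn (fun r => Real.exp (-(s - r)) • E r) (Iic u) := by
  refine (integrableOn_exp_neg_sub_Iic s u).smul_bdd K hE.aestronglyMeasurable ?_
  exact (ae_restrict_iff' measurableSet_Iic).2 (Eventually.of_forall fun r hr => hK r (hr.trans hut))

theorem integral_Iic_eq_add {G : Type*} [NormedAddCommGroup G] [NormedSpace ℝ G] {g : ℝ → G}
    {s t : ℝ} (hst : s ≤ t) (hg : IntegrableOn g (Iic t)) :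
    ∫ r in Iic t, g r = (∫ r in Iic s, g r) + ∫ r in s..t, g r := by
  rw [← intervalIntegral.integral_Iic_sub_Iic (hg.mono_set (Iic_subset_Iic.2 hst)) hg]
  abel

/-- The solution started from the Maxwellian in the remote past is close to the invariant
solution. -/
theorem lintegral_solution_sub_invariantSolution_le (Q : Collision) {E : ℝ → Vel N}
    (hE : Measurable E) {K : ℝ} {s t : ℝ} (hst : s ≤ t) (hK : ∀ r ≤ t, ‖E r‖ ≤ K) :
    ∫⁻ v, ‖solution Q maxwellian E s t v - invariantSolution Q E t v‖ₑ ≤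
      (2 + maxwellianMoment N * ENNReal.ofReal K) * ENNReal.ofReal (Real.exp (-(t - s))) := by
  cases Q with
  | LB =>
    have hd := measurable_drift hE t
    have h (v : Vel N) : solution .LB maxwellian E s t v - invariantSolution .LB E t v =
        Real.exp (-(t - s)) * maxwellian (v - ∫ r in s..t, E r) -
        ∫ σ in Iic s, Real.exp (-(t - σ)) * maxwellian (v - ∫ r in σ..t, E r) := by
      simp only [solution, invariantSolution, density_maxwellian, one_mul]
      rw [integral_Iic_eq_add hst (integrableOn_exp_mul_maxwellian hd t t v)]
      ring
    simp only [h]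
    refine (lintegral_mono fun v => enorm_sub_le).trans ?_
    have hm : Measurable fun v : Vel N => Real.exp (-(t - s)) * maxwellian (v - ∫ r in s..t, E r) :=
      (measurable_maxwellian.comp (measurable_id.sub_const _)).const_mul _
    rw [lintegral_add_left hm.enorm,
      lintegral_exp_mul_maxwellian (fun s => ∫ r in s..t, E r) t s, add_mul, two_mul]
    -- The transported Maxwellian and the part of the source emitted before `s` each have mass
    -- `e^{-(t-s)}`: this is the `2` in the constant.
    refine le_trans (add_le_add le_rfl ?_) le_self_add
    refine (lintegral_setIntegral_exp_mul_maxwellian_le hd t (Iic s)).trans ?_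
    rw [lintegral_exp_neg_sub_Iic]
  | FP =>
    simp only [solution_FP_maxwellian hst, invariantSolution]
    refine (lintegral_maxwellian_sub_le _ _).trans ?_
    -- The two shifts differ by the weighted integral of the force before `s`, at most `K
    -- e^{-(t-s)}`.
    rw [integral_Iic_eq_add hst (integrableOn_exp_smul hE hK le_rfl t), add_mul, mul_assoc]
    refine le_trans (mul_le_mul_right ?_ _) le_add_self
    rw [sub_add_cancel_right, enorm_neg]
    refine (enorm_integral_le_lintegral_enorm _).trans ?_
    rw [← lintegral_exp_neg_sub_Iic t s, ← lintegral_const_mul' _ _ (by simp)]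
    refine setLIntegral_mono' measurableSet_Iic fun r hr => ?_
    rw [enorm_smul, Real.enorm_of_nonneg (Real.exp_pos _).le, mul_comm, ← ofReal_norm]
    gcongr
    exact hK r (le_trans hr hst)

theorem density_invariantSolution (Q : Collision) {E : ℝ → Vel N} (hE : Measurable E) (t : ℝ) :
    density (invariantSolution Q E t) = 1 := by
  cases Q with
  | LB =>
    have hd := measurable_drift hE t
    have hi : Integrable (Function.uncurry fun (v : Vel N) (σ : ℝ) =>
        Real.exp (-(t - σ)) * maxwellian (v - ∫ r in σ..t, E r))
        (volume.prod (volume.restrict (Iic t))) := by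
      have hm := measurable_exp_mul_maxwellian hd t
      refine Integrable.swap (f := Function.uncurry fun (σ : ℝ) (v : Vel N) =>
        Real.exp (-(t - σ)) * maxwellian (v - ∫ r in σ..t, E r)) ⟨hm.aestronglyMeasurable, ?_⟩
      rw [HasFiniteIntegral, lintegral_prod _ hm.enorm.aemeasurable]
      simp only [Function.uncurry,
        lintegral_exp_mul_maxwellian (fun σ => ∫ r in σ..t, E r) t, lintegral_exp_neg_sub_Iic]
      exact ENNReal.ofReal_lt_top
    simp only [density, invariantSolution]
    rw [integral_integral_swap hi]
    simp only [integral_const_mul, integral_sub_right_eq_self (fun v : Vel N => maxwellian v),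
      integral_maxwellian, mul_one]
    have : ∀ σ, Real.exp (-(t - σ)) = Real.exp (-t) * Real.exp σ := fun σ => by
      rw [← Real.exp_add]; congr 1; ring
    simp only [this, integral_const_mul, integral_exp_Iic]
    rw [← Real.exp_add]; simp
  | FP =>
    simp only [density, invariantSolution]
    rw [integral_sub_right_eq_self (fun v : Vel N => maxwellian v), integral_maxwellian]

/-- The invariant solutions are solutions. -/
theorem solution_invariantSolution (Q : Collision) {E : ℝ → Vel N} (hE : Measurable E)
    (hEi : LocallyIntegrable E) {K : ℝ} {s t : ℝ} (hst : s ≤ t) (hK : ∀ r ≤ t, ‖E r‖ ≤ K)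
    (v : Vel N) :
    solution Q (invariantSolution Q E s) E s t v = invariantSolution Q E t v := by
  cases Q with
  | LB =>
    have hd := measurable_drift hE t
    rw [solution, density_invariantSolution .LB hE, one_mul]
    simp only [invariantSolution]
    -- The source emitted before `s` is the transport of `Mbar_s` damped by `e^{-(t-s)}`, because
    -- drifts over adjacent intervals add up; the rest is the source on `[s, t]`.
    rw [integral_Iic_eq_add hst (integrableOn_exp_mul_maxwellian hd t t v), ← integral_const_mul]
    congr 1
    refine setIntegral_congr_fun measurableSet_Iic fun σ _ => ?_
    simp only [← mul_assoc, ← Real.exp_add]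
    congr 2
    · ring
    · rw [sub_sub, add_comm (∫ r in s..t, E r), intervalIntegral.integral_add_adjacent_intervals
        (hEi.integrableOn_isCompact isCompact_uIcc).intervalIntegrable
        (hEi.integrableOn_isCompact isCompact_uIcc).intervalIntegrable]
  | FP =>
    rw [solution_FP]
    have h : invariantSolution .FP E s =
        fun v => maxwellian (v - ∫ r in Iic s, Real.exp (-(s - r)) • E r) := rfl
    -- The semigroup contracts the old centre by `e^{-(t-s)}`, which turns the weight `e^{-(s-r)}`
    -- into `e^{-(t-r)}`.
    rw [h, invariantSolution, ouSemigroup_maxwellian_sub (by linarith), integral_Iic_eq_add hst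
      (integrableOn_exp_smul hE hK le_rfl t), sub_sub, ← integral_smul]
    congr 2
    rw [add_comm]
    congr 1
    refine setIntegral_congr_fun measurableSet_Iic fun r _ => ?_
    simp only [smul_smul, ← Real.exp_add]
    congr 2; ring

end Estimates
-- The Markov property on the path space
section Markov

variable {ι S Ω : Type*} [MeasurableSpace S]

/-- The `σ`-algebra generated by a process up to time `s`. -/
abbrev pastAlgebra [Preorder ι] (X : ι → Ω → S) (s : ι) : MeasurableSpace Ω :=
  ⨆ r, ⨆ _ : r ≤ s, MeasurableSpace.comap (X r) inferInstance

theorem measurable_pastAlgebra [Preorder ι] (X : ι → Ω → S) {r s : ι} (hrs : r ≤ s) :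
    Measurable[pastAlgebra X s] (X r) :=
  measurable_iff_comap_le.2 (le_iSup₂_of_le r hrs le_rfl)

theorem pastAlgebra_mono [Preorder ι] (X : ι → Ω → S) {s t : ι} (hst : s ≤ t) :
    pastAlgebra X s ≤ pastAlgebra X t :=
  iSup_le fun r => iSup_le fun hr => le_iSup₂_of_le r (hr.trans hst) le_rfl

variable [MeasurableSpace Ω]

theorem pastAlgebra_le [Preorder ι] {X : ι → Ω → S} (hX : ∀ t, Measurable (X t)) (s : ι) :
    pastAlgebra X s ≤ ‹MeasurableSpace Ω› :=
  iSup_le fun r => iSup_le fun _ => (hX r).comap_le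

/-- The conditional expectation integrated over a past event: the form that can be iterated over
finitely many times. -/
theorem IsMarkovProcess.measure_inter [Preorder ι] [PseudoMetricSpace ι]
    {P : ℝ≥0 → Kernel S S} [∀ t, IsMarkovKernel (P t)] {μ : Measure Ω} [IsFiniteMeasure μ]
    {X : ι → Ω → S} (hX : IsMarkovProcess P μ X) (hm : ∀ t, Measurable (X t)) {s t : ι}
    (hst : s ≤ t) {A : Set Ω} (hA : MeasurableSet[pastAlgebra X s] A) {B : Set S}
    (hB : MeasurableSet B) :
    μ (A ∩ X t ⁻¹' B) = ∫⁻ ω in A, P (nndist s t) (X s ω) B ∂μ := by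
  have hle := pastAlgebra_le hm s
  have hA' := hle A hA
  have hi : Integrable ((X t ⁻¹' B).indicator fun _ : Ω => (1 : ℝ)) μ :=
    (integrable_const 1).indicator (hm t hB)
  have h1 := setIntegral_condExp hle hi hA
  have h2 : ∫ ω in A, (μ[(X t ⁻¹' B).indicator fun _ : Ω => (1 : ℝ) | pastAlgebra X s]) ω ∂μ =
      ∫ ω in A, (P (nndist s t) (X s ω)).real B ∂μ :=
    integral_congr_ae (ae_restrict_of_ae (hX s t hst B hB))
  rw [h2, integral_indicator_const (1 : ℝ) (hm t hB), smul_eq_mul, mul_one] at h1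
  have hmB : Measurable fun ω => P (nndist s t) (X s ω) B :=
    ((P (nndist s t)).measurable_coe hB).comp (hm s)
  rw [integral_eq_lintegral_of_nonneg_ae (Eventually.of_forall fun _ => measureReal_nonneg)
    hmB.ennreal_toReal.aestronglyMeasurable] at h1
  have h3 : ∀ ω, ENNReal.ofReal ((P (nndist s t) (X s ω)).real B) = P (nndist s t) (X s ω) B :=
    fun ω => ofReal_measureReal
  simp only [h3] at h1
  rw [measureReal_def, Measure.restrict_apply (hm t hB), inter_comm] at h1
  refine ((ENNReal.toReal_eq_toReal_iff' ?_ (measure_ne_top _ _)).1 h1).symm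
  have h4 : ∫⁻ ω in A, P (nndist s t) (X s ω) B ∂μ ≤ μ A :=
    (lintegral_mono fun ω => prob_le_one).trans (by simp)
  exact (h4.trans_lt (measure_lt_top _ _)).ne

variable [TopologicalSpace S]

theorem measurable_eval (t : ℝ≥0) : Measurable fun ω : CadlagPath S => ω.1 t :=
  (measurable_pi_apply t).comp measurable_subtype_coe

instance (law : Kernel S (CadlagPath S)) [IsMarkovKernel law] (t : ℝ≥0) :
    IsMarkovKernel (transition law t) :=
  Kernel.IsMarkovKernel.map _ (measurable_eval t)

/-- The path `(X_{s+τ})_{τ ≥ 0}`. -/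
def pathFrom {X : ℝ → Ω → S} (hX : ∀ ω, IsCadlag fun t => X t ω) (s : ℝ) (ω : Ω) : CadlagPath S :=
  ⟨fun τ => X (s + τ) ω, (hX ω).shift s⟩

theorem measurable_pathFrom {X : ℝ → Ω → S} (hX : ∀ ω, IsCadlag fun t => X t ω)
    (hm : ∀ t, Measurable (X t)) (s : ℝ) : Measurable (pathFrom hX s) := by
  have h : Measurable fun ω (τ : ℝ≥0) => X (s + τ) ω := measurable_pi_lambda _ fun τ => hm (s + τ)
  exact h.subtype_mk

/-- The `σ`-algebra generated by finitely many coordinates on the path space. -/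
abbrev coordAlgebra (S : Type*) [TopologicalSpace S] [MeasurableSpace S] (J : Finset ℝ≥0) :
    MeasurableSpace (CadlagPath S) :=
  ⨆ r ∈ J, MeasurableSpace.comap (fun ω : CadlagPath S => ω.1 r) inferInstance

theorem coordAlgebra_le (J : Finset ℝ≥0) :
    coordAlgebra S J ≤ (inferInstance : MeasurableSpace (CadlagPath S)) :=
  iSup₂_le fun r _ => (measurable_eval r).comap_le

theorem coordAlgebra_mono {J J' : Finset ℝ≥0} (h : J ⊆ J') :
    coordAlgebra S J ≤ coordAlgebra S J' :=
  iSup₂_le fun r hr => le_iSup₂_of_le r (h hr) le_rfl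

theorem measurable_coordAlgebra {J : Finset ℝ≥0} {r : ℝ≥0} (hr : r ∈ J) :
    Measurable[coordAlgebra S J] fun ω : CadlagPath S => ω.1 r :=
  measurable_iff_comap_le.2 (le_iSup₂_of_le r hr le_rfl)

theorem coordAlgebra_insert (t : ℝ≥0) (J : Finset ℝ≥0) :
    coordAlgebra S (insert t J) =
      MeasurableSpace.comap (fun ω : CadlagPath S => ω.1 t) inferInstance ⊔ coordAlgebra S J := by
  exact Finset.iSup_insert _ _ _

theorem isPiSystem_inter {α : Type*} (m₁ m₂ : MeasurableSpace α) :
    IsPiSystem {s | ∃ B C, MeasurableSet[m₁] B ∧ MeasurableSet[m₂] C ∧ s = B ∩ C} := by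
  rintro _ ⟨B, C, hB, hC, rfl⟩ _ ⟨B', C', hB', hC', rfl⟩ _
  exact ⟨B ∩ B', C ∩ C', hB.inter hB', hC.inter hC', inter_inter_inter_comm _ _ _ _⟩

theorem generateFrom_inter {α : Type*} (m₁ m₂ : MeasurableSpace α) :
    m₁ ⊔ m₂ = MeasurableSpace.generateFrom
      {s | ∃ B C, MeasurableSet[m₁] B ∧ MeasurableSet[m₂] C ∧ s = B ∩ C} := by
  refine le_antisymm (sup_le (fun B hB => ?_) fun C hC => ?_)
    (MeasurableSpace.generateFrom_le ?_)
  · exact MeasurableSpace.measurableSet_generateFrom ⟨B, univ, hB, .univ, (inter_univ B).symm⟩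
  · exact MeasurableSpace.measurableSet_generateFrom ⟨univ, C, .univ, hC, (univ_inter C).symm⟩
  · rintro _ ⟨B, C, hB, hC, rfl⟩
    exact MeasurableSet.inter ((le_sup_left : m₁ ≤ m₁ ⊔ m₂) B hB)
      ((le_sup_right : m₂ ≤ m₁ ⊔ m₂) C hC)

/-- Serves to integrate a transition probability when two path laws are only known to agree on the
coordinates treated so far. -/
theorem setLIntegral_eq_of_trim_eq {α : Type*} {m m0 : MeasurableSpace α} (hm : m ≤ m0)
    {μ ν : Measure[m0] α} (h : ∀ B, MeasurableSet[m] B → μ B = ν B) {g : α → ℝ≥0∞}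
    (hg : Measurable[m] g) {B : Set α} (hB : MeasurableSet[m] B) :
    ∫⁻ x in B, g x ∂μ = ∫⁻ x in B, g x ∂ν := by
  have ht : μ.trim hm = ν.trim hm := by
    refine @Measure.ext α m _ _ fun s hs => ?_
    rw [trim_measurableSet_eq hm hs, trim_measurableSet_eq hm hs, h s hs]
  rw [← lintegral_indicator (hm B hB), ← lintegral_indicator (hm B hB),
    ← lintegral_trim hm (hg.indicator hB), ← lintegral_trim hm (hg.indicator hB), ht]

variable {law : Kernel S (CadlagPath S)} [IsMarkovKernel law] {Pr : Measure Ω}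
  [IsProbabilityMeasure Pr] {X : ℝ → Ω → S}

/-- Finite-dimensional laws are compared by adding times in increasing order. Under both measures
the coordinate at a new time is drawn, given the earlier ones, from the same transition function at
the latest earlier time. Time `0` is always included so that such a time exists. -/
theorem map_pathFrom_coordAlgebra (hlaw : IsMarkovFamily law) (hX : IsStationaryMarkov law Pr X)
    (s : ℝ) {A : Set Ω} (hA : MeasurableSet[pastAlgebra X s] A) (J : Finset ℝ≥0) :
    ∀ B, MeasurableSet[coordAlgebra S (insert 0 J)] B →
      (Pr.restrict A).map (pathFrom hX.cadlag s) B =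
        (Pr.restrict A).bind (fun ω => law (X s ω)) B := by
  have hsm := measurable_pathFrom hX.cadlag hX.measurable s
  have hA0 : MeasurableSet A := pastAlgebra_le hX.measurable s A hA
  have hlm : Measurable fun ω => law (X s ω) := law.measurable.comp (hX.measurable s)
  have hm1 {B : Set (CadlagPath S)} (hB : MeasurableSet B) :
      (Pr.restrict A).map (pathFrom hX.cadlag s) B = Pr (A ∩ pathFrom hX.cadlag s ⁻¹' B) := by
    rw [Measure.map_apply hsm hB, Measure.restrict_apply (hsm hB), inter_comm]
  have hm2 {B : Set (CadlagPath S)} (hB : MeasurableSet B) :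
      (Pr.restrict A).bind (fun ω => law (X s ω)) B = ∫⁻ ω in A, law (X s ω) B ∂Pr :=
    Measure.bind_apply hB hlm.aemeasurable
  induction J using Finset.induction_on_max with
  | empty =>
    rintro B hB
    have hB' := coordAlgebra_le _ B hB
    obtain ⟨D, hD, rfl⟩ : ∃ D : Set S, MeasurableSet D ∧ (fun ω : CadlagPath S => ω.1 0) ⁻¹' D = B := by
      have h : coordAlgebra S (insert 0 ∅) =
          MeasurableSpace.comap (fun ω : CadlagPath S => ω.1 0) inferInstance := by
        simp [coordAlgebra]
      rw [h] at hB
      exact hB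
    rw [hm1 hB', hm2 hB']
    have h1 : ∀ ω, law (X s ω) ((fun ω : CadlagPath S => ω.1 0) ⁻¹' D) =
        (X s ⁻¹' D).indicator 1 ω := by
      intro ω
      have hst := hlaw.start (X s ω)
      by_cases h : X s ω ∈ D
      · rw [indicator_of_mem (by exact h), Pi.one_apply, ← mem_ae_iff_prob_eq_one hB']
        filter_upwards [hst] with ξ hξ
        simpa [hξ] using h
      · rw [indicator_of_notMem (by exact h)]
        refine measure_eq_zero_iff_ae_notMem.2 ?_
        filter_upwards [hst] with ξ hξ
        simpa [hξ] using h
    simp only [h1]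
    rw [lintegral_indicator_one (hX.measurable s hD), Measure.restrict_apply (hX.measurable s hD),
      inter_comm]
    simp [pathFrom, preimage]
  | insert t J hJ ih =>
    -- As `t` exceeds all of `J`, this happens only for `t = 0`, and then nothing is added.
    by_cases ht : t ∈ insert 0 J
    · rwa [Finset.insert_comm, Finset.insert_eq_of_mem ht]
    obtain ⟨u, hu, hut, hmax⟩ : ∃ u ∈ insert 0 J, u ≤ t ∧ ∀ r ∈ insert 0 J, r ≤ u := by
      refine ⟨(insert 0 J).max' (Finset.insert_nonempty _ _), Finset.max'_mem _ _, ?_,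
        fun r hr => Finset.le_max' _ r hr⟩
      refine Finset.max'_le _ _ _ fun r hr => ?_
      rcases Finset.mem_insert.1 hr with rfl | hr
      · exact zero_le
      · exact (hJ r hr).le
    have hle := coordAlgebra_le (S := S) (insert 0 J)
    have hle' := coordAlgebra_le (S := S) (insert 0 (insert t J))
    have hg : Measurable[coordAlgebra S (insert 0 J)] fun ω : CadlagPath S => ω.1 u :=
      measurable_coordAlgebra hu
    -- the two measures agree on the generating `π`-system
    have key : ∀ B D, MeasurableSet[coordAlgebra S (insert 0 J)] B → MeasurableSet D →
        (Pr.restrict A).map (pathFrom hX.cadlag s) (B ∩ (fun ω : CadlagPath S => ω.1 t) ⁻¹' D) =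
        (Pr.restrict A).bind (fun ω => law (X s ω))
          (B ∩ (fun ω : CadlagPath S => ω.1 t) ⁻¹' D) := by
      intro B D hB hD
      have hB0 := hle B hB
      have hC0 : MeasurableSet ((fun ω : CadlagPath S => ω.1 t) ⁻¹' D) := measurable_eval t hD
      have hP : Measurable fun y => transition law (nndist u t) y D := Kernel.measurable_coe _ hD
      have hPu : Measurable fun ω : CadlagPath S => transition law (nndist u t) (ω.1 u) D :=
        hP.comp (measurable_eval u)
      -- All the coordinates in `B` are observed by time `s + u`, so the event may be used in the
      -- Markov property at that time.
      have hpast : MeasurableSet[pastAlgebra X (s + u)] (A ∩ pathFrom hX.cadlag s ⁻¹' B) := by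
        refine MeasurableSet.inter (pastAlgebra_mono X (by simp) A hA) ?_
        have : @Measurable _ _ (pastAlgebra X (s + u)) (coordAlgebra S (insert 0 J))
            (pathFrom hX.cadlag s) := by
          rw [measurable_iff_comap_le]
          simp only [MeasurableSpace.comap_iSup, MeasurableSpace.comap_comp]
          refine iSup₂_le fun r hr => ?_
          exact (measurable_pastAlgebra X (s := s + u) (r := s + r)
            (by have : (r : ℝ) ≤ u := mod_cast hmax r hr
                linarith)).comap_le
        exact this hB
      have hnn : nndist (s + u : ℝ) (s + t) = nndist u t := by
        ext; simp [Real.dist_eq, NNReal.dist_eq]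
      have hmk := hX.markov.measure_inter hX.measurable (s := s + u) (t := s + t)
        (by have : (u : ℝ) ≤ t := mod_cast hut
            linarith) hpast hD
      rw [hnn] at hmk
      have e1 : (Pr.restrict A).map (pathFrom hX.cadlag s)
          (B ∩ (fun ω : CadlagPath S => ω.1 t) ⁻¹' D) =
          ∫⁻ ω in B, transition law (nndist u t) (ω.1 u) D
            ∂((Pr.restrict A).map (pathFrom hX.cadlag s)) := by
        rw [hm1 (hB0.inter hC0), preimage_inter, ← inter_assoc,
          setLIntegral_map hB0 hPu hsm, Measure.restrict_restrict (hsm hB0), inter_comm _ A]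
        exact hmk
      have e2 : (Pr.restrict A).bind (fun ω => law (X s ω))
          (B ∩ (fun ω : CadlagPath S => ω.1 t) ⁻¹' D) =
          ∫⁻ ω in B, transition law (nndist u t) (ω.1 u) D
            ∂((Pr.restrict A).bind fun ω => law (X s ω)) := by
        rw [hm2 (hB0.inter hC0), ← lintegral_indicator hB0,
          Measure.lintegral_bind hlm.aemeasurable (hPu.indicator hB0).aemeasurable]
        refine lintegral_congr fun ω => ?_
        rw [lintegral_indicator hB0]
        refine (hlaw.markov (X s ω)).measure_inter measurable_eval hut ?_ hD
        have : coordAlgebra S (insert 0 J) ≤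
            pastAlgebra (fun (t : ℝ≥0) (ω : CadlagPath S) => ω.1 t) u :=
          iSup₂_le fun r hr => le_iSup₂_of_le r (hmax r hr) le_rfl
        exact this B hB
      rw [e1, e2]
      exact setLIntegral_eq_of_trim_eq hle ih (hP.comp hg) hB
    intro B hB
    have huniv : (Pr.restrict A).map (pathFrom hX.cadlag s) univ =
        (Pr.restrict A).bind (fun ω => law (X s ω)) univ := ih univ .univ
    have hfin : IsFiniteMeasure ((Pr.restrict A).map (pathFrom hX.cadlag s)) := inferInstance
    have hgen : coordAlgebra S (insert 0 (insert t J)) = MeasurableSpace.generateFrom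
        {s | ∃ B C, MeasurableSet[coordAlgebra S (insert 0 J)] B ∧
          MeasurableSet[MeasurableSpace.comap (fun ω : CadlagPath S => ω.1 t) inferInstance] C ∧
          s = B ∩ C} := by
      rw [Finset.insert_comm, coordAlgebra_insert, sup_comm, generateFrom_inter]
    have htrim := ext_of_generate_finite (m0 := coordAlgebra S (insert 0 (insert t J)))
      (μ := ((Pr.restrict A).map (pathFrom hX.cadlag s)).trim hle')
      (ν := ((Pr.restrict A).bind (fun ω => law (X s ω))).trim hle') _ hgen
      (isPiSystem_inter _ _) ?_ ?_
    · rw [← trim_measurableSet_eq hle' hB, htrim, trim_measurableSet_eq hle' hB]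
    · rintro E hE
      have hEm : MeasurableSet[coordAlgebra S (insert 0 (insert t J))] E := by
        rw [hgen]; exact MeasurableSpace.measurableSet_generateFrom hE
      obtain ⟨B, C, hB, ⟨D, hD, rfl⟩, rfl⟩ := hE
      rw [trim_measurableSet_eq hle' hEm, trim_measurableSet_eq hle' hEm]
      exact key B D hB hD
    · rw [trim_measurableSet_eq hle' .univ, trim_measurableSet_eq hle' .univ]
      exact huniv

/-- The Markov property on the path space: conditionally on the past at time `s`, the path
`(X_{s+τ})_{τ ≥ 0}` has law `ℙ_{X_s}`. -/
theorem map_pathFrom_restrict (hlaw : IsMarkovFamily law) (hX : IsStationaryMarkov law Pr X)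
    (s : ℝ) {A : Set Ω} (hA : MeasurableSet[pastAlgebra X s] A) :
    (Pr.restrict A).map (pathFrom hX.cadlag s) = (Pr.restrict A).bind fun ω => law (X s ω) := by
  have key := map_pathFrom_coordAlgebra hlaw hX s hA
  -- Cylinder events form a `π`-system, stable under intersection by taking the union of the time
  -- sets.
  refine ext_of_generate_finite {B | ∃ J, MeasurableSet[coordAlgebra S (insert 0 J)] B} ?_ ?_ ?_ ?_
  · refine le_antisymm ?_ (MeasurableSpace.generateFrom_le ?_)
    · have : (Subtype.instMeasurableSpace : MeasurableSpace (CadlagPath S)) =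
          ⨆ r, MeasurableSpace.comap (fun ω : CadlagPath S => ω.1 r) inferInstance := by
        change MeasurableSpace.comap Subtype.val MeasurableSpace.pi = _
        simp only [MeasurableSpace.pi, MeasurableSpace.comap_iSup, MeasurableSpace.comap_comp]
        rfl
      rw [this]
      refine iSup_le fun r B hB => MeasurableSpace.measurableSet_generateFrom ⟨{r}, ?_⟩
      exact (measurable_coordAlgebra (by simp)).comap_le B hB
    · rintro B ⟨J, hJ⟩; exact coordAlgebra_le _ B hJ
  · rintro B ⟨J, hJ⟩ B' ⟨J', hJ'⟩ _
    refine ⟨J ∪ J', MeasurableSet.inter (coordAlgebra_mono ?_ B hJ) (coordAlgebra_mono ?_ B' hJ')⟩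
    · exact Finset.insert_subset_insert _ Finset.subset_union_left
    · exact Finset.insert_subset_insert _ Finset.subset_union_right
  · rintro B ⟨J, hJ⟩; exact key J B hJ
  · exact key ∅ univ .univ

theorem map_pathFrom (hlaw : IsMarkovFamily law) (hX : IsStationaryMarkov law Pr X) (s : ℝ) :
    Pr.map (pathFrom hX.cadlag s) = (Pr.map (X 0)).bind law := by
  have h := map_pathFrom_restrict hlaw hX s MeasurableSet.univ
  rw [Measure.restrict_univ] at h
  rw [h, ← hX.stationary s]
  ext B hB
  have hlm : Measurable fun ω => law (X s ω) := law.measurable.comp (hX.measurable s)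
  rw [Measure.bind_apply hB hlm.aemeasurable, Measure.bind_apply hB law.measurable.aemeasurable,
    lintegral_map (Kernel.measurable_coe _ hB) (hX.measurable s)]

end Markov
-- The pair of solution and force as a function of the path
section StatePair

variable {N m : ℕ} {Ω : Type*}

theorem solution_shift (Q : Collision) (f : Vel N → ℝ) (E : ℝ → Vel N) (s t : ℝ) :
    solution Q f (fun r => E (r - s)) s t = solution Q f E 0 (t - s) := by
  funext v
  have h1 (σ : ℝ) : ∫ r in σ..t, E (r - s) = ∫ r in (σ - s)..(t - s), E r :=
    intervalIntegral.integral_comp_sub_right E s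
  cases Q with
  | LB =>
    have h2 := intervalIntegral.integral_comp_sub_right (a := s) (b := t)
      (fun σ => Real.exp (-((t - s) - σ)) * maxwellian (v - ∫ r in σ..(t - s), E r)) s
    simp only [sub_sub_sub_cancel_right, sub_self] at h2
    simp only [solution, h1, h2, sub_self, sub_zero]
  | FP =>
    have h2 := intervalIntegral.integral_comp_sub_right (a := s) (b := t)
      (fun σ => Real.exp (-(0 - σ)) • E σ) s
    simp only [sub_self, zero_sub, neg_sub, neg_neg] at h2
    simp only [solution, neg_sub, h2, zero_sub, neg_neg, sub_zero]

theorem solution_congr (Q : Collision) (f : Vel N → ℝ) {E E' : ℝ → Vel N} {s t : ℝ} (hst : s ≤ t)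
    (h : ∀ r ∈ Icc s t, E r = E' r) : solution Q f E s t = solution Q f E' s t := by
  funext v
  have h1 : ∀ σ ∈ Icc s t, ∫ r in σ..t, E r = ∫ r in σ..t, E' r := fun σ hσ =>
    intervalIntegral.integral_congr fun r hr => by
      rw [uIcc_of_le hσ.2] at hr
      exact h r ⟨hσ.1.trans hr.1, hr.2⟩
  cases Q with
  | LB =>
    simp only [solution]
    rw [h1 s (left_mem_Icc.2 hst)]
    congr 2
    refine intervalIntegral.integral_congr fun σ hσ => ?_
    rw [uIcc_of_le hst] at hσ
    simp only [h1 σ hσ]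
  | FP =>
    simp only [solution]
    have h2 : ∫ σ in s..t, Real.exp (-(s - σ)) • E σ = ∫ σ in s..t, Real.exp (-(s - σ)) • E' σ :=
      intervalIntegral.integral_congr fun r hr => by
        rw [uIcc_of_le hst] at hr
        simp only [h r hr]
    rw [h2]

/-- Only the past of the force enters; this is what makes the limit adapted. -/
theorem invariantSolution_congr (Q : Collision) {E E' : ℝ → Vel N} {t : ℝ}
    (h : ∀ r ≤ t, E r = E' r) : invariantSolution Q E t = invariantSolution Q E' t := by
  funext v
  cases Q with
  | LB =>
    refine setIntegral_congr_fun measurableSet_Iic fun σ hσ => ?_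
    have : ∫ r in σ..t, E r = ∫ r in σ..t, E' r :=
      intervalIntegral.integral_congr fun r hr => by
        rw [uIcc_of_le hσ] at hr
        exact h r hr.2
    simp only [this]
  | FP =>
    simp only [invariantSolution]
    congr 2
    refine setIntegral_congr_fun measurableSet_Iic fun σ hσ => ?_
    simp only [h σ hσ]

variable {x : Torus N}

theorem isCadlag_force (hx : Continuous (forceAt (m := m) x)) (s : ℝ)
    (ω : CadlagPath (ForceSpace N m)) : IsCadlag fun r => forceAt x (forceFrom s ω r) :=
  (ω.2.delay s).continuous_comp hx

theorem measurable_uncurry_force (hx : Continuous (forceAt (m := m) x)) (s : ℝ) :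
    Measurable (Function.uncurry fun (ω : CadlagPath (ForceSpace N m)) r =>
      forceAt x (forceFrom s ω r)) :=
  measurable_uncurry_of_rightContinuous (fun _ => hx.measurable.comp (measurable_eval _))
    fun ω t => (isCadlag_force hx s ω t).1

/-- The pair formed by the solution started from the Maxwellian, multiplied by `ρ`, and the force
field. -/
def maxwellPair (Q : Collision) (x : Torus N) (ρ s t : ℝ) (ω : CadlagPath (ForceSpace N m)) :
    L1 N × ForceSpace N m :=
  (ρ • toL1 (solution Q maxwellian (fun r => forceAt x (forceFrom s ω r)) s t), forceFrom s ω t)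

theorem force_shift (x : Torus N) (s : ℝ) (ω : CadlagPath (ForceSpace N m)) :
    (fun r => forceAt x (forceFrom s ω r)) =
      fun r => forceAt x (forceFrom 0 ω (r - s)) := by
  funext r; simp [forceFrom]

theorem statePair_shift (Q : Collision) (x : Torus N) (f : L1 N) (s t : ℝ) :
    statePair (m := m) Q x f s t = statePair Q x f 0 (t - s) := by
  funext ω
  simp only [statePair]
  rw [force_shift, solution_shift _ _ fun r => forceAt x (forceFrom 0 ω r)]
  simp [forceFrom]

theorem maxwellPair_shift (Q : Collision) (x : Torus N) (ρ s t : ℝ) :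
    maxwellPair (m := m) Q x ρ s t = maxwellPair Q x ρ 0 (t - s) := by
  funext ω
  simp only [maxwellPair]
  rw [force_shift, solution_shift _ _ fun r => forceAt x (forceFrom 0 ω r)]
  simp [forceFrom]

theorem integrable_solution_force (hx : Continuous (forceAt (m := m) x)) (Q : Collision)
    (f : L1 N) (s t : ℝ) (ω : CadlagPath (ForceSpace N m)) :
    Integrable (solution Q f (fun r => forceAt x (forceFrom s ω r)) s t) :=
  integrable_solution (isCadlag_force hx s ω).measurable Q (measurable_coeFn f)
    (L1.integrable_coeFn f) s t

theorem measurable_statePair (hx : Continuous (forceAt (m := m) x)) (Q : Collision)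
    (f : L1 N) (s t : ℝ) : Measurable (statePair (m := m) Q x f s t) :=
  (measurable_toL1 (measurable_solution (measurable_uncurry_force hx s) Q (measurable_coeFn f) s t)
    fun ω => integrable_solution_force hx Q f s t ω).prodMk (measurable_eval _)

theorem measurable_maxwellPair (hx : Continuous (forceAt (m := m) x)) (Q : Collision)
    (ρ s t : ℝ) : Measurable (maxwellPair (m := m) Q x ρ s t) :=
  ((measurable_toL1 (measurable_solution (measurable_uncurry_force hx s) Q measurable_maxwellian
    s t) fun ω => integrable_solution (isCadlag_force hx s ω).measurable Q measurable_maxwellian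
      integrable_maxwellian s t).const_smul ρ).prodMk (measurable_eval _)

/-- A Carathéodory argument: Lipschitz in the datum for each path, measurable in the path for each
datum, on a separable space. -/
theorem measurable_uncurry_statePair (hx : Continuous (forceAt (m := m) x)) (Q : Collision)
    (s t : ℝ) : Measurable fun p : L1 N × CadlagPath (ForceSpace N m) =>
      statePair Q x p.1 s t p.2 := by
  obtain ⟨C, hC, h⟩ := lintegral_solution_sub_le (N := N) s t
  have h1 : Measurable (Function.uncurry fun (f : L1 N) (ω : CadlagPath (ForceSpace N m)) =>
      toL1 (solution Q f (fun r => forceAt x (forceFrom s ω r)) s t)) := by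
    refine measurable_uncurry_of_continuous_of_measurable (fun ω => ?_)
      fun f => (measurable_statePair hx Q f s t).fst
    have hl : LipschitzWith C.toNNReal fun f : L1 N =>
        toL1 (solution Q f (fun r => forceAt x (forceFrom s ω r)) s t) := by
      intro f g
      rw [edist_toL1 (integrable_solution_force hx Q f s t ω)
        (integrable_solution_force hx Q g s t ω), ENNReal.coe_toNNReal hC]
      refine (h Q _ (isCadlag_force hx s ω).measurable f g (measurable_coeFn f)
        (L1.integrable_coeFn f) (measurable_coeFn g) (L1.integrable_coeFn g)).trans ?_
      rw [← edist_toL1 (L1.integrable_coeFn f) (L1.integrable_coeFn g), toL1_coeFn, toL1_coeFn]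
    exact hl.continuous
  exact h1.prodMk ((measurable_eval _).comp measurable_snd)

/-- Stopping the force at time `t` does not change the pair and leaves only variables of index `≤
t`. The statement thus also applies with the `σ`-algebra of the past on `Ω`. -/
theorem measurable_limitPair [MeasurableSpace Ω] (hx : Continuous (forceAt (m := m) x))
    (Q : Collision) (ρ t : ℝ) {X : ℝ → Ω → ForceSpace N m} (hX : ∀ ω, IsCadlag fun r => X r ω)
    (hm : ∀ r ≤ t, Measurable (X r)) : Measurable (limitPair Q x ρ X t) := by
  have h1 : Measurable (Function.uncurry fun (ω : Ω) (r : ℝ) => forceAt x (X (min r t) ω)) := by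
    refine measurable_uncurry_of_rightContinuous
      (fun r => hx.measurable.comp (hm _ (min_le_right r t))) fun ω r => ?_
    refine hx.continuousAt.comp_continuousWithinAt ?_
    refine (hX ω (min r t)).1.comp (f := fun r => min r t)
      (by fun_prop : Continuous fun r => min r t).continuousWithinAt fun r' hr' => ?_
    exact min_le_min_right t hr'
  have h2 : ∀ ω, invariantSolution Q (fun r => forceAt x (X r ω)) t =
      invariantSolution Q (fun r => forceAt x (X (min r t) ω)) t := fun ω =>
    invariantSolution_congr Q fun r hr => by rw [min_eq_left hr]
  unfold limitPair
  simp only [h2]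
  refine Measurable.prodMk (Measurable.const_smul (measurable_toL1
    (measurable_invariantSolution h1 Q t) fun ω => ?_) ρ) (hm t le_rfl)
  exact integrable_invariantSolution h1.of_uncurry_left Q t

/-- The distance of the solutions driven by two force fields, the second one being started from
the Maxwellian. -/
theorem edist_statePair_maxwellPair_le (hx : Continuous (forceAt (m := m) x)) (f : L1 N) :
    ∃ ε : ℝ → ℝ≥0∞, Tendsto ε atTop (𝓝 0) ∧ ∀ (Q : Collision) (T : ℝ), 0 < T →
      ∀ ω ω' : CadlagPath (ForceSpace N m),
      edist (statePair Q x f 0 T ω) (maxwellPair Q x (density f) 0 T ω') ≤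
        ε T + ‖density f‖ₑ * (2 * maxwellianMoment N *
          ∫⁻ r in Ioc 0 T, ENNReal.ofReal (Real.exp (-(T - r))) *
            ‖forceAt x (forceFrom 0 ω r) - forceAt x (forceFrom 0 ω' r)‖ₑ) +
        edist (forceFrom 0 ω T) (forceFrom 0 ω' T) := by
  obtain ⟨ε, hε, h⟩ := exists_relaxation (measurable_coeFn f) (L1.integrable_coeFn f)
  refine ⟨ε, hε, fun Q T hT ω ω' => ?_⟩
  have hc := isCadlag_force hx 0 ω
  have hc' := isCadlag_force hx 0 ω'
  have hi := integrable_solution hc.measurable Q measurable_maxwellian integrable_maxwellian 0 T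
  have hi' := integrable_solution hc'.measurable Q measurable_maxwellian integrable_maxwellian 0 T
  have h1 := h Q (fun r => forceAt x (forceFrom 0 ω r)) 0 T hT
  rw [sub_zero] at h1
  have h2 := lintegral_solution_maxwellian_sub_le Q hc.measurable hc'.measurable
    hc.locallyIntegrable hc'.locallyIntegrable hT.le
  rw [Prod.edist_eq]
  refine (max_le_add_of_nonneg zero_le zero_le).trans (add_le_add ?_ le_rfl)
  -- Triangle inequality through `ρ(f)` times the solution from the Maxwellian driven by the first
  -- force.
  refine le_trans ?_ (add_le_add h1 (mul_le_mul_right h2 _))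
  simp only [statePair, maxwellPair]
  rw [smul_toL1 hi', edist_toL1 (integrable_solution_force hx Q f 0 T ω) (hi'.const_mul _),
    ← lintegral_const_mul' _ _ (by simp)]
  have hm1 : Measurable fun v => ‖solution Q f (fun r => forceAt x (forceFrom 0 ω r)) 0 T v -
      density f * solution Q maxwellian (fun r => forceAt x (forceFrom 0 ω r)) 0 T v‖ₑ :=
    ((measurable_solution_right hc.measurable Q (measurable_coeFn f) 0 T).sub
      ((measurable_solution_right hc.measurable Q measurable_maxwellian 0 T).const_mul _)).enorm
  rw [← lintegral_add_left hm1]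
  refine lintegral_mono fun v => ?_
  rw [← enorm_mul]
  refine le_trans (le_of_eq ?_) (enorm_add_le _ _)
  congr 1; ring

end StatePair

/-! ### Consequences of mixing -/

section MixingForce

variable {N m : ℕ} {Ω : Type*} [MeasurableSpace Ω] {Pr : Measure Ω}
  {R : ℝ} {law : Kernel (ForceSpace N m) (CadlagPath (ForceSpace N m))}
  {X : ℝ → Ω → ForceSpace N m} {x : Torus N}

/-- Stationarity gives the bound at all rational times almost surely. By right continuity, an excess
over `R` would persist up to a later rational time. -/
theorem ae_norm_le (hE : IsMixingForceField R law Pr X) : ∀ᵐ ω ∂Pr, ∀ r, ‖X r ω‖ ≤ R := by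
  have hs := hE.stationaryMarkov
  have h1 : ∀ q : ℚ, ∀ᵐ ω ∂Pr, ‖X q ω‖ ≤ R := fun q => by
    have h := hE.support
    rw [← hs.stationary q] at h
    exact ae_of_ae_map (hs.measurable q).aemeasurable h
  filter_upwards [ae_all_iff.2 h1] with ω hω r
  by_contra! hr
  have h2 := (hs.cadlag ω r).1.tendsto.norm.eventually_const_lt hr
  obtain ⟨u, hu, hsub⟩ := mem_nhdsGE_iff_exists_Ico_subset.1 h2
  obtain ⟨q, hq1, hq2⟩ := exists_rat_btwn (show r < u from hu)
  exact absurd (hω q) (not_le.2 (hsub ⟨hq1.le, hq2⟩))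

/-- Monotonicity gives `T γ(T) ≤ ∫ γ`. -/
theorem tendsto_antitone_integrable {γ : ℝ → ℝ} (ha : AntitoneOn γ (Ici 0))
    (hp : ∀ t, 0 ≤ t → 0 < γ t) (hi : IntegrableOn γ (Ici 0)) : Tendsto γ atTop (𝓝 0) := by
  have h1 : ∀ T, 0 < T → γ T ≤ (∫ r in Ici 0, γ r) * T⁻¹ := by
    intro T hT
    rw [← div_eq_mul_inv, le_div_iff₀ hT]
    calc γ T * T = ∫ _ in Ioc 0 T, γ T := by simp [hT.le, mul_comm]
      _ ≤ ∫ r in Ioc 0 T, γ r := by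
          refine setIntegral_mono_on (by simp)
            (hi.mono_set fun r hr => hr.1.le) measurableSet_Ioc fun r hr => ?_
          exact ha hr.1.le hT.le hr.2
      _ ≤ ∫ r in Ici 0, γ r :=
          setIntegral_mono_set hi ((ae_restrict_iff' measurableSet_Ici).2
            (Eventually.of_forall fun r hr => (hp r hr).le))
            (Eventually.of_forall fun r hr => hr.1.le)
  have h2 : Tendsto (fun T : ℝ => (∫ r in Ici 0, γ r) * T⁻¹) atTop (𝓝 0) := by
    simpa using tendsto_inv_atTop_zero.const_mul (∫ r in Ici 0, γ r)
  refine tendsto_of_tendsto_of_tendsto_of_le_of_le' tendsto_const_nhds h2 ?_ ?_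
  · filter_upwards [eventually_ge_atTop 0] with T hT using (hp T hT).le
  · filter_upwards [eventually_gt_atTop 0] with T hT using h1 T hT

/-- Dominated convergence with majorant `g`: at fixed `r` the weight `e^{-(T-r)}` tends to zero. -/
theorem tendsto_lintegral_exp_mul {g : ℝ → ℝ≥0∞} (hg : AEMeasurable g (volume.restrict (Ioi 0)))
    (hi : ∫⁻ r in Ioi (0 : ℝ), g r ≠ ∞) :
    Tendsto (fun T : ℝ => ∫⁻ r in Ioc 0 T, ENNReal.ofReal (Real.exp (-(T - r))) * g r) atTop
      (𝓝 0) := by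
  have h0 : ∫⁻ _ in Ioi (0 : ℝ), (0 : ℝ≥0∞) = 0 := lintegral_zero
  have h1 : ∀ T : ℝ, ∫⁻ r in Ioc 0 T, ENNReal.ofReal (Real.exp (-(T - r))) * g r =
      ∫⁻ r in Ioi (0 : ℝ), (Iic T).indicator
        (fun r => ENNReal.ofReal (Real.exp (-(T - r))) * g r) r := fun T => by
    rw [lintegral_indicator measurableSet_Iic, Measure.restrict_restrict measurableSet_Iic,
      inter_comm, Ioi_inter_Iic]
  simp only [h1]
  rw [← h0]
  refine tendsto_lintegral_filter_of_dominated_convergence' g (Eventually.of_forall fun T => ?_)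
    (Eventually.of_forall fun T => Eventually.of_forall fun r => ?_) hi
    ((ae_lt_top' hg hi).mono fun r hr => ?_)
  · exact (((measurable_exp_neg_sub T).ennreal_ofReal.aemeasurable).mul hg).indicator
      measurableSet_Iic
  · by_cases hr : r ∈ Iic T
    · rw [indicator_of_mem hr]
      refine mul_le_of_le_one_left zero_le ?_
      rw [ENNReal.ofReal_le_one, Real.exp_le_one_iff]
      have : r ≤ T := hr
      linarith
    · rw [indicator_of_notMem hr]; exact zero_le
  · have h2 : Tendsto (fun T : ℝ => Real.exp (-(T - r))) atTop (𝓝 0) :=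
      Real.tendsto_exp_neg_atTop_nhds_zero.comp (tendsto_atTop_add_const_right _ _ tendsto_id)
    have h3 : Tendsto (fun T : ℝ => ENNReal.ofReal (Real.exp (-(T - r))) * g r) atTop (𝓝 0) := by
      simpa using ENNReal.Tendsto.mul_const (ENNReal.tendsto_ofReal h2) (Or.inr hr.ne)
    refine tendsto_of_tendsto_of_tendsto_of_le_of_le tendsto_const_nhds h3
      (fun _ => zero_le) fun T => indicator_le_self _ _ _

theorem lintegral_le_of_le_add {α : Type*} [MeasurableSpace α] {Γ : Measure α}
    [IsProbabilityMeasure Γ] {D I d : α → ℝ≥0∞} (hI : Measurable I) {a A i d' : ℝ≥0∞}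
    (h : ∀ p, D p ≤ a + A * I p + d p) (hi : ∫⁻ p, I p ∂Γ ≤ i) (hd : ∫⁻ p, d p ∂Γ ≤ d') :
    ∫⁻ p, D p ∂Γ ≤ a + A * i + d' :=
  calc ∫⁻ p, D p ∂Γ ≤ ∫⁻ p, (a + A * I p + d p) ∂Γ := lintegral_mono h
    _ = a + A * ∫⁻ p, I p ∂Γ + ∫⁻ p, d p ∂Γ := by
        have hm : Measurable fun p => a + A * I p := measurable_const.add (hI.const_mul A)
        rw [lintegral_add_left hm, lintegral_add_left measurable_const, lintegral_const_mul A hI]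
        simp
    _ ≤ a + A * i + d' := add_le_add (add_le_add le_rfl (mul_le_mul_right hi A)) hd

theorem lintegral_weighted_force_le {F : Type*} [NormedAddCommGroup F] [NormedSpace ℝ F]
    [MeasurableSpace F] [BorelSpace F] (L : F →L[ℝ] Vel N)
    {Γ : Measure (CadlagPath F × CadlagPath F)} [IsProbabilityMeasure Γ] {g : ℝ → ℝ≥0∞}
    (hg : ∀ t : ℝ≥0, ∫⁻ p, ‖p.1.1 t - p.2.1 t‖ₑ ∂Γ ≤ g t) (T : ℝ) :
    (Measurable fun p : CadlagPath F × CadlagPath F =>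
      ∫⁻ r in Ioc 0 T, ENNReal.ofReal (Real.exp (-(T - r))) *
        ‖L (forceFrom 0 p.1 r) - L (forceFrom 0 p.2 r)‖ₑ) ∧
    ∫⁻ p, (∫⁻ r in Ioc 0 T, ENNReal.ofReal (Real.exp (-(T - r))) *
        ‖L (forceFrom 0 p.1 r) - L (forceFrom 0 p.2 r)‖ₑ) ∂Γ ≤
      ‖L‖ₑ * ∫⁻ r in Ioc 0 T, ENNReal.ofReal (Real.exp (-(T - r))) * g r := by
  have hu : Measurable (Function.uncurry fun (ω : CadlagPath F) r => L (forceFrom 0 ω r)) :=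
    measurable_uncurry_of_rightContinuous (fun _ => L.continuous.measurable.comp (measurable_eval _))
      fun ω t => (((ω.2.delay 0).continuous_comp L.continuous) t).1
  have ha : Measurable fun q : (CadlagPath F × CadlagPath F) × ℝ => L (forceFrom 0 q.1.1 q.2) :=
    hu.comp (measurable_fst.fst.prodMk measurable_snd)
  have hb : Measurable fun q : (CadlagPath F × CadlagPath F) × ℝ => L (forceFrom 0 q.1.2 q.2) :=
    hu.comp (measurable_fst.snd.prodMk measurable_snd)
  have hm : Measurable fun q : (CadlagPath F × CadlagPath F) × ℝ =>
      ENNReal.ofReal (Real.exp (-(T - q.2))) *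
        ‖L (forceFrom 0 q.1.1 q.2) - L (forceFrom 0 q.1.2 q.2)‖ₑ :=
    (((measurable_exp_neg_sub T).comp measurable_snd).ennreal_ofReal).mul (ha.sub hb).enorm
  refine ⟨Measurable.lintegral_prod_right (ν := volume.restrict (Ioc 0 T))
    (f := fun (p : CadlagPath F × CadlagPath F) (r : ℝ) =>
      ENNReal.ofReal (Real.exp (-(T - r))) *
        ‖L (forceFrom 0 p.1 r) - L (forceFrom 0 p.2 r)‖ₑ) hm, ?_⟩
  rw [lintegral_lintegral_swap hm.aemeasurable, ← lintegral_const_mul' _ _ enorm_ne_top]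
  refine setLIntegral_mono' measurableSet_Ioc fun r hr => ?_
  rw [lintegral_const_mul' _ _ (by simp), mul_left_comm]
  refine mul_le_mul_right ?_ _
  have h5 := hg r.toNNReal
  rw [Real.coe_toNNReal r hr.1.le] at h5
  refine le_trans ?_ (mul_le_mul_right h5 _)
  rw [← lintegral_const_mul' _ _ enorm_ne_top]
  refine lintegral_mono fun p => ?_
  rw [← map_sub]
  simp only [forceFrom, sub_zero]
  exact L.le_opENorm _

variable [IsProbabilityMeasure Pr] [IsMarkovKernel law]

/-- Two processes started in the ball can be coupled so that the expected distance of the solution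
to `ρ(f)` times the solution started from the Maxwellian vanishes at infinity. -/
theorem exists_coupling (L : ForceSpace N m →L[ℝ] Vel N) (hL : ∀ e, forceAt x e = L e)
    (hE : IsMixingForceField R law Pr X) (Q : Collision) (f : L1 N) {e : ForceSpace N m}
    (he : ‖e‖ ≤ R) :
    ∃ (Γ : Measure (CadlagPath (ForceSpace N m) × CadlagPath (ForceSpace N m))) (w : ℝ → ℝ≥0∞),
      Γ.fst = law e ∧ Γ.snd = (Pr.map (X 0)).bind law ∧ Tendsto w atTop (𝓝 0) ∧
      ∀ T, 0 < T →
        ∫⁻ p, edist (statePair Q x f 0 T p.1) (maxwellPair Q x (density f) 0 T p.2) ∂Γ ≤ w T := by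
  have hx : Continuous (forceAt (m := m) x) := by
    rw [show forceAt x = L from funext hL]; exact L.continuous
  obtain ⟨γ, hγc, hγa, hγp, hγi, hΓ⟩ := hE.mixing
  have hR := hE.radius_nonneg
  have hprob : IsProbabilityMeasure (Pr.map (X 0)) :=
    Measure.isProbabilityMeasure_map (hE.stationaryMarkov.measurable 0).aemeasurable
  -- The coupling lives on whole paths, so the same `Γ` controls every `T`.
  obtain ⟨Γ, h1, h2, h3⟩ := hΓ (Measure.dirac e) (Pr.map (X 0)) inferInstance hprob
    ((ae_dirac_iff (isClosed_le continuous_norm continuous_const).measurableSet).2 he) hE.support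
  rw [Measure.dirac_bind law.measurable] at h1
  have hΓp : IsProbabilityMeasure Γ := by
    refine ⟨?_⟩
    have : Γ.fst univ = 1 := by rw [h1]; exact measure_univ
    rwa [Measure.fst_univ] at this
  obtain ⟨ε, hε, hb⟩ := edist_statePair_maxwellPair_le hx f
  let g : ℝ → ℝ≥0∞ := fun r => ENNReal.ofReal (R * γ r)
  have hgi : ∫⁻ r in Ioi (0 : ℝ), g r ≠ ∞ :=
    ((hγi.mono_set Ioi_subset_Ici_self).const_mul R).lintegral_lt_top.ne
  have hgm : AEMeasurable g (volume.restrict (Ioi 0)) :=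
    ((hγi.mono_set Ioi_subset_Ici_self).const_mul R).aestronglyMeasurable.aemeasurable.ennreal_ofReal
  let A : ℝ≥0∞ := ‖density f‖ₑ * (2 * maxwellianMoment N)
  have hA : A ≠ ∞ := ENNReal.mul_ne_top (by simp)
    (ENNReal.mul_ne_top (by simp) maxwellianMoment_ne_top)
  refine ⟨Γ, fun T => ε T + A * (‖L‖ₑ * ∫⁻ r in Ioc 0 T,
    ENNReal.ofReal (Real.exp (-(T - r))) * g r) + g T, h1, h2, ?_, fun T hT => ?_⟩
  · have e1 := ENNReal.Tendsto.const_mul (ENNReal.Tendsto.const_mul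
      (tendsto_lintegral_exp_mul hgm hgi) (Or.inr (enorm_ne_top (x := L)))) (Or.inr hA)
    have e2 : Tendsto g atTop (𝓝 0) := by
      simpa using ENNReal.tendsto_ofReal ((tendsto_antitone_integrable hγa hγp hγi).const_mul R)
    simpa using (hε.add e1).add e2
  · obtain ⟨hI, hI1⟩ := lintegral_weighted_force_le (Γ := Γ) (g := g) L h3 T
    simp only [← hL] at hI hI1
    have h5 := h3 T.toNNReal
    rw [Real.coe_toNNReal T hT.le] at h5
    refine lintegral_le_of_le_add hI (fun p => ?_) hI1 (d := fun p => ‖p.1.1 T.toNNReal -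
      p.2.1 T.toNNReal‖ₑ) h5
    have h6 := hb Q T hT p.1 p.2
    simpa only [forceFrom, sub_zero, edist_eq_enorm_sub, A, mul_assoc] using h6

end MixingForce
-- Convergence in law and conditional sampling
section Distribution

variable {α E : Type*} [MeasurableSpace α] [PseudoEMetricSpace E] [MeasurableSpace E]
  [OpensMeasurableSpace E]

theorem edist_integral_le {P : Measure α} [IsProbabilityMeasure P] {φ : E → ℝ} {C : ℝ} {K : ℝ≥0}
    (hb : ∀ x y, dist (φ x) (φ y) ≤ C) (hφ : LipschitzWith K φ) {U V : α → E} (hU : Measurable U)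
    (hV : Measurable V) :
    edist (∫ a, φ (U a) ∂P) (∫ a, φ (V a) ∂P) ≤ K * ∫⁻ a, edist (U a) (V a) ∂P := by
  obtain ⟨a₀⟩ := nonempty_of_isProbabilityMeasure P
  have hi : ∀ W : α → E, Measurable W → Integrable (fun a => φ (W a)) P := fun W hW => by
    refine .of_bound (hφ.continuous.measurable.comp hW).aestronglyMeasurable
      (C + ‖φ (U a₀)‖) (Eventually.of_forall fun a => ?_)
    have h1 := hb (W a) (U a₀)
    have h2 := norm_le_norm_add_norm_sub' (φ (W a)) (φ (U a₀))
    rw [dist_eq_norm] at h1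
    linarith
  rw [edist_eq_enorm_sub, ← integral_sub (hi U hU) (hi V hV), ← lintegral_const_mul' _ _ (by simp)]
  refine (enorm_integral_le_lintegral_enorm _).trans (lintegral_mono fun a => ?_)
  rw [← edist_eq_enorm_sub]
  exact hφ (U a) (V a)

/-- Convergence in law from a coupling of the process with an approximation of the limit. -/
theorem tendstoInDistribution_of_coupling {ι Ω : Type*} [MeasurableSpace Ω] {Pr : Measure Ω}
    [IsProbabilityMeasure Pr] {P : Measure α} [IsProbabilityMeasure P] {l : Filter ι}
    [l.IsCountablyGenerated] {Γ : Measure (α × α)} [IsProbabilityMeasure Γ] {Y V : ι → α → E}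
    {Z : Ω → E} {p : ι → Ω → α} (hY : ∀ s, Measurable (Y s)) (hV : ∀ s, Measurable (V s))
    (hZ : Measurable Z) (hp : ∀ s, Measurable (p s)) (h1 : Γ.fst = P)
    (h2 : ∀ s, Γ.snd = Pr.map (p s)) {a b : ι → ℝ≥0∞} (ha : Tendsto a l (𝓝 0))
    (hb : Tendsto b l (𝓝 0))
    (hYV : ∀ᶠ s in l, ∫⁻ q, edist (Y s q.1) (V s q.2) ∂Γ ≤ a s)
    (hVZ : ∀ᶠ s in l, ∫⁻ ω, edist (V s (p s ω)) (Z ω) ∂Pr ≤ b s) :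
    TendstoInDistribution Y l Z (fun _ => P) Pr := by
  refine ⟨fun s => (hY s).aemeasurable, hZ.aemeasurable, ?_⟩
  refine tendsto_iff_forall_lipschitz_integral_tendsto.2 ?_
  rintro φ ⟨C, hC⟩ ⟨K, hK⟩
  have hφ := hK.continuous.measurable
  rw [tendsto_iff_edist_tendsto_0]
  have hlim : Tendsto (fun s => K * a s + K * b s) l (𝓝 0) := by
    simpa using (ENNReal.Tendsto.const_mul ha (Or.inr ENNReal.coe_ne_top)).add
      (ENNReal.Tendsto.const_mul hb (Or.inr ENNReal.coe_ne_top))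
  refine tendsto_of_tendsto_of_tendsto_of_le_of_le' tendsto_const_nhds hlim
    (Eventually.of_forall fun _ => zero_le) ?_
  filter_upwards [hYV, hVZ] with s hs hs'
  change edist (∫ z, φ z ∂(P.map (Y s))) (∫ z, φ z ∂(Pr.map Z)) ≤ _
  rw [integral_map (hY s).aemeasurable hφ.aestronglyMeasurable,
    integral_map hZ.aemeasurable hφ.aestronglyMeasurable]
  have e1 : ∫ z, φ (Y s z) ∂P = ∫ q, φ (Y s q.1) ∂Γ := by
    rw [← h1, Measure.fst, integral_map (f := fun z => φ (Y s z)) measurable_fst.aemeasurable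
      (hφ.comp (hY s)).aestronglyMeasurable]
  have e2 : ∫ q, φ (V s q.2) ∂Γ = ∫ ω, φ (V s (p s ω)) ∂Pr := by
    rw [← integral_map (hp s).aemeasurable (f := fun z => φ (V s z))
      (hφ.comp (hV s)).aestronglyMeasurable, ← h2 s, Measure.snd,
      integral_map (f := fun z => φ (V s z)) measurable_snd.aemeasurable (hφ.comp (hV s)).aestronglyMeasurable]
  have l1 := edist_integral_le (P := Γ) hC hK ((hY s).comp measurable_fst)
    ((hV s).comp measurable_snd)
  have l2 := edist_integral_le (P := Pr) hC hK ((hV s).comp (hp s)) hZ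
  simp only [Function.comp_apply] at l1 l2
  rw [e1]
  -- The intermediate expectation depends only on the second marginal of `Γ`, so it can also be
  -- computed under `Pr` along the path `p s`, where it is compared with the limit.
  refine (edist_triangle _ (∫ q, φ (V s q.2) ∂Γ) _).trans (add_le_add ?_ ?_)
  · exact l1.trans (mul_le_mul_right hs _)
  · rw [e2]; exact l2.trans (mul_le_mul_right hs' _)

theorem measurable_measure_map {β γ : Type*} [MeasurableSpace β] [MeasurableSpace γ]
    (κ : Kernel α β) [IsSFiniteKernel κ] {G : α × β → γ} (hG : Measurable G) :
    Measurable fun a => (κ a).map fun b => G (a, b) := by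
  refine Measure.measurable_of_measurable_coe _ fun B hB => ?_
  have h : ∀ a, ((κ a).map fun b => G (a, b)) B = κ a (Prod.mk a ⁻¹' (G ⁻¹' B)) := fun a =>
    Measure.map_apply (hG.comp measurable_prodMk_left) hB
  simp only [h]
  exact Kernel.measurable_kernel_prodMk_left (hG hB)

/-- If `U` is independent of `p` given `X`, the law of `p` given `X` being `κ`, the law of
`G(U, p)` is obtained from the joint law of `U` and `X` by sampling `p` from `κ`. -/
theorem map_eq_bind_of_restrict {Ω β γ δ ε : Type*} [MeasurableSpace Ω] [MeasurableSpace β]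
    [MeasurableSpace γ] [MeasurableSpace δ] [MeasurableSpace ε] {Pr : Measure Ω}
    [IsProbabilityMeasure Pr]
    (κ : Kernel β γ) [IsMarkovKernel κ] {W : Ω → δ × β} (hW : Measurable W) {p : Ω → γ}
    (hp : Measurable p)
    (h : ∀ A, MeasurableSet A →
      (Pr.restrict (W ⁻¹' A)).map p = (Pr.restrict (W ⁻¹' A)).bind fun ω => κ (W ω).2)
    {G : δ × γ → ε} (hG : Measurable G) :
    (Pr.map W).bind (fun z => (κ z.2).map fun y => G (z.1, y)) =
      Pr.map fun ω => G ((W ω).1, p ω) := by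
  let κ' : Kernel (δ × β) γ := κ.comap Prod.snd measurable_snd
  have hprob : IsProbabilityMeasure (Pr.map W) := Measure.isProbabilityMeasure_map hW.aemeasurable
  have hprob' : IsProbabilityMeasure (Pr.map fun ω => (W ω, p ω)) :=
    Measure.isProbabilityMeasure_map (hW.prodMk hp).aemeasurable
  -- The hypothesis is precisely the equality of the two joint laws on rectangles.
  have key : (Pr.map W) ⊗ₘ κ' = Pr.map fun ω => (W ω, p ω) := by
    refine Measure.ext_prod fun {A B} hA hB => ?_
    rw [Measure.compProd_apply_prod hA hB, Measure.map_apply (hW.prodMk hp) (hA.prod hB),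
      setLIntegral_map hA (Kernel.measurable_coe _ hB) hW]
    have h1 := congrArg (fun μ => μ B) (h A hA)
    have hk : Measurable fun ω => κ (W ω).2 := κ.measurable.comp hW.snd
    rw [Measure.bind_apply hB hk.aemeasurable, Measure.map_apply hp hB,
      Measure.restrict_apply (hp hB)] at h1
    rw [mk_preimage_prod, inter_comm]
    exact h1.symm
  have hG' : Measurable fun q : (δ × β) × γ => G (q.1.1, q.2) :=
    hG.comp (measurable_fst.fst.prodMk measurable_snd)
  have hs : Measurable fun z : δ × β => (κ z.2).map fun y => G (z.1, y) :=
    measurable_measure_map κ' hG'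
  ext B hB
  rw [Measure.bind_apply hB hs.aemeasurable]
  have h2 : Pr.map (fun ω => G ((W ω).1, p ω)) = (Pr.map fun ω => (W ω, p ω)).map
      fun q : (δ × β) × γ => G (q.1.1, q.2) :=
    (Measure.map_map hG' (hW.prodMk hp)).symm
  rw [h2, ← key, Measure.map_apply hG' hB, Measure.compProd_apply (hG' hB)]
  refine lintegral_congr fun z => ?_
  exact Measure.map_apply (hG.comp measurable_prodMk_left) hB

end Distribution

/-! ### Convergence and invariance -/

section Main

variable {N m : ℕ} {Ω : Type*} [MeasurableSpace Ω] {Pr : Measure Ω} [IsProbabilityMeasure Pr]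
  {R : ℝ} {law : Kernel (ForceSpace N m) (CadlagPath (ForceSpace N m))} [IsMarkovKernel law]
  {X : ℝ → Ω → ForceSpace N m} {x : Torus N}

theorem forceFrom_pathFrom (hX : ∀ ω, IsCadlag fun t => X t ω) (s : ℝ) (ω : Ω) {r : ℝ}
    (hr : s ≤ r) : forceFrom s (pathFrom hX s ω) r = X r ω := by
  simp [forceFrom, pathFrom, Real.coe_toNNReal _ (sub_nonneg.2 hr)]

/-- The bound holds path by path on the almost sure event that the force stays in the ball: the path
issued at `s` is the stationary one on `[s, t]`, so the force components coincide and only the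
remote past differs. -/
theorem lintegral_edist_maxwellPair_limitPair_le (L : ForceSpace N m →L[ℝ] Vel N)
    (hL : ∀ e, forceAt x e = L e) (hE : IsMixingForceField R law Pr X) (Q : Collision) (ρ : ℝ)
    {s t : ℝ} (hst : s ≤ t) :
    ∫⁻ ω, edist (maxwellPair Q x ρ s t (pathFrom hE.stationaryMarkov.cadlag s ω))
      (limitPair Q x ρ X t ω) ∂Pr ≤
    ‖ρ‖ₑ * ((2 + maxwellianMoment N * ENNReal.ofReal (‖L‖ * R)) *
      ENNReal.ofReal (Real.exp (-(t - s)))) := by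
  have hx : Continuous (forceAt (m := m) x) := by
    rw [show forceAt x = L from funext hL]; exact L.continuous
  have hc := hE.stationaryMarkov.cadlag
  have hle : ∀ᵐ ω ∂Pr, edist (maxwellPair Q x ρ s t (pathFrom hc s ω)) (limitPair Q x ρ X t ω) ≤
      ‖ρ‖ₑ * ((2 + maxwellianMoment N * ENNReal.ofReal (‖L‖ * R)) *
        ENNReal.ofReal (Real.exp (-(t - s)))) := by
    filter_upwards [ae_norm_le hE] with ω hω
    have hm := ((hc ω).continuous_comp hx).measurable
    have hK : ∀ r ≤ t, ‖forceAt x (X r ω)‖ ≤ ‖L‖ * R := fun r _ => by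
      rw [hL]; exact L.le_opNorm_of_le (hω r)
    have h1 : solution Q maxwellian (fun r => forceAt x (forceFrom s (pathFrom hc s ω) r)) s t =
        solution Q maxwellian (fun r => forceAt x (X r ω)) s t :=
      solution_congr Q _ hst fun r hr => by simp only [forceFrom_pathFrom hc s ω hr.1]
    have h2 := lintegral_solution_sub_invariantSolution_le Q hm hst hK
    rw [← edist_toL1 (integrable_solution hm Q measurable_maxwellian integrable_maxwellian s t)
      (integrable_invariantSolution hm Q t)] at h2
    unfold maxwellPair limitPair
    rw [h1, forceFrom_pathFrom hc s ω hst, Prod.edist_eq]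
    simp only [edist_self, edist_smul₀]
    refine max_le ?_ zero_le
    exact mul_le_mul_right h2 _
  exact (lintegral_mono_ae hle).trans (by simp)

theorem measurable_limitPair_stationary (hx : Continuous (forceAt (m := m) x))
    (hE : IsMixingForceField R law Pr X) (Q : Collision) (ρ t : ℝ) :
    Measurable (limitPair Q x ρ X t) :=
  measurable_limitPair hx Q ρ t hE.stationaryMarkov.cadlag
    fun r _ => hE.stationaryMarkov.measurable r

theorem tendstoInDistribution_statePair (L : ForceSpace N m →L[ℝ] Vel N)
    (hL : ∀ e, forceAt x e = L e) (hE : IsMixingForceField R law Pr X) (Q : Collision) (f : L1 N)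
    {e : ForceSpace N m} (he : ‖e‖ ≤ R) (t : ℝ) :
    TendstoInDistribution (fun s : ℝ => statePair Q x f s t) atBot
      (limitPair Q x (density f) X t) (fun _ => law e) Pr := by
  have hx : Continuous (forceAt (m := m) x) := by
    rw [show forceAt x = L from funext hL]; exact L.continuous
  have hc := hE.stationaryMarkov.cadlag
  obtain ⟨Γ, w, h1, h2, hw, hΓ⟩ := exists_coupling L hL hE Q f he
  have hΓp : IsProbabilityMeasure Γ := by
    refine ⟨?_⟩
    have : Γ.fst univ = 1 := by rw [h1]; exact measure_univ
    rwa [Measure.fst_univ] at this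
  have hts : Tendsto (fun s : ℝ => t - s) atBot atTop :=
    tendsto_atTop_add_const_left _ t tendsto_neg_atBot_atTop
  have hb : Tendsto (fun s : ℝ => ‖density f‖ₑ * ((2 + maxwellianMoment N *
      ENNReal.ofReal (‖L‖ * R)) * ENNReal.ofReal (Real.exp (-(t - s))))) atBot (𝓝 0) := by
    have h3 : Tendsto (fun s : ℝ => ENNReal.ofReal (Real.exp (-(t - s)))) atBot (𝓝 0) := by
      simpa using ENNReal.tendsto_ofReal (Real.tendsto_exp_neg_atTop_nhds_zero.comp hts)
    have h4 : 2 + maxwellianMoment N * ENNReal.ofReal (‖L‖ * R) ≠ ∞ :=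
      ENNReal.add_ne_top.2 ⟨by simp, ENNReal.mul_ne_top maxwellianMoment_ne_top (by simp)⟩
    simpa using ENNReal.Tendsto.const_mul (ENNReal.Tendsto.const_mul h3 (Or.inr h4))
      (Or.inr (enorm_ne_top (x := density f)))
  refine tendstoInDistribution_of_coupling (Γ := Γ) (V := fun s => maxwellPair Q x (density f) s t)
    (p := pathFrom hc) (fun s => measurable_statePair hx Q f s t)
    (fun s => measurable_maxwellPair hx Q _ s t) (measurable_limitPair_stationary hx hE Q _ t)
    (measurable_pathFrom hc hE.stationaryMarkov.measurable) h1
    (fun s => h2.trans (map_pathFrom hE.markovFamily hE.stationaryMarkov s).symm)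
    (hw.comp hts) hb ?_ ?_
  · filter_upwards [eventually_lt_atBot t] with s hs
    simp only [statePair_shift Q x f s t, maxwellPair_shift Q x (density f) s t]
    exact hΓ (t - s) (sub_pos.2 hs)
  · filter_upwards [eventually_le_atBot t] with s hs
    exact lintegral_edist_maxwellPair_limitPair_le L hL hE Q _ hs

/-- The law of the limit does not depend on time. -/
theorem map_limitPair_eq (L : ForceSpace N m →L[ℝ] Vel N)
    (hL : ∀ e, forceAt x e = L e) (hE : IsMixingForceField R law Pr X) (Q : Collision) (ρ t : ℝ) :
    Pr.map (limitPair Q x ρ X t) = Pr.map (limitPair Q x ρ X 0) := by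
  -- Any datum of mass `ρ`, with any initial force in the ball, would do.
  let f : L1 N := ρ • toL1 maxwellian
  have hf : density f = ρ := by
    have h1 : (f : Vel N → ℝ) =ᵐ[volume] fun v => ρ * maxwellian v := by
      simp only [f]
      rw [smul_toL1 integrable_maxwellian]
      exact coeFn_toL1 (integrable_maxwellian.const_mul ρ)
    rw [density, integral_congr_ae h1, integral_const_mul, integral_maxwellian, mul_one]
  have he : ‖(0 : ForceSpace N m)‖ ≤ R := by rw [norm_zero]; exact hE.radius_nonneg
  have h1 := tendstoInDistribution_statePair L hL hE Q f he t
  have h2 := tendstoInDistribution_statePair L hL hE Q f he 0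
  rw [hf] at h1 h2
  -- The pair depends on `t - s` only, so the family at time `t` is a reparametrisation of the one
  -- at time `0`.
  have h3 : ∀ s, statePair (m := m) Q x f s t = statePair Q x f (s - t) 0 := fun s => by
    funext ω
    rw [statePair_shift Q x f s t, statePair_shift Q x f (s - t) 0, zero_sub, neg_sub]
  simp only [h3] at h1
  have h4 : TendstoInDistribution (fun s : ℝ => statePair Q x f (s - t) 0) atBot
      (limitPair Q x ρ X 0) (fun _ => law 0) Pr :=
    ⟨fun s => h2.forall_aemeasurable (s - t), h2.aemeasurable_limit,
      h2.tendsto.comp (tendsto_atBot_add_const_right _ (-t) tendsto_id)⟩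
  exact tendstoInDistribution_unique _ h1 h4

/-- Along a bounded path this is `solution_invariantSolution` and linearity in the datum; what
remains is that the datum is the representative of an `L¹` class. -/
theorem ae_statePair_pathFrom (L : ForceSpace N m →L[ℝ] Vel N)
    (hL : ∀ e, forceAt x e = L e) (hE : IsMixingForceField R law Pr X) (Q : Collision) (ρ : ℝ)
    (τ : ℝ≥0) : ∀ᵐ ω ∂Pr, statePair Q x (limitPair Q x ρ X 0 ω).1 0 τ
      (pathFrom hE.stationaryMarkov.cadlag 0 ω) = limitPair Q x ρ X τ ω := by
  have hx : Continuous (forceAt (m := m) x) := by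
    rw [show forceAt x = L from funext hL]; exact L.continuous
  have hc := hE.stationaryMarkov.cadlag
  have hτ : (0 : ℝ) ≤ τ := τ.coe_nonneg
  filter_upwards [ae_norm_le hE] with ω hω
  have hF : IsCadlag fun r => forceAt x (X r ω) := (hc ω).continuous_comp hx
  have hm := hF.measurable
  have hK : ∀ r ≤ (τ : ℝ), ‖forceAt x (X r ω)‖ ≤ ‖L‖ * R := fun r _ => by
    rw [hL]; exact L.le_opNorm_of_le (hω r)
  have hi := integrable_invariantSolution hm Q 0
  have hi' := integrable_invariantSolution hm Q τ
  let g : Vel N → ℝ := fun v => ρ * invariantSolution Q (fun r => forceAt x (X r ω)) 0 v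
  have hg : ρ • toL1 (invariantSolution Q (fun r => forceAt x (X r ω)) 0) = toL1 g :=
    smul_toL1 hi ρ
  have hgi : Integrable g := hi.const_mul ρ
  have h1 : solution Q (toL1 g) (fun r => forceAt x (forceFrom 0 (pathFrom hc 0 ω) r)) 0 τ =
      solution Q (toL1 g) (fun r => forceAt x (X r ω)) 0 τ :=
    solution_congr Q _ hτ fun r hr => by simp only [forceFrom_pathFrom hc 0 ω hr.1]
  have h2 : solution Q (toL1 g) (fun r => forceAt x (X r ω)) 0 τ =ᵐ[volume]
      solution Q g (fun r => forceAt x (X r ω)) 0 τ :=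
    solution_congr_ae Q (measurable_coeFn _) (L1.integrable_coeFn _)
      ((measurable_invariantSolution_right hm Q 0).const_mul ρ) hgi (coeFn_toL1 hgi) hm 0 τ
  have h3 : solution Q g (fun r => forceAt x (X r ω)) 0 τ =
      fun v => ρ * invariantSolution Q (fun r => forceAt x (X r ω)) τ v := by
    funext v
    rw [solution_const_mul, solution_invariantSolution Q hm hF.locallyIntegrable hτ hK v]
  unfold statePair limitPair
  simp only
  rw [hg, h1, toL1_congr h2, h3, ← smul_toL1 hi', forceFrom_pathFrom hc 0 ω hτ]

theorem bind_stepLaw_limitPair (L : ForceSpace N m →L[ℝ] Vel N)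
    (hL : ∀ e, forceAt x e = L e) (hE : IsMixingForceField R law Pr X) (Q : Collision) (ρ : ℝ)
    (τ : ℝ≥0) :
    (Pr.map (limitPair Q x ρ X 0)).bind (stepLaw Q x law τ) = Pr.map (limitPair Q x ρ X 0) := by
  have hx : Continuous (forceAt (m := m) x) := by
    rw [show forceAt x = L from funext hL]; exact L.continuous
  have hs := hE.stationaryMarkov
  -- Adaptedness is the point: given the pair at time `0`, the future path then has the law of the
  -- process started from its force component, which is what `stepLaw` samples.
  have hp : Measurable[pastAlgebra X 0] (limitPair Q x ρ X 0) :=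
    @measurable_limitPair N m Ω x (pastAlgebra X 0) hx Q ρ 0 X hs.cadlag
      fun r hr => measurable_pastAlgebra X hr
  have h := map_eq_bind_of_restrict law (measurable_limitPair_stationary hx hE Q ρ 0)
    (measurable_pathFrom hs.cadlag hs.measurable 0)
    (fun A hA => map_pathFrom_restrict hE.markovFamily hs 0 (hp hA))
    (measurable_uncurry_statePair hx Q 0 τ)
  refine Eq.trans h ?_
  rw [← map_limitPair_eq L hL hE Q ρ τ]
  exact Measure.map_congr (ae_statePair_pathFrom L hL hE Q ρ τ)

end Main
end
end KineticMixing

open KineticMixing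
theorem mainTheorem4 (N m : ℕ) (hN : 0 < N) (hm : N + 1 < m) (R : ℝ)
    (law : Kernel (ForceSpace N m) (CadlagPath (ForceSpace N m))) [IsMarkovKernel law]
    {Ω : Type*} [MeasurableSpace Ω] (Pr : Measure Ω) [IsProbabilityMeasure Pr]
    (Ebar : ℝ → Ω → ForceSpace N m) (hE : IsMixingForceField R law Pr Ebar)
    (Q : Collision) (x : Torus N) :
    (∀ (f : L1 N) (e : ForceSpace N m), ‖e‖ ≤ R → ∀ t : ℝ,
      (∀ s ≤ t, ∀ ω : CadlagPath (ForceSpace N m),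
        Integrable (solution Q f (fun r => forceAt x (forceFrom s ω r)) s t)) ∧
      (∀ ω, Integrable (invariantSolution Q (fun r => forceAt x (Ebar r ω)) t)) ∧
      TendstoInDistribution (fun s : ℝ => statePair Q x f s t) atBot
        (limitPair Q x (density f) Ebar t) (fun _ => law e) Pr) ∧
    (∀ ρ : ℝ, ∃ μρ : Measure (L1 N × ForceSpace N m), IsProbabilityMeasure μρ ∧
      (∀ t : ℝ, Pr.map (limitPair Q x ρ Ebar t) = μρ) ∧
      ∀ τ : ℝ≥0, μρ.bind (stepLaw Q x law τ) = μρ) := by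
  -- The embedding only needs `N < 2m`, weaker than `N + 1 < m`.
  obtain ⟨L, hL⟩ := exists_forceAt_eq_clm (N := N) (m := m) (by omega) x
  have hx : Continuous (forceAt (m := m) x) := by
    rw [show forceAt x = L from funext hL]; exact L.continuous
  have hc := hE.stationaryMarkov.cadlag
  refine ⟨fun f e he t => ⟨fun s _ ω => integrable_solution_force hx Q f s t ω, fun ω =>
    integrable_invariantSolution ((hc ω).continuous_comp hx).measurable Q t,
    tendstoInDistribution_statePair L hL hE Q f he t⟩, fun ρ => ?_⟩
  exact ⟨Pr.map (limitPair Q x ρ Ebar 0), Measure.isProbabilityMeasure_map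
    (measurable_limitPair_stationary hx hE Q ρ 0).aemeasurable,
    map_limitPair_eq L hL hE Q ρ, bind_stepLaw_limitPair L hL hE Q ρ⟩
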